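/- For $T>0$, Hermitian $n\times n$ matrices $H_0,H_1$ and a control $f\in L^2(0,T)$ (real valued), let $U_f:[0,T]\to\mathbf U(n)$ be the solution of $i\dot U_f(t)=(H_0+f(t)H_1)U_f(t)$, $U_f(0)=I$ (equivalently, the continuous solution of the integrated equation). For $V\in\mathbf U(n)$ let $\mathfrak F_V(f)=\frac1n\operatorname{Re}\operatorname{Tr}[V^\dagger U_f(T)]$. For a function $g$ on $[0,T]$ let $\Pi[g]$ be the operator $\alpha\mapsto\big(\int_0^T g\alpha\big)g$ on $L^2(0,T)$, identified with its bilinear form. The pair $(H_0,H_1)$ is controllable at time $T$ if every element of $\mathbf U(n)$ is $U_f(T)$ for some $f\in L^2(0,T)$; it satisfies the exact-time Lie algebra rank condition if all iterated commutators (with at least one bracket) of $iH_0,iH_1$, joined with $iH_1$, span the real space $\mathfrak u(n)$ of skew-Hermitian matrices. For real $a,b,c,\varphi,\gamma$, a sign $\pm$, and $\varepsilon>0$, put $T=\pi/\varepsilon$ and $$H_0=\begin{pmatrix}1+\varepsilon&0&0\\0&1&0\\0&0&2\end{pmatrix},\quad H_1=\begin{pmatrix}a&1&0\\1&b&1\\0&1&c\end{pmatrix},\quad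 V^\dagger=\begin{pmatrix}e^{i\varphi}&0&0\\0&ie^{i\gamma}&0\\0&0&ie^{\pm i\gamma}\end{pmatrix}e^{iTH_0}.$$ Let $A=a^2\cos\varphi-(b^2\pm c^2)\sin\gamma$, $x=\cos\gamma-\sin\varphi$, $y=\sin\gamma\pm\sin\gamma$, $z=\cos\varphi-\sin\gamma$ and $w_\kappa=\frac{\kappa}{\pi}x+A$. (1) For all $a,b,c,\varphi,\gamma$, both signs and all $\varepsilon>0$: each $f\in L^2(0,T)$ has exactly one propagator $U_f$ on $[0,T]$; $\mathfrak F_V$ is a $C^2$ functional on $L^2(0,T)$; its gradient at $f\equiv0$ is the constant function $\frac13a\sin\varphi+\frac13(b+c)\cos\gamma$; and its Hessian (second Fréchet derivative) at $f\equiv0$ is $$(\alpha,\beta)\mapsto\frac13\iint_{0<\sigma<\tau<T}\big[x\sin(\varepsilon(\sigma-\tau))-A+y\cos(\sigma-\tau)-z\cos(\varepsilon(\sigma-\tau))\big]\,[\alpha(\sigma)\beta(\tau)+\alpha(\tau)\beta(\sigma)]\,d\sigma\,d\tau,$$ which equals the bilinear form $$-\tfrac13w_2\,\Pi[1]+\tfrac13x\sum_{k\ge1}\tfrac{4}{\pi(4k^2-1)}\big(\Pi[\sin(2k\varepsilon\,\cdot)]+\Pi[\cos(2k\varepsilon\,\cdot)]\big)+\tfrac13y\big(\Pi[\cos]+\Pi[\sin]\big)-\tfrac13z\big(\Pi[\cos(\varepsilon\,\cdot)]+\Pi[\sin(\varepsilon\,\cdot)]\big),$$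 the series converging for every pair $(\alpha,\beta)$. If, for $\kappa=4$ or more generally for some real $\kappa\ge2$, $$0=a\sin\varphi+(b+c)\cos\gamma,\quad 0<w_\kappa,\quad 0>x,\quad 0\ge y,\quad 0\le z,$$ then $f\equiv0$ is a critical point of $\mathfrak F_V$ over $L^2(0,T)$, the Hessian there is negative definite (strictly negative on every $\alpha\ne0$), and $f\equiv0$ is a local maximum of the restriction of $\mathfrak F_V$ to every finite-dimensional subspace of $L^2(0,T)$. (2) If $a,b,c$ are such that $(H_0|_{\varepsilon=0},H_1)$ satisfies the exact-time Lie algebra rank condition, then there is $\varepsilon_0>0$ such that for all $0<\varepsilon<\varepsilon_0$ the pair $(H_0,H_1)$ is controllable at time $T=\pi/\varepsilon$. (3) The constraints with $\kappa=4$, and the rank condition at $\varepsilon=0$, hold for each of the two choices - sign $-$, $a=5\sqrt{2/3}$, $b=4$, $c=1$, $\varphi=\frac{2\pi}3$, $\gamma=-\frac{3\pi}4$, - sign $+$, $a=\sqrt{2/3}$, $b=-1$, $c=0$, $\varphi=\frac\pi3$, $\gamma=-\frac\pi4$. Consequently, for these choices and every $\varepsilon>0$, $f\equiv0$ is a critical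 point with negative definite Hessian and a local maximum over every finite-dimensional subspace, with values $\mathfrak F_V(0)=-\frac16$ and $\mathfrak F_V(0)=\frac16+\frac{\sqrt2}3$ respectively; on the scale $\frac12(1+\mathfrak F_V)\in[0,1]$ these are about $42\%$ and $82\%$ (to within half a percent). For all sufficiently small $\varepsilon>0$ the system is controllable at time $T$ and the maximum of $\mathfrak F_V$ over $L^2(0,T)$ exists and equals $1$, so that $f\equiv0$ is suboptimal. -/

import Mathlib

open MeasureTheory Matrix

namespace QuantumControl

noncomputable section

/-- The control space `L²(0,T)` of real-valued controls (the end point `T` is a null set). -/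
abbrev ControlSpace (T : ℝ) : Type := Lp ℝ 2 (volume.restrict (Set.Ioc (0 : ℝ) T))

/-- The controlled Hamiltonian `H_f(t) = H₀ + f(t) H₁`. -/
def hamiltonian {n : ℕ} {T : ℝ} (H₀ H₁ : Matrix (Fin n) (Fin n) ℂ) (f : ControlSpace T) (t : ℝ) :
    Matrix (Fin n) (Fin n) ℂ :=
  H₀ + ((f t : ℝ) : ℂ) • H₁

/-- `U` solves the Schrödinger equation `i U'(t) = H_f(t) U(t)`, `U(0) = 1` on `[0,T]` (with
`ħ = 1`).  As `f` is only square integrable, the equation is meant in the sense of Carathéodory: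
`U` is continuous and satisfies the integrated equation, here written entry by entry. -/
structure IsPropagator {n : ℕ} {T : ℝ} (H₀ H₁ : Matrix (Fin n) (Fin n) ℂ) (f : ControlSpace T)
    (U : ℝ → Matrix (Fin n) (Fin n) ℂ) : Prop where
  continuousOn : ContinuousOn U (Set.Icc 0 T)
  integral_eq : ∀ t ∈ Set.Icc (0 : ℝ) T, ∀ i j : Fin n,
    U t i j = (1 : Matrix (Fin n) (Fin n) ℂ) i j
      - Complex.I * ∫ s in (0 : ℝ)..t, (hamiltonian H₀ H₁ f s * U s) i j

open Classical in
/-- The propagator `U_f`, the solution of the Schrödinger equation (only its values on `[0,T]`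
are meaningful). -/
def propagator {n : ℕ} {T : ℝ} (H₀ H₁ : Matrix (Fin n) (Fin n) ℂ) (f : ControlSpace T) :
    ℝ → Matrix (Fin n) (Fin n) ℂ :=
  if h : ∃ U, IsPropagator H₀ H₁ f U then h.choose else 0

/-- The gate fidelity `F_V(f) = (1/n) Re Tr (V† U_f(T))`, as a functional on `L²(0,T)`. -/
def gateFidelity {n : ℕ} {T : ℝ} (H₀ H₁ V : Matrix (Fin n) (Fin n) ℂ) (f : ControlSpace T) : ℝ :=
  (1 / (n : ℝ)) * (Vᴴ * propagator H₀ H₁ f T).trace.re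

/-- `f` is a critical point of `F` over `L²(0,T)`: the Fréchet derivative exists and vanishes. -/
def IsCriticalPoint {T : ℝ} (F : ControlSpace T → ℝ) (f : ControlSpace T) : Prop :=
  HasFDerivAt F (0 : ControlSpace T →L[ℝ] ℝ) f

/-- The Hessian of `F` at `f`, as a bilinear form: the second Fréchet derivative. -/
def hessian {T : ℝ} (F : ControlSpace T → ℝ) (f α β : ControlSpace T) : ℝ :=
  fderiv ℝ (fderiv ℝ F) f α β

/-- Exact-time controllability at time `T`: every unitary gate is `U_f(T)` for some control. -/
def ControllableAt {n : ℕ} (H₀ H₁ : Matrix (Fin n) (Fin n) ℂ) (T : ℝ) : Prop :=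
  ∀ g ∈ Matrix.unitaryGroup (Fin n) ℂ, ∃ f : ControlSpace T, propagator H₀ H₁ f T = g

/-- The iterated Lie brackets of two matrices `A` and `B`, including `A` and `B` themselves. -/
inductive IsBracketWord {n : ℕ} (A B : Matrix (Fin n) (Fin n) ℂ) :
    Matrix (Fin n) (Fin n) ℂ → Prop
  | fst : IsBracketWord A B A
  | snd : IsBracketWord A B B
  | bracket {X Y : Matrix (Fin n) (Fin n) ℂ} :
      IsBracketWord A B X → IsBracketWord A B Y → IsBracketWord A B (X * Y - Y * X)

/-- The exact-time Lie algebra rank condition for `u(n)`: the set of all commutator expressions in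
`i H₀` and `i H₁`, joined with `i H₁`, spans the real space of skew-Hermitian matrices. -/
def ExactTimeRankCondition {n : ℕ} (H₀ H₁ : Matrix (Fin n) (Fin n) ℂ) : Prop :=
  (Submodule.span ℝ
      ({Z | ∃ X Y, IsBracketWord (Complex.I • H₀) (Complex.I • H₁) X ∧
          IsBracketWord (Complex.I • H₀) (Complex.I • H₁) Y ∧ Z = X * Y - Y * X} ∪
        {Complex.I • H₁}) : Set (Matrix (Fin n) (Fin n) ℂ)) = {X | Xᴴ = -X}

/-- The bilinear form `(α, β) ↦ ⟨β, Π[g] α⟩` of the unnormalized projection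
`Π[g] α = (∫₀ᵀ g α) g`. -/
def proj {T : ℝ} (g : ℝ → ℝ) (α β : ControlSpace T) : ℝ :=
  (∫ t in (0 : ℝ)..T, g t * α t) * (∫ t in (0 : ℝ)..T, g t * β t)

/-- The system Hamiltonian. -/
def drift (ε : ℝ) : Matrix (Fin 3) (Fin 3) ℂ :=
  !![1 + (ε : ℂ), 0, 0; 0, 1, 0; 0, 0, 2]

/-- The control Hamiltonian. -/
def control (a b c : ℝ) : Matrix (Fin 3) (Fin 3) ℂ :=
  !![(a : ℂ), 1, 0; 1, (b : ℂ), 1; 0, 1, (c : ℂ)]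

/-- The adjoint `V†` of the target gate; `s = 1` and `s = -1` are the two choices of sign, and
the target time is `T = π / ε`. -/
def targetAdjoint (s φ γ ε : ℝ) : Matrix (Fin 3) (Fin 3) ℂ :=
  !![Complex.exp (Complex.I * φ), 0, 0;
     0, Complex.I * Complex.exp (Complex.I * γ), 0;
     0, 0, Complex.I * Complex.exp (Complex.I * (s * γ))] *
    NormedSpace.exp ((Complex.I * ((Real.pi / ε : ℝ) : ℂ)) • drift ε)

/-- The gate fidelity of the three-level problem over `L²(0, π/ε)`. -/
def trapFidelity (s a b c φ γ ε : ℝ) : ControlSpace (Real.pi / ε) → ℝ :=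
  gateFidelity (drift ε) (control a b c) (targetAdjoint s φ γ ε)ᴴ

/-- The part `a² cos φ - (b² ± c²) sin γ` of the coefficient `w`. -/
def coeffA (s a b c φ γ : ℝ) : ℝ :=
  a ^ 2 * Real.cos φ - (b ^ 2 + s * c ^ 2) * Real.sin γ

def coeffX (φ γ : ℝ) : ℝ := Real.cos γ - Real.sin φ

/-- `w = (κ/π) (cos γ - sin φ) + a² cos φ - (b² ± c²) sin γ`. -/
def coeffW (κ s a b c φ γ : ℝ) : ℝ :=
  κ / Real.pi * coeffX φ γ + coeffA s a b c φ γ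

def coeffY (s γ : ℝ) : ℝ := Real.sin γ + s * Real.sin γ

def coeffZ (φ γ : ℝ) : ℝ := Real.cos φ - Real.sin γ

/-- The constraints on the parameters. -/
structure TrapConstraints (κ s a b c φ γ : ℝ) : Prop where
  crit : 0 = a * Real.sin φ + (b + c) * Real.cos γ
  w_pos : 0 < coeffW κ s a b c φ γ
  x_neg : 0 > coeffX φ γ
  y_nonpos : 0 ≥ coeffY s γ
  z_nonneg : 0 ≤ coeffZ φ γ

/-- `f ≡ 0` is a critical point of `F` with negative definite Hessian, and so is a local maximum
over every finite-dimensional subspace of controls. -/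
structure IsAttractiveAtZero {T : ℝ} (F : ControlSpace T → ℝ) : Prop where
  critical : IsCriticalPoint F 0
  hessian_neg : ∀ α : ControlSpace T, α ≠ 0 → hessian F 0 α α < 0
  localMax : ∀ S : Submodule ℝ (ControlSpace T), FiniteDimensional ℝ S →
    IsLocalMaxOn F (S : Set (ControlSpace T)) 0

end

end QuantumControl

/-! Dynamics. In integrated form the evolution equation reads `(1 - V_f) Y = 1` in `C([0,T])`, with
`V_f` a Volterra operator affine in `f`. Iterating a Cauchy–Schwarz bound bounds the squared norm of
`V_f ^ k` by a multiple of `c ^ k / k!`, so `1 - V_f` is invertible (`IsVolterra.isUnit`). This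
gives existence and uniqueness and, inversion being smooth, smoothness in `f`. The derivatives of
the inverse `R` are products such as `R κ(α) R κ(β) R`, which variation of constants
(`resolventOf_drive_apply`) turns into the Dyson integrals of first and second order.

Hessian. At `f = 0` the propagator is diagonal and the integrands are explicit. The symmetrized
Hessian kernel depends on `s - r` only, and `ε |s - r|` stays in `[0, π]`, where the sine is `2/π`
minus a series of `cos (2kθ)` with positive coefficients (`hasSum_sin_series`). Since `cos (ω (s -
r))` splits into two rank-one kernels, the Hessian is a series of projections, all with nonpositive
coefficients under the constraints. The frequencies `0` and `2kε` have strictly negative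
coefficients and form a complete system in `L²(0, π/ε)`, so the Hessian is negative definite. The
coefficients tend to zero, so no uniform bound is available, and the second derivative test uses
compactness of the sphere of a finite-dimensional subspace.

Controllability. The rank condition yields one trajectory of the unperturbed system whose
linearization is onto (`exists_controlSpan_eq_fullSpan`). A submersion argument with `ε` as a
parameter shows that a fixed neighbourhood of its end point is reachable in the same time for all
small `ε` (`exists_nhds_reach`). Recurrence of powers and roots near `1` spread this to the whole
unitary group at one time `S` independent of `ε`; drifting freely covers all later times, and `π/ε`
exceeds `S` for small `ε`. For the examples, eight explicit brackets together with `i H₁` span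
`u(3)` when `a + b + c ≠ 0`. The value `1` is attained by steering to the target and bounds the
fidelity because entries of unitary matrices have modulus at most one. -/

namespace QuantumControl

noncomputable section

open Set

/-! ### Volterra operators on `C([0,T], E)` driven by square integrable controls. -/

section Volterra

variable {T : ℝ} {E : Type*} [NormedAddCommGroup E]

lemma ControlSpace.memLp (α : ControlSpace T) : MemLp α 2 (volume.restrict (Ioc (0 : ℝ) T)) :=
  Lp.memLp α

lemma intervalIntegrable_of_memLp (hT : 0 ≤ T) {f : ℝ → E}
    (hf : MemLp f 2 (volume.restrict (Ioc (0 : ℝ) T))) : IntervalIntegrable f volume 0 T := by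
  rw [intervalIntegrable_iff_integrableOn_Ioc_of_le hT]
  exact hf.integrable one_le_two

lemma ControlSpace.intervalIntegrable (hT : 0 ≤ T) (α : ControlSpace T) :
    IntervalIntegrable α volume 0 T :=
  intervalIntegrable_of_memLp hT α.memLp

lemma uIcc_zero_subset {t : ℝ} (ht : t ∈ Icc (0 : ℝ) T) : uIcc 0 t ⊆ uIcc 0 T := by
  rw [uIcc_of_le ht.1, uIcc_of_le (ht.1.trans ht.2)]
  exact Icc_subset_Icc_right ht.2

/-- Continuous functions on `[0,T]`. -/
abbrev Traj (T : ℝ) (E : Type*) [TopologicalSpace E] : Type _ := C(Icc (0 : ℝ) T, E)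

/-- The extension of a continuous function on `[0,T]` to the real line. -/
def Traj.ext (hT : 0 ≤ T) (Y : Traj T E) : ℝ → E := IccExtend hT Y

lemma Traj.continuous_ext (hT : 0 ≤ T) (Y : Traj T E) : Continuous (Y.ext hT) :=
  (map_continuous Y).Icc_extend'

lemma Traj.ext_of_mem (hT : 0 ≤ T) (Y : Traj T E) {t : ℝ} (ht : t ∈ Icc (0 : ℝ) T) :
    Y.ext hT t = Y ⟨t, ht⟩ := IccExtend_of_mem hT Y ht

@[simp] lemma Traj.ext_coe (hT : 0 ≤ T) (Y : Traj T E) (t : Icc (0 : ℝ) T) :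
    Y.ext hT t = Y t := Traj.ext_of_mem hT Y t.2

lemma Traj.ext_add (hT : 0 ≤ T) (Y Z : Traj T E) (t : ℝ) :
    (Y + Z).ext hT t = Y.ext hT t + Z.ext hT t := rfl

lemma Traj.norm_ext_le (hT : 0 ≤ T) (Y : Traj T E) (t : ℝ) : ‖Y.ext hT t‖ ≤ ‖Y‖ :=
  Y.norm_coe_le_norm _

variable [NormedSpace ℝ E]

lemma Traj.ext_smul (hT : 0 ≤ T) (c : ℝ) (Y : Traj T E) (t : ℝ) :
    (c • Y).ext hT t = c • Y.ext hT t := rfl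

lemma ControlSpace.norm_sq (hT : 0 ≤ T) (α : ControlSpace T) :
    ‖α‖ ^ 2 = ∫ t in (0 : ℝ)..T, α t ^ 2 := by
  rw [intervalIntegral.integral_of_le hT, ← real_inner_self_eq_norm_sq, L2.inner_def]
  simp [pow_two]

lemma sq_integral_mul_le {μ : Measure ℝ} {f g : ℝ → ℝ} (hf : MemLp f 2 μ) (hg : MemLp g 2 μ) :
    (∫ x, f x * g x ∂μ) ^ 2 ≤ (∫ x, f x ^ 2 ∂μ) * ∫ x, g x ^ 2 ∂μ := by
  have hfg : Integrable (fun x => f x * g x) μ := hf.integrable_mul hg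
  -- The quadratic `y ↦ ∫ (y f + g)²` is nonnegative, so its discriminant is nonpositive.
  have := discrim_le_zero (a := ∫ x, f x ^ 2 ∂μ) (b := 2 * ∫ x, f x * g x ∂μ)
    (c := ∫ x, g x ^ 2 ∂μ) fun y => by
      have h : 0 ≤ ∫ x, (y * f x + g x) ^ 2 ∂μ := integral_nonneg fun x => sq_nonneg _
      have e : ∫ x, (y * f x + g x) ^ 2 ∂μ
          = ∫ x, (y * y) * f x ^ 2 + ((2 * y) * (f x * g x) + g x ^ 2) ∂μ := by
        congr 1; ext x; ring
      have e2 : ∫ x, (2 * y) * (f x * g x) + g x ^ 2 ∂μ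
          = 2 * y * ∫ x, f x * g x ∂μ + ∫ x, g x ^ 2 ∂μ := by
        rw [integral_add (hfg.const_mul _) hg.integrable_sq, integral_const_mul]
      have i2 : Integrable (fun x => (2 * y) * (f x * g x) + g x ^ 2) μ :=
        (hfg.const_mul _).add hg.integrable_sq
      rw [e, integral_add (hf.integrable_sq.const_mul _) i2, e2, integral_const_mul] at h
      linarith
  rw [discrim] at this
  linarith

/-- Cauchy–Schwarz on `[0,t]`. Keeping the integral of `‖Y‖²` up to time `t`, rather than the
supremum of `‖Y‖`, is what produces the factorial under iteration. -/
lemma norm_sq_integral_smul_le (α : ControlSpace T) {Y : ℝ → E} (hY : Continuous Y) {t : ℝ}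
    (ht : t ∈ Icc (0 : ℝ) T) :
    ‖∫ s in (0 : ℝ)..t, α s • Y s‖ ^ 2 ≤ ‖α‖ ^ 2 * ∫ s in (0 : ℝ)..t, ‖Y s‖ ^ 2 := by
  have h1 : ‖∫ s in (0 : ℝ)..t, α s • Y s‖ ≤ ∫ s in (0 : ℝ)..t, |α s| * ‖Y s‖ := by
    simpa only [norm_smul, Real.norm_eq_abs] using
      intervalIntegral.norm_integral_le_integral_norm (f := fun s => α s • Y s) (μ := volume) ht.1
  have hm : MemLp α 2 (volume.restrict (Ioc 0 t)) :=
    α.memLp.mono_measure (Measure.restrict_mono_set _ (Ioc_subset_Ioc_right ht.2))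
  have hY2 : MemLp (fun s => ‖Y s‖) 2 (volume.restrict (Ioc 0 t)) := by
    refine (memLp_two_iff_integrable_sq hY.norm.aestronglyMeasurable).2 ?_
    exact ((intervalIntegrable_iff_integrableOn_Ioc_of_le ht.1).1
      ((hY.norm.pow 2).intervalIntegrable 0 t))
  have h2 := sq_integral_mul_le hm.abs hY2
  have h3 : ∫ s in Ioc 0 t, |α s| ^ 2 ≤ ‖α‖ ^ 2 := by
    rw [α.norm_sq (ht.1.trans ht.2), intervalIntegral.integral_of_le (ht.1.trans ht.2)]
    simp only [sq_abs]
    exact setIntegral_mono_set α.memLp.integrable_sq (Filter.Eventually.of_forall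
      fun x => sq_nonneg _) (Ioc_subset_Ioc_right ht.2).eventuallyLE
  calc ‖∫ s in (0 : ℝ)..t, α s • Y s‖ ^ 2 ≤ (∫ s in (0 : ℝ)..t, |α s| * ‖Y s‖) ^ 2 := by gcongr
    _ ≤ _ := by
      rw [intervalIntegral.integral_of_le ht.1, intervalIntegral.integral_of_le ht.1]
      exact h2.trans (mul_le_mul_of_nonneg_right h3 (integral_nonneg fun x => sq_nonneg _))

lemma intervalIntegrable_smul (α : ControlSpace T) {Y : ℝ → E} {t : ℝ} (ht : t ∈ Icc (0 : ℝ) T)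
    (hY : ContinuousOn Y (Icc 0 t)) :
    IntervalIntegrable (fun s => α s • Y s) volume 0 t :=
  ((α.intervalIntegrable (ht.1.trans ht.2)).mono_set (uIcc_zero_subset ht)).smul_continuousOn
    (by rwa [uIcc_of_le ht.1])

/-- The primitive `t ↦ ∫₀ᵗ α Y`. -/
def primitive (hT : 0 ≤ T) (α : ControlSpace T) (Y : Traj T E) : Traj T E where
  toFun t := ∫ s in (0 : ℝ)..t, α s • Y.ext hT s
  continuous_toFun := by
    have h := intervalIntegral.continuousOn_primitive_interval'
      (intervalIntegrable_smul α (right_mem_Icc.2 hT) (Y.continuous_ext hT).continuousOn)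
      left_mem_uIcc
    rw [uIcc_of_le hT] at h
    exact h.domRestrict

lemma primitive_apply (hT : 0 ≤ T) (α : ControlSpace T) (Y : Traj T E) (t : Icc (0 : ℝ) T) :
    primitive hT α Y t = ∫ s in (0 : ℝ)..t, α s • Y.ext hT s := rfl

/-- The bilinear Volterra operator `(α, Y) ↦ (t ↦ ∫₀ᵗ α Y)`. -/
def volterra (hT : 0 ≤ T) : ControlSpace T →L[ℝ] Traj T E →L[ℝ] Traj T E :=
  LinearMap.mkContinuous₂
    (LinearMap.mk₂ ℝ
      (fun (α : ControlSpace T) (Y : Traj T E) =>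
        primitive hT α Y)
      (fun α β Y => by
        ext t
        simp only [primitive_apply, ContinuousMap.add_apply]
        rw [← intervalIntegral.integral_add
          (intervalIntegrable_smul α t.2 (Y.continuous_ext hT).continuousOn)
          (intervalIntegrable_smul β t.2 (Y.continuous_ext hT).continuousOn)]
        refine intervalIntegral.integral_congr_ae_restrict ?_
        rw [uIoc_of_le t.2.1]
        filter_upwards [ae_restrict_of_ae_restrict_of_subset (Ioc_subset_Ioc_right t.2.2)
          (Lp.coeFn_add α β)] with s hs
        rw [hs, Pi.add_apply, add_smul])
      (fun c α Y => by
        ext t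
        simp only [primitive_apply, ContinuousMap.smul_apply]
        rw [← intervalIntegral.integral_smul]
        refine intervalIntegral.integral_congr_ae_restrict ?_
        rw [uIoc_of_le t.2.1]
        filter_upwards [ae_restrict_of_ae_restrict_of_subset (Ioc_subset_Ioc_right t.2.2)
          (Lp.coeFn_smul c α)] with s hs
        rw [hs, Pi.smul_apply, smul_eq_mul, mul_smul])
      (fun α Y Z => by
        ext t
        simp only [primitive_apply, ContinuousMap.add_apply, Traj.ext_add, smul_add]
        exact intervalIntegral.integral_add
          (intervalIntegrable_smul α t.2 (Y.continuous_ext hT).continuousOn)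
          (intervalIntegrable_smul α t.2 (Z.continuous_ext hT).continuousOn))
      (fun c α Y => by
        ext t
        simp only [primitive_apply, ContinuousMap.smul_apply, Traj.ext_smul, smul_comm _ c]
        exact intervalIntegral.integral_smul _ _))
    (√T) (fun α Y => by
      refine (ContinuousMap.norm_le _ (by positivity)).2 fun t => ?_
      refine (sq_le_sq₀ (norm_nonneg _) (by positivity)).1 ?_
      refine (norm_sq_integral_smul_le α (Y.continuous_ext hT) t.2).trans ?_
      rw [mul_pow, mul_pow, Real.sq_sqrt hT]
      have : ∫ s in (0 : ℝ)..t, ‖Y.ext hT s‖ ^ 2 ≤ ∫ s in (0 : ℝ)..t, ‖Y‖ ^ 2 :=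
        intervalIntegral.integral_mono_on t.2.1
          (((Y.continuous_ext hT).norm.pow 2).intervalIntegrable _ _)
          (continuous_const.intervalIntegrable _ _)
          fun s _ => pow_le_pow_left₀ (norm_nonneg _) (Y.norm_ext_le hT s) 2
      rw [intervalIntegral.integral_const, smul_eq_mul, sub_zero] at this
      have h2 : (t : ℝ) * ‖Y‖ ^ 2 ≤ T * ‖Y‖ ^ 2 := by gcongr; exact t.2.2
      nlinarith [sq_nonneg ‖α‖])

lemma volterra_apply (hT : 0 ≤ T) (α : ControlSpace T) (Y : Traj T E) (t : Icc (0 : ℝ) T) :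
    volterra hT α Y t = ∫ s in (0 : ℝ)..t, α s • Y.ext hT s := rfl

/-- Operators `V` of Volterra type, for which `‖V Y‖` at time `t` is controlled by the `L²` norm
of `Y` on `[0,t]`. -/
def IsVolterra (hT : 0 ≤ T) (V : Traj T E →L[ℝ] Traj T E) : Prop :=
  ∃ C : ℝ, 0 ≤ C ∧ ∀ (Y : Traj T E) (t : Icc (0 : ℝ) T),
    ‖V Y t‖ ^ 2 ≤ C * ∫ s in (0 : ℝ)..t, ‖Y.ext hT s‖ ^ 2

lemma IsVolterra.add {hT : 0 ≤ T} {V W : Traj T E →L[ℝ] Traj T E} (hV : IsVolterra hT V)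
    (hW : IsVolterra hT W) : IsVolterra hT (V + W) := by
  obtain ⟨C, hC, hV⟩ := hV
  obtain ⟨D, hD, hW⟩ := hW
  refine ⟨2 * C + 2 * D, by positivity, fun Y t => ?_⟩
  have h1 := hV Y t
  have h2 := hW Y t
  have h3 : ‖(V + W) Y t‖ ≤ ‖V Y t‖ + ‖W Y t‖ := norm_add_le _ _
  have h4 : ‖(V + W) Y t‖ ^ 2 ≤ (‖V Y t‖ + ‖W Y t‖) ^ 2 := by gcongr
  nlinarith [sq_nonneg (‖V Y t‖ - ‖W Y t‖)]

/-- Postcomposition with a continuous linear map. -/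
def postcomp (L : E →L[ℝ] E) : Traj T E →L[ℝ] Traj T E := L.compLeftContinuous ℝ _

lemma isVolterra_volterra_comp (hT : 0 ≤ T) (α : ControlSpace T) (L : E →L[ℝ] E) :
    IsVolterra hT ((volterra hT α).comp (postcomp L)) := by
  refine ⟨‖α‖ ^ 2 * ‖L‖ ^ 2, by positivity, fun Y t => ?_⟩
  refine (norm_sq_integral_smul_le α (Traj.continuous_ext hT (postcomp L Y)) t.2).trans ?_
  rw [mul_assoc]
  refine mul_le_mul_of_nonneg_left (α := ℝ) ?_ (sq_nonneg ‖α‖)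
  rw [← intervalIntegral.integral_const_mul]
  refine intervalIntegral.integral_mono_on t.2.1
    (((Traj.continuous_ext hT _).norm.pow 2).intervalIntegrable _ _)
    ((((Traj.continuous_ext hT _).norm.pow 2).intervalIntegrable _ _).const_mul _) fun s _ => ?_
  rw [← mul_pow]
  exact pow_le_pow_left₀ (norm_nonneg _) (L.le_opNorm _) 2

/-- Each application of `V` integrates the previous bound once, and `∫₀ᵗ sᵏ = tᵏ⁺¹ / (k + 1)` builds
up the factorial. -/
lemma norm_sq_pow_volterra_le {hT : 0 ≤ T} {V : Traj T E →L[ℝ] Traj T E} {C : ℝ} (hC : 0 ≤ C)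
    (hV : ∀ (Y : Traj T E) (t : Icc (0 : ℝ) T),
      ‖V Y t‖ ^ 2 ≤ C * ∫ s in (0 : ℝ)..t, ‖Y.ext hT s‖ ^ 2)
    (Y : Traj T E) (k : ℕ) (t : Icc (0 : ℝ) T) :
    ‖(V ^ k) Y t‖ ^ 2 ≤ C ^ k * (t : ℝ) ^ k / k.factorial * ‖Y‖ ^ 2 := by
  induction k generalizing t with
  | zero => simpa using pow_le_pow_left₀ (norm_nonneg _) (Y.norm_coe_le_norm t) 2
  | succ k ih =>
    rw [pow_succ' V]
    refine (hV ((V ^ k) Y) t).trans ?_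
    have h : ∫ s in (0 : ℝ)..t, ‖((V ^ k) Y).ext hT s‖ ^ 2
        ≤ ∫ s in (0 : ℝ)..t, (C ^ k / k.factorial * ‖Y‖ ^ 2) * s ^ k := by
      refine intervalIntegral.integral_mono_on t.2.1
        (((Traj.continuous_ext hT _).norm.pow 2).intervalIntegrable _ _)
        ((continuous_const.mul (continuous_id.pow k)).intervalIntegrable _ _) fun s hs => ?_
      rw [Traj.ext_of_mem hT _ ⟨hs.1, hs.2.trans t.2.2⟩]
      refine (ih _).trans (le_of_eq ?_)
      ring
    rw [intervalIntegral.integral_const_mul, integral_pow] at h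
    refine (mul_le_mul_of_nonneg_left h hC).trans (le_of_eq ?_)
    rw [Nat.factorial_succ]
    have : (k.factorial : ℝ) ≠ 0 := by positivity
    push_cast
    field_simp
    ring

/-- No smallness of `V` is needed: some power of it is a contraction, and `1 - V` divides `1 - V ^
k`. -/
lemma IsVolterra.isUnit [CompleteSpace E] {hT : 0 ≤ T} {V : Traj T E →L[ℝ] Traj T E}
    (hV : IsVolterra hT V) : IsUnit (1 - V) := by
  obtain ⟨C, hC, hV⟩ := hV
  have hlim := FloorSemiring.tendsto_pow_div_factorial_atTop (C * T)
  -- The estimate is for squared norms, so `1/4` here becomes the operator norm bound `1/2`.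
  obtain ⟨k, hk⟩ := (hlim.eventually (gt_mem_nhds (show (0 : ℝ) < 1 / 4 by norm_num))).exists
  have hnorm : ‖V ^ k‖ < 1 := by
    refine lt_of_le_of_lt (ContinuousLinearMap.opNorm_le_bound _ (M := 1 / 2) (by norm_num)
      fun Y => ?_) (by norm_num)
    refine (ContinuousMap.norm_le _ (by positivity)).2 fun t => ?_
    refine (sq_le_sq₀ (norm_nonneg _) (by positivity)).1 ?_
    refine (norm_sq_pow_volterra_le hC hV Y k t).trans ?_
    rw [mul_pow]
    refine mul_le_mul_of_nonneg_right ?_ (sq_nonneg _)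
    have : C ^ k * (t : ℝ) ^ k / k.factorial ≤ (C * T) ^ k / k.factorial := by
      rw [mul_pow]
      have := pow_le_pow_left₀ t.2.1 t.2.2 k
      gcongr
    linarith
  have hu : IsUnit (1 - V ^ k) := isUnit_one_sub_of_norm_lt_one (R := Traj T E →L[ℝ] Traj T E) hnorm
  -- `1 - V ^ k` is the product of `1 - V` and a geometric sum; the factors commute, so each is a
  -- unit.
  rw [← mul_neg_geom_sum] at hu
  exact ((Commute.isUnit_mul_iff (((Commute.one_left _).sub_left
    (Commute.sum_right _ _ _ fun i _ => (Commute.refl V).pow_right i)))).1 hu).1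

end Volterra

end

end QuantumControl

namespace QuantumControl

noncomputable section

open Set

set_option linter.unusedSectionVars false

/-! ### Product rule and variation of constants for absolutely continuous functions in a Banach
algebra. -/

section ProductRule

variable {𝔸 : Type*} [NormedRing 𝔸] [NormedAlgebra ℝ 𝔸] [CompleteSpace 𝔸]

/-- Fubini after cutting the square along its diagonal, in opposite orders on the two halves, so
that the outer variable is the larger one in both integrals. -/
lemma setIntegral_triangle {t : ℝ} {F : ℝ × ℝ → 𝔸}
    (hF : Integrable F ((volume.restrict (Ioc 0 t)).prod (volume.restrict (Ioc 0 t)))) :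
    ∫ z, F z ∂((volume.restrict (Ioc 0 t)).prod (volume.restrict (Ioc 0 t)))
      = (∫ s in Ioc 0 t, ∫ r in Ioc 0 s, F (s, r)) + ∫ r in Ioc 0 t, ∫ s in Ioc 0 r, F (s, r) := by
  have hS : MeasurableSet {z : ℝ × ℝ | z.2 ≤ z.1} := measurableSet_le measurable_snd measurable_fst
  rw [← integral_add_compl hS hF, ← integral_indicator hS, ← integral_indicator hS.compl,
    integral_prod _ (hF.indicator hS), integral_prod_symm _ (hF.indicator hS.compl)]
  congr 1
  · refine setIntegral_congr_fun measurableSet_Ioc fun s hs => ?_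
    have e : ∀ r, ({z : ℝ × ℝ | z.2 ≤ z.1}).indicator F (s, r)
        = (Iic s).indicator (fun r => F (s, r)) r := fun r => by
      simp [indicator_apply]
    simp only [e]
    rw [setIntegral_indicator measurableSet_Iic, Ioc_inter_Iic, min_eq_right hs.2]
  · refine setIntegral_congr_fun measurableSet_Ioc fun r hr => ?_
    have e : ∀ s, ({z : ℝ × ℝ | z.2 ≤ z.1}ᶜ).indicator F (s, r)
        = (Iio r).indicator (fun s => F (s, r)) s := fun s => by
      simp [indicator_apply]
    simp only [e]
    rw [setIntegral_indicator measurableSet_Iio, integral_Ioc_eq_integral_Ioo]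
    refine congrArg (fun S => ∫ s in S, F (s, r)) ?_
    ext s
    simp only [mem_inter_iff, mem_Ioc, mem_Iio, mem_Ioo]
    exact ⟨fun h => ⟨h.1.1, h.2⟩, fun h => ⟨⟨h.1, h.2.le.trans hr.2⟩, h.2⟩⟩

/-- Integration by parts for merely integrable functions: the product of the integrals is an
integral over the square, cut into two triangles. -/
lemma integral_mul_integral_eq {t : ℝ} (ht : 0 ≤ t) {φ η : ℝ → 𝔸}
    (hφ : IntervalIntegrable φ volume 0 t) (hη : IntervalIntegrable η volume 0 t) :
    (∫ s in (0 : ℝ)..t, φ s) * ∫ s in (0 : ℝ)..t, η s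
      = (∫ s in (0 : ℝ)..t, φ s * ∫ r in (0 : ℝ)..s, η r)
        + ∫ s in (0 : ℝ)..t, (∫ r in (0 : ℝ)..s, φ r) * η s := by
  have h1 := (intervalIntegrable_iff_integrableOn_Ioc_of_le ht).1 hφ
  have h2 := (intervalIntegrable_iff_integrableOn_Ioc_of_le ht).1 hη
  have h := integral_prod_bilin (ContinuousLinearMap.mul ℝ 𝔸) h1 h2
  simp only [ContinuousLinearMap.mul_apply'] at h
  simp only [intervalIntegral.integral_of_le ht]
  rw [← h, setIntegral_triangle (h1.mul_prod h2)]
  congr 1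
  · refine setIntegral_congr_fun measurableSet_Ioc fun s hs => ?_
    simp only [intervalIntegral.integral_of_le hs.1.le]
    exact integral_const_mul_of_integrable (h2.mono_set (Ioc_subset_Ioc_right hs.2))
  · refine setIntegral_congr_fun measurableSet_Ioc fun s hs => ?_
    simp only [intervalIntegral.integral_of_le hs.1.le]
    exact integral_mul_const_of_integrable (h1.mono_set (Ioc_subset_Ioc_right hs.2))

lemma _root_.IntervalIntegrable.continuousOn_primitive {T : ℝ} (hT : 0 ≤ T) {φ : ℝ → 𝔸}
    (hφ : IntervalIntegrable φ volume 0 T) :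
    ContinuousOn (fun t => ∫ s in (0 : ℝ)..t, φ s) (Icc 0 T) := by
  have h := intervalIntegral.continuousOn_primitive_interval' hφ left_mem_uIcc
  rwa [uIcc_of_le hT] at h

lemma intervalIntegrable_mul_continuousOn {T : ℝ} (hT : 0 ≤ T) {φ y : ℝ → 𝔸}
    (hφ : IntervalIntegrable φ volume 0 T) (hy : ContinuousOn y (Icc 0 T)) :
    IntervalIntegrable (fun s => φ s * y s) volume 0 T :=
  hφ.smul_continuousOn (by rwa [uIcc_of_le hT])

lemma intervalIntegrable_continuousOn_mul {T : ℝ} (hT : 0 ≤ T) {φ y : ℝ → 𝔸}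
    (hφ : IntervalIntegrable φ volume 0 T) (hy : ContinuousOn y (Icc 0 T)) :
    IntervalIntegrable (fun s => y s * φ s) volume 0 T :=
  hφ.continuousOn_smul (by rwa [uIcc_of_le hT])

/-- The product rule for absolutely continuous functions. -/
lemma mul_eq_integral {T : ℝ} {F H φ η : ℝ → 𝔸} {F₀ H₀ : 𝔸}
    (hφ : IntervalIntegrable φ volume 0 T) (hη : IntervalIntegrable η volume 0 T)
    (hF : ∀ t ∈ Icc (0 : ℝ) T, F t = F₀ + ∫ s in (0 : ℝ)..t, φ s)
    (hH : ∀ t ∈ Icc (0 : ℝ) T, H t = H₀ + ∫ s in (0 : ℝ)..t, η s) :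
    ∀ t ∈ Icc (0 : ℝ) T, F t * H t = F₀ * H₀ + ∫ s in (0 : ℝ)..t, (φ s * H s + F s * η s) := by
  intro t ht
  have hφ := hφ.mono_set (uIcc_zero_subset ht)
  have hη := hη.mono_set (uIcc_zero_subset ht)
  have e : ∫ s in (0 : ℝ)..t, (φ s * H s + F s * η s)
      = ∫ s in (0 : ℝ)..t, ((φ s * H₀ + F₀ * η s)
        + (φ s * (∫ r in (0 : ℝ)..s, η r) + (∫ r in (0 : ℝ)..s, φ r) * η s)) := by
    refine intervalIntegral.integral_congr fun s hs => ?_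
    rw [uIcc_of_le ht.1] at hs
    have hs' : s ∈ Icc 0 T := ⟨hs.1, hs.2.trans ht.2⟩
    simp only [hF s hs', hH s hs', mul_add, add_mul]
    abel
  have i1 := intervalIntegrable_mul_continuousOn ht.1 hφ (y := fun _ => H₀) continuousOn_const
  have i2 := intervalIntegrable_continuousOn_mul ht.1 hη (y := fun _ => F₀) continuousOn_const
  have i3 := intervalIntegrable_mul_continuousOn ht.1 hφ (hη.continuousOn_primitive ht.1)
  have i4 := intervalIntegrable_continuousOn_mul ht.1 hη (hφ.continuousOn_primitive ht.1)
  have c1 : ∫ s in (0 : ℝ)..t, φ s * H₀ = (∫ s in (0 : ℝ)..t, φ s) * H₀ := by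
    simp only [intervalIntegral.integral_of_le ht.1]
    exact integral_mul_const_of_integrable
      ((intervalIntegrable_iff_integrableOn_Ioc_of_le ht.1).1 hφ)
  have c2 : ∫ s in (0 : ℝ)..t, F₀ * η s = F₀ * ∫ s in (0 : ℝ)..t, η s := by
    simp only [intervalIntegral.integral_of_le ht.1]
    exact integral_const_mul_of_integrable
      ((intervalIntegrable_iff_integrableOn_Ioc_of_le ht.1).1 hη)
  rw [e, intervalIntegral.integral_add (i1.add i2) (i3.add i4), intervalIntegral.integral_add i1 i2,
    intervalIntegral.integral_add i3 i4, ← integral_mul_integral_eq ht.1 hφ hη, hF t ht, hH t ht,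
    c1, c2]
  simp only [mul_add, add_mul]
  abel

/-- `u` is the solution of the linear equation `u' = G u`, `u(0) = 1` on `[0,T]`. -/
structure IsFundamental (G : ℝ → 𝔸) (T : ℝ) (u : ℝ → 𝔸) : Prop where
  continuousOn : ContinuousOn u (Icc 0 T)
  eq_integral : ∀ t ∈ Icc (0 : ℝ) T, u t = 1 + ∫ s in (0 : ℝ)..t, G s * u s

lemma IsFundamental.map_zero {G u : ℝ → 𝔸} {T : ℝ} (hT : 0 ≤ T) (hu : IsFundamental G T u) :
    u 0 = 1 := by
  simpa using hu.eq_integral 0 (left_mem_Icc.2 hT)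

/-- The solution of the adjoint equation is a left inverse. -/
lemma IsFundamental.adjoint_mul {G u w : ℝ → 𝔸} {T : ℝ} (hT : 0 ≤ T)
    (hG : IntervalIntegrable G volume 0 T) (hu : IsFundamental G T u)
    (hw : ContinuousOn w (Icc 0 T))
    (hw' : ∀ t ∈ Icc (0 : ℝ) T, w t = 1 + ∫ s in (0 : ℝ)..t, -(w s * G s)) :
    ∀ t ∈ Icc (0 : ℝ) T, w t * u t = 1 := by
  intro t ht
  rw [mul_eq_integral (intervalIntegrable_continuousOn_mul hT hG hw).neg
    (intervalIntegrable_mul_continuousOn hT hG hu.continuousOn) hw' hu.eq_integral t ht]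
  simp [mul_assoc]

/-- Variation of constants. -/
lemma IsFundamental.variation {G u w h : ℝ → 𝔸} {T : ℝ} (hT : 0 ≤ T)
    (hG : IntervalIntegrable G volume 0 T) (hu : IsFundamental G T u)
    (hw : ContinuousOn w (Icc 0 T)) (huw : ∀ t ∈ Icc (0 : ℝ) T, u t * w t = 1)
    (hh : IntervalIntegrable h volume 0 T) :
    ∀ t ∈ Icc (0 : ℝ) T, u t * ∫ s in (0 : ℝ)..t, w s * h s
      = ∫ s in (0 : ℝ)..t, (G s * (u s * ∫ r in (0 : ℝ)..s, w r * h r) + h s) := by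
  intro t ht
  rw [mul_eq_integral (intervalIntegrable_mul_continuousOn hT hG hu.continuousOn)
    (intervalIntegrable_continuousOn_mul hT hh hw) hu.eq_integral
    (H := fun t => ∫ s in (0 : ℝ)..t, w s * h s) (H₀ := 0) (fun t _ => (zero_add _).symm) t ht,
    mul_zero, zero_add]
  refine intervalIntegral.integral_congr fun s hs => ?_
  rw [uIcc_of_le ht.1] at hs
  simp only [← mul_assoc, huw s ⟨hs.1, hs.2.trans ht.2⟩, one_mul]

end ProductRule

/-! ### Resolvents depending on a linear parameter: smoothness and first derivative. -/

section Resolvent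

variable {X P : Type*} [NormedAddCommGroup X] [NormedSpace ℝ X] [CompleteSpace X]
  [NormedAddCommGroup P] [NormedSpace ℝ P]

/-- The resolvent `(1 - K₀ - κ p)⁻¹`. -/
def resolventOf (K₀ : X →L[ℝ] X) (κ : P →L[ℝ] X →L[ℝ] X) (p : P) : X →L[ℝ] X :=
  -- `Ring.inverse` vanishes at non-units; for the operators used below the Volterra estimate
  -- excludes that case.
  Ring.inverse (1 - (K₀ + κ p))

variable {K₀ : X →L[ℝ] X} {κ : P →L[ℝ] X →L[ℝ] X}

lemma contDiff_resolventOf (h : ∀ p, IsUnit (1 - (K₀ + κ p))) {n : WithTop ℕ∞} :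
    ContDiff ℝ n (resolventOf K₀ κ) := by
  refine contDiff_iff_contDiffAt.2 fun p => ?_
  obtain ⟨x, hx⟩ := h p
  have h1 : ContDiffAt ℝ n (fun p => 1 - (K₀ + κ p)) p :=
    contDiffAt_const.sub (contDiffAt_const.add κ.contDiff.contDiffAt)
  have h2 := contDiffAt_ringInverse ℝ (n := n) x
  rw [hx] at h2
  exact h2.comp p h1

/-- The minus sign from differentiating an inverse cancels the one in `1 - (K₀ + κ p)`. Strict
differentiability is needed later for local surjectivity. -/
lemma hasStrictFDerivAt_resolventOf_apply {p : P} (h : IsUnit (1 - (K₀ + κ p))) (y : X) :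
    HasStrictFDerivAt (fun q => resolventOf K₀ κ q y)
      ((resolventOf K₀ κ p).comp (κ.flip (resolventOf K₀ κ p y))) p := by
  obtain ⟨x, hx⟩ := h
  have h1 : HasStrictFDerivAt (fun p => 1 - (K₀ + κ p)) (-κ) p :=
    (κ.hasStrictFDerivAt.const_add K₀).const_sub 1
  have h2 := hasStrictFDerivAt_ringInverse (𝕜 := ℝ) x
  rw [hx] at h2
  have h3 := (h2.comp p h1)
  have h4 := ((ContinuousLinearMap.apply ℝ X y).hasStrictFDerivAt).comp p h3
  refine h4.congr_fderiv ?_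
  have e : resolventOf K₀ κ p = (↑x⁻¹ : X →L[ℝ] X) := by
    rw [resolventOf, ← hx, Ring.inverse_unit]
  ext q
  simp [e, ContinuousLinearMap.mulLeftRight_apply]

/-- The uniqueness half: any explicit solution of the fixed-point equation is thereby identified
with the resolvent. -/
lemma resolventOf_eq {p : P} (h : IsUnit (1 - (K₀ + κ p))) {y z : X}
    (hy : y = (K₀ + κ p) y + z) : resolventOf K₀ κ p z = y := by
  have : z = (1 - (K₀ + κ p)) y := by
    rw [_root_.sub_apply, one_apply_eq_self, eq_sub_iff_add_eq', ← hy]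
  rw [this, resolventOf, ← mul_apply_eq_comp, Ring.inverse_mul_cancel _ h,
    one_apply_eq_self]

lemma resolventOf_spec {p : P} (h : IsUnit (1 - (K₀ + κ p))) (z : X) :
    resolventOf K₀ κ p z = (K₀ + κ p) (resolventOf K₀ κ p z) + z := by
  have : (1 - (K₀ + κ p)) (resolventOf K₀ κ p z) = z := by
    rw [resolventOf, ← mul_apply_eq_comp, Ring.mul_inverse_cancel _ h,
      one_apply_eq_self]
  rwa [_root_.sub_apply, one_apply_eq_self, sub_eq_iff_eq_add'] at this

end Resolvent

end

end QuantumControl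

namespace QuantumControl

noncomputable section

open Set

set_option linter.unusedSectionVars false

/-! ### Second derivative of the resolvent. -/

section Resolvent

variable {X P : Type*} [NormedAddCommGroup X] [NormedSpace ℝ X] [CompleteSpace X]
  [NormedAddCommGroup P] [NormedSpace ℝ P] {K₀ : X →L[ℝ] X} {κ : P →L[ℝ] X →L[ℝ] X}

lemma fderiv_resolventOf (h : ∀ p, IsUnit (1 - (K₀ + κ p))) (ℓ : X →L[ℝ] ℝ) (y : X) (p α : P) :
    fderiv ℝ (fun q => ℓ (resolventOf K₀ κ q y)) p α
      = ℓ (resolventOf K₀ κ p (κ α (resolventOf K₀ κ p y))) := by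
  have h1 := ℓ.hasFDerivAt.comp p (hasStrictFDerivAt_resolventOf_apply (h p) y).hasFDerivAt
  have h2 := h1.fderiv
  simp only [Function.comp_def] at h2
  rw [h2]
  simp

lemma contDiff_resolventOf_apply (h : ∀ p, IsUnit (1 - (K₀ + κ p))) (ℓ : X →L[ℝ] ℝ) (y : X)
    {n : WithTop ℕ∞} : ContDiff ℝ n (fun q => ℓ (resolventOf K₀ κ q y)) :=
  ℓ.contDiff.comp ((contDiff_resolventOf h).clm_apply contDiff_const)

/-- The first derivative contains the resolvent twice, and the product rule hits each occurrence
once; this accounts for the two orders of `α` and `β`. -/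
lemma fderiv_fderiv_resolventOf (h : ∀ p, IsUnit (1 - (K₀ + κ p))) (ℓ : X →L[ℝ] ℝ) (y : X)
    (p α β : P) :
    fderiv ℝ (fderiv ℝ (fun q => ℓ (resolventOf K₀ κ q y))) p α β
      = ℓ (resolventOf K₀ κ p (κ α (resolventOf K₀ κ p (κ β (resolventOf K₀ κ p y)))))
        + ℓ (resolventOf K₀ κ p (κ β (resolventOf K₀ κ p (κ α (resolventOf K₀ κ p y))))) := by
  have hR : DifferentiableAt ℝ (resolventOf K₀ κ) p :=
    (contDiff_resolventOf h (n := 1)).differentiable one_ne_zero p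
  have hR' : ∀ z, fderiv ℝ (resolventOf K₀ κ) p α z
      = resolventOf K₀ κ p (κ α (resolventOf K₀ κ p z)) := fun z => by
    have h1 := (hasStrictFDerivAt_resolventOf_apply (h p) z).hasFDerivAt
    have h2 := hR.hasFDerivAt.clm_apply (hasFDerivAt_const z p)
    have := congrArg (fun L => L α) (h2.unique h1)
    simpa using this
  have hF : DifferentiableAt ℝ (fderiv ℝ (fun q => ℓ (resolventOf K₀ κ q y))) p :=
    ((contDiff_resolventOf_apply h ℓ y (n := 2)).fderiv_right (m := 1) (by norm_num)).differentiable
      one_ne_zero p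
  have e1 : fderiv ℝ (fderiv ℝ (fun q => ℓ (resolventOf K₀ κ q y))) p α β
      = fderiv ℝ (fun q => fderiv ℝ (fun q => ℓ (resolventOf K₀ κ q y)) q β) p α := by
    rw [fderiv_clm_apply hF (differentiableAt_const β)]
    simp
  have e2 : (fun q => fderiv ℝ (fun q => ℓ (resolventOf K₀ κ q y)) q β)
      = fun q => ℓ (resolventOf K₀ κ q (κ β (resolventOf K₀ κ q y))) :=
    funext fun q => fderiv_resolventOf h ℓ y q β
  rw [e1, e2]
  have h1 := (hR.hasFDerivAt.clm_apply (((κ β).hasFDerivAt.comp p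
    (hasStrictFDerivAt_resolventOf_apply (h p) y).hasFDerivAt)))
  have h2 := (ℓ.hasFDerivAt.comp p h1).fderiv
  simp only [Function.comp_def] at h2
  rw [h2]
  simp [hR', add_comm]

end Resolvent

/-! ### The propagator as a resolvent, and Duhamel's formula. -/

section Flow

variable {𝔸 : Type*} [NormedRing 𝔸] [NormedAlgebra ℝ 𝔸] [CompleteSpace 𝔸] {T : ℝ}

/-- The Volterra operator `(α, Y) ↦ (t ↦ ∫₀ᵗ α B Y)`. -/
def drive (hT : 0 ≤ T) (B : 𝔸) : ControlSpace T →L[ℝ] Traj T 𝔸 →L[ℝ] Traj T 𝔸 :=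
  ((ContinuousLinearMap.compL ℝ (Traj T 𝔸) (Traj T 𝔸) (Traj T 𝔸)).flip
    (postcomp (ContinuousLinearMap.mul ℝ 𝔸 B))).comp (volterra hT)

lemma drive_apply (hT : 0 ≤ T) (B : 𝔸) (α : ControlSpace T) (Y : Traj T 𝔸) (t : Icc (0 : ℝ) T) :
    drive hT B α Y t = ∫ s in (0 : ℝ)..t, α s • (B * Y.ext hT s) := rfl

lemma isVolterra_drive (hT : 0 ≤ T) (B : 𝔸) (α : ControlSpace T) :
    IsVolterra hT (drive hT B α) := isVolterra_volterra_comp hT α _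

/-- The Volterra operator `Y ↦ (t ↦ ∫₀ᵗ A Y)`. -/
def driftOp (hT : 0 ≤ T) (A : 𝔸) : Traj T 𝔸 →L[ℝ] Traj T 𝔸 :=
  -- The constant control `1` makes the drift a special case of the control operator, so the
  -- Volterra bound is inherited.
  drive hT A (Lp.const 2 (volume.restrict (Ioc (0 : ℝ) T)) (1 : ℝ))

lemma driftOp_apply (hT : 0 ≤ T) (A : 𝔸) (Y : Traj T 𝔸) (t : Icc (0 : ℝ) T) :
    driftOp hT A Y t = ∫ s in (0 : ℝ)..t, A * Y.ext hT s := by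
  rw [driftOp, drive_apply]
  refine intervalIntegral.integral_congr_ae_restrict ?_
  rw [uIoc_of_le t.2.1]
  filter_upwards [ae_restrict_of_ae_restrict_of_subset (Ioc_subset_Ioc_right t.2.2)
    (Lp.coeFn_const 2 (volume.restrict (Ioc (0 : ℝ) T)) (1 : ℝ))] with s hs
  rw [hs, Function.const_apply, one_smul]

lemma isUnit_drift_add_drive (hT : 0 ≤ T) (A B : 𝔸) (f : ControlSpace T) :
    IsUnit (1 - (driftOp hT A + drive hT B f)) :=
  ((isVolterra_drive hT A _).add (isVolterra_drive hT B f)).isUnit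

lemma intervalIntegrable_generator (hT : 0 ≤ T) (A B : 𝔸) (f : ControlSpace T) :
    IntervalIntegrable (fun s => A + f s • B) volume 0 T :=
  (intervalIntegrable_const).add
    (intervalIntegrable_smul f (right_mem_Icc.2 hT) continuousOn_const)

lemma drift_add_drive_apply (hT : 0 ≤ T) (A B : 𝔸) (f : ControlSpace T) (Y : Traj T 𝔸)
    (t : Icc (0 : ℝ) T) :
    (driftOp hT A + drive hT B f) Y t = ∫ s in (0 : ℝ)..t, (A + f s • B) * Y.ext hT s := by
  have h1 : Continuous fun s => A * Y.ext hT s := continuous_const.mul (Y.continuous_ext hT)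
  have h2 : Continuous fun s => B * Y.ext hT s := continuous_const.mul (Y.continuous_ext hT)
  have h3 : (driftOp hT A + drive hT B f) Y t = driftOp hT A Y t + drive hT B f Y t := rfl
  rw [h3, driftOp_apply, drive_apply, ← intervalIntegral.integral_add (h1.intervalIntegrable _ _)
    (intervalIntegrable_smul f t.2 h2.continuousOn)]
  simp only [add_mul, smul_mul_assoc]

/-- The solution of `u' = (A + f B) u`, `u(0) = 1`, as a continuous function on `[0,T]`. -/
def flowTraj (hT : 0 ≤ T) (A B : 𝔸) (f : ControlSpace T) : Traj T 𝔸 :=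
  resolventOf (driftOp hT A) (drive hT B) f (ContinuousMap.const _ 1)

lemma isFundamental_flowTraj (hT : 0 ≤ T) (A B : 𝔸) (f : ControlSpace T) :
    IsFundamental (fun s => A + f s • B) T ((flowTraj hT A B f).ext hT) := by
  refine ⟨(Traj.continuous_ext hT _).continuousOn, fun t ht => ?_⟩
  rw [Traj.ext_of_mem hT _ ht]
  have h := resolventOf_spec (isUnit_drift_add_drive hT A B f) (ContinuousMap.const _ 1)
  have h' := congrArg (fun Y : Traj T 𝔸 => Y ⟨t, ht⟩) h
  simp only [ContinuousMap.add_apply, drift_add_drive_apply, ContinuousMap.const_apply] at h'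
  rw [add_comm]
  exact h'

lemma restrict_ext_eqOn (hT : 0 ≤ T) {u : ℝ → 𝔸} (hu : ContinuousOn u (Icc 0 T)) :
    EqOn (Traj.ext hT (⟨_, hu.domRestrict⟩ : Traj T 𝔸)) u (Icc 0 T) := fun t ht => by
  rw [Traj.ext_of_mem hT _ ht]
  rfl

lemma IsFundamental.eqOn_flowTraj (hT : 0 ≤ T) {A B : 𝔸} {f : ControlSpace T} {u : ℝ → 𝔸}
    (hu : IsFundamental (fun s => A + f s • B) T u) :
    EqOn u ((flowTraj hT A B f).ext hT) (Icc 0 T) := by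
  have key : flowTraj hT A B f = ⟨_, hu.continuousOn.domRestrict⟩ := by
    refine resolventOf_eq (isUnit_drift_add_drive hT A B f) ?_
    ext t
    rw [ContinuousMap.add_apply, drift_add_drive_apply, ContinuousMap.const_apply, add_comm]
    change u t = _
    rw [hu.eq_integral t t.2]
    congr 1
    refine intervalIntegral.integral_congr fun s hs => ?_
    rw [uIcc_of_le t.2.1] at hs
    simp only [restrict_ext_eqOn hT hu.continuousOn ⟨hs.1, hs.2.trans t.2.2⟩]
  rw [key]
  exact (restrict_ext_eqOn hT hu.continuousOn).symm

/-- Duhamel's formula: the resolvent of an inhomogeneity `∫ α B Y` is the variation of constants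
integral, with `w` the inverse of `u`. The right-hand side satisfies the fixed-point equation, and
uniqueness does the rest. -/
lemma resolventOf_drive_apply (hT : 0 ≤ T) {A B : 𝔸} {f : ControlSpace T} {u w : ℝ → 𝔸}
    (hu : IsFundamental (fun s => A + f s • B) T u) (hw : ContinuousOn w (Icc 0 T))
    (huw : ∀ t ∈ Icc (0 : ℝ) T, u t * w t = 1) (α : ControlSpace T) (Y : Traj T 𝔸)
    (t : Icc (0 : ℝ) T) :
    resolventOf (driftOp hT A) (drive hT B) f (drive hT B α Y) t
      = u t * ∫ s in (0 : ℝ)..t, α s • (w s * (B * Y.ext hT s)) := by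
  have hG := intervalIntegrable_generator hT A B f
  have hB : Continuous fun s => B * Y.ext hT s := continuous_const.mul (Y.continuous_ext hT)
  have hh : IntervalIntegrable (fun s => α s • (B * Y.ext hT s)) volume 0 T :=
    intervalIntegrable_smul α (right_mem_Icc.2 hT) hB.continuousOn
  have hwh := intervalIntegrable_continuousOn_mul hT hh hw
  have hc : ContinuousOn (fun t => u t * ∫ s in (0 : ℝ)..t, w s * (α s • (B * Y.ext hT s)))
      (Icc 0 T) := hu.continuousOn.mul (hwh.continuousOn_primitive hT)
  have key : resolventOf (driftOp hT A) (drive hT B) f (drive hT B α Y)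
      = ⟨_, hc.domRestrict⟩ := by
    refine resolventOf_eq (isUnit_drift_add_drive hT A B f) ?_
    ext t
    rw [ContinuousMap.add_apply, drift_add_drive_apply, drive_apply]
    change u t * ∫ s in (0 : ℝ)..t, w s * (α s • (B * Y.ext hT s)) = _
    rw [hu.variation hT hG hw huw hh t t.2, intervalIntegral.integral_add]
    · congr 1
      refine intervalIntegral.integral_congr fun s hs => ?_
      rw [uIcc_of_le t.2.1] at hs
      simp only [restrict_ext_eqOn hT hc ⟨hs.1, hs.2.trans t.2.2⟩]
    · exact (intervalIntegrable_mul_continuousOn hT hG hc).mono_set (uIcc_zero_subset t.2)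
    · exact hh.mono_set (uIcc_zero_subset t.2)
  rw [key]
  change u t * ∫ s in (0 : ℝ)..t, w s * (α s • (B * Y.ext hT s)) = _
  simp only [mul_smul_comm]

end Flow

end

end QuantumControl

namespace QuantumControl

noncomputable section

open Set

set_option linter.unusedSectionVars false

/-! ### Derivatives of functionals of the end point of the flow. -/

section Endpoint

variable {𝔸 : Type*} [NormedRing 𝔸] [NormedAlgebra ℝ 𝔸] [CompleteSpace 𝔸] {T : ℝ}

lemma IsFundamental.congr_ae {G G' u : ℝ → 𝔸} (hu : IsFundamental G T u)
    (h : ∀ᵐ s ∂(volume.restrict (Ioc 0 T)), G s = G' s) : IsFundamental G' T u := by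
  refine ⟨hu.continuousOn, fun t ht => ?_⟩
  rw [hu.eq_integral t ht]
  congr 1
  refine intervalIntegral.integral_congr_ae_restrict ?_
  rw [uIoc_of_le ht.1]
  filter_upwards [ae_restrict_of_ae_restrict_of_subset (Ioc_subset_Ioc_right ht.2) h] with s hs
  rw [hs]

lemma isFundamental_exp (C : 𝔸) (T : ℝ) :
    IsFundamental (fun _ => C) T (fun t => NormedSpace.exp (t • C)) := by
  have hd : ∀ t : ℝ, HasDerivAt (fun t : ℝ => NormedSpace.exp (t • C))
      (C * NormedSpace.exp (t • C)) t := fun t => hasDerivAt_exp_smul_const' C t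
  have hc : Continuous fun t : ℝ => NormedSpace.exp (t • C) :=
    continuous_iff_continuousAt.2 fun t => (hd t).continuousAt
  refine ⟨hc.continuousOn, fun t ht => ?_⟩
  rw [intervalIntegral.integral_eq_sub_of_hasDerivAt (fun s _ => hd s)
    ((continuous_const.mul hc).intervalIntegrable _ _)]
  simp

/-- The functional `f ↦ ℓ (u_f (T))` of the end point. -/
def endpointFunctional (hT : 0 ≤ T) (A B : 𝔸) (ℓ : 𝔸 →L[ℝ] ℝ) (f : ControlSpace T) : ℝ :=
  (ℓ.comp (ContinuousMap.evalCLM ℝ (⟨T, right_mem_Icc.2 hT⟩ : Icc (0 : ℝ) T)))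
    (resolventOf (driftOp hT A) (drive hT B) f (ContinuousMap.const _ 1))

lemma endpointFunctional_eq (hT : 0 ≤ T) (A B : 𝔸) (ℓ : 𝔸 →L[ℝ] ℝ) (f : ControlSpace T) :
    endpointFunctional hT A B ℓ f = ℓ ((flowTraj hT A B f).ext hT T) := by
  rw [Traj.ext_of_mem hT _ (right_mem_Icc.2 hT)]
  rfl

lemma contDiff_endpointFunctional (hT : 0 ≤ T) (A B : 𝔸) (ℓ : 𝔸 →L[ℝ] ℝ) {n : WithTop ℕ∞} :
    ContDiff ℝ n (endpointFunctional hT A B ℓ) :=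
  contDiff_resolventOf_apply (isUnit_drift_add_drive hT A B) _ _

variable {A B : 𝔸} {f : ControlSpace T} {u w : ℝ → 𝔸}

lemma fderiv_endpointFunctional (hT : 0 ≤ T) (ℓ : 𝔸 →L[ℝ] ℝ)
    (hu : IsFundamental (fun s => A + f s • B) T u) (hw : ContinuousOn w (Icc 0 T))
    (huw : ∀ t ∈ Icc (0 : ℝ) T, u t * w t = 1) (α : ControlSpace T) :
    fderiv ℝ (endpointFunctional hT A B ℓ) f α
      = ∫ s in (0 : ℝ)..T, α s * ℓ (u T * (w s * (B * u s))) := by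
  have hg : ContinuousOn (fun s => w s * (B * u s)) (Icc 0 T) :=
    hw.mul (continuousOn_const.mul hu.continuousOn)
  have e := fderiv_resolventOf (isUnit_drift_add_drive hT A B)
    (ℓ.comp (ContinuousMap.evalCLM ℝ (⟨T, right_mem_Icc.2 hT⟩ : Icc (0 : ℝ) T)))
    (ContinuousMap.const _ 1) f α
  have e2 : ∫ s in (0 : ℝ)..T, α s • (w s * (B * (flowTraj hT A B f).ext hT s))
      = ∫ s in (0 : ℝ)..T, α s • (w s * (B * u s)) := by
    refine intervalIntegral.integral_congr fun s hs => ?_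
    rw [uIcc_of_le hT] at hs
    simp only [hu.eqOn_flowTraj hT hs]
  refine e.trans ?_
  simp only [ContinuousLinearMap.comp_apply, ContinuousMap.evalCLM_apply]
  rw [resolventOf_drive_apply hT hu hw huw]
  refine (congrArg (fun z => ℓ (u T * z)) e2).trans ?_
  have := ContinuousLinearMap.intervalIntegral_comp_comm
    (ℓ.comp (ContinuousLinearMap.mul ℝ 𝔸 (u T)))
    (intervalIntegrable_smul α (right_mem_Icc.2 hT) hg)
  simp only [ContinuousLinearMap.comp_apply, ContinuousLinearMap.mul_apply'] at this
  rw [← this]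
  simp

/-- Two nested uses of Duhamel's formula give the time-ordered Dyson term, with the later operator
on the left. -/
lemma fderiv_fderiv_endpointFunctional (hT : 0 ≤ T) (ℓ : 𝔸 →L[ℝ] ℝ)
    (hu : IsFundamental (fun s => A + f s • B) T u) (hw : ContinuousOn w (Icc 0 T))
    (huw : ∀ t ∈ Icc (0 : ℝ) T, u t * w t = 1) (α β : ControlSpace T) :
    fderiv ℝ (fderiv ℝ (endpointFunctional hT A B ℓ)) f α β
      = (∫ τ in (0 : ℝ)..T, α τ * ∫ σ in (0 : ℝ)..τ,
          β σ * ℓ (u T * ((w τ * (B * u τ)) * (w σ * (B * u σ)))))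
        + ∫ τ in (0 : ℝ)..T, β τ * ∫ σ in (0 : ℝ)..τ,
          α σ * ℓ (u T * ((w τ * (B * u τ)) * (w σ * (B * u σ)))) := by
  have hg : ContinuousOn (fun s => w s * (B * u s)) (Icc 0 T) :=
    hw.mul (continuousOn_const.mul hu.continuousOn)
  have key : ∀ α β : ControlSpace T,
      ℓ (resolventOf (driftOp hT A) (drive hT B) f (drive hT B α
        (resolventOf (driftOp hT A) (drive hT B) f (drive hT B β
          (resolventOf (driftOp hT A) (drive hT B) f (ContinuousMap.const _ 1)))))
        (⟨T, right_mem_Icc.2 hT⟩ : Icc (0 : ℝ) T))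
      = ∫ τ in (0 : ℝ)..T, α τ * ∫ σ in (0 : ℝ)..τ,
          β σ * ℓ (u T * ((w τ * (B * u τ)) * (w σ * (B * u σ)))) := fun α β => by
    have i1 := intervalIntegrable_smul β (right_mem_Icc.2 hT) hg
    have c1 : ContinuousOn (fun τ => (w τ * (B * u τ)) *
        ∫ σ in (0 : ℝ)..τ, β σ • (w σ * (B * u σ))) (Icc 0 T) :=
      hg.mul (i1.continuousOn_primitive hT)
    have e2 : ∀ s ∈ Icc 0 T, w s * (B * (resolventOf (driftOp hT A) (drive hT B) f (drive hT B β
          (resolventOf (driftOp hT A) (drive hT B) f (ContinuousMap.const _ 1)))).ext hT s)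
        = (w s * (B * u s)) * ∫ σ in (0 : ℝ)..s, β σ • (w σ * (B * u σ)) := fun s hs => by
      rw [Traj.ext_of_mem hT _ hs, resolventOf_drive_apply hT hu hw huw]
      simp only [mul_assoc]
      congr 3
      refine intervalIntegral.integral_congr fun r hr => ?_
      rw [uIcc_of_le hs.1] at hr
      simp only [hu.eqOn_flowTraj hT ⟨hr.1, hr.2.trans hs.2⟩]
      rfl
    rw [resolventOf_drive_apply hT hu hw huw]
    have e3 : ∫ s in (0 : ℝ)..T, α s • (w s * (B *
        (resolventOf (driftOp hT A) (drive hT B) f (drive hT B β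
          (resolventOf (driftOp hT A) (drive hT B) f (ContinuousMap.const _ 1)))).ext hT s))
        = ∫ s in (0 : ℝ)..T, α s • ((w s * (B * u s)) *
            ∫ σ in (0 : ℝ)..s, β σ • (w σ * (B * u σ))) := by
      refine intervalIntegral.integral_congr fun s hs => ?_
      rw [uIcc_of_le hT] at hs
      simp only [e2 s hs]
    simp only [e3]
    have h1 := ContinuousLinearMap.intervalIntegral_comp_comm
      (ℓ.comp (ContinuousLinearMap.mul ℝ 𝔸 (u T)))
      (intervalIntegrable_smul α (right_mem_Icc.2 hT) c1)
    simp only [ContinuousLinearMap.comp_apply, ContinuousLinearMap.mul_apply'] at h1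
    rw [← h1]
    refine intervalIntegral.integral_congr fun τ hτ => ?_
    rw [uIcc_of_le hT] at hτ
    have h2 := ContinuousLinearMap.intervalIntegral_comp_comm
      (ℓ.comp ((ContinuousLinearMap.mul ℝ 𝔸 (u T)).comp
        (ContinuousLinearMap.mul ℝ 𝔸 (w τ * (B * u τ)))))
      (i1.mono_set (uIcc_zero_subset hτ))
    simp only [ContinuousLinearMap.comp_apply, ContinuousLinearMap.mul_apply'] at h2
    simp only [mul_smul_comm, map_smul, smul_eq_mul]
    congr 1
    rw [← h2]
    simp only [mul_smul_comm, map_smul, smul_eq_mul]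
  refine (fderiv_fderiv_resolventOf (isUnit_drift_add_drive hT A B)
    (ℓ.comp (ContinuousMap.evalCLM ℝ (⟨T, right_mem_Icc.2 hT⟩ : Icc (0 : ℝ) T)))
    (ContinuousMap.const _ 1) f α β).trans ?_
  simp only [ContinuousLinearMap.comp_apply, ContinuousMap.evalCLM_apply]
  rw [key, key]

lemma fderiv_fderiv_endpointFunctional_eq_integral (hT : 0 ≤ T) (ℓ : 𝔸 →L[ℝ] ℝ)
    (hu : IsFundamental (fun s => A + f s • B) T u) (hw : ContinuousOn w (Icc 0 T))
    (huw : ∀ t ∈ Icc (0 : ℝ) T, u t * w t = 1) (α β : ControlSpace T) :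
    fderiv ℝ (fderiv ℝ (endpointFunctional hT A B ℓ)) f α β
      = ∫ τ in (0 : ℝ)..T, ∫ σ in (0 : ℝ)..τ,
          ℓ (u T * ((w τ * (B * u τ)) * (w σ * (B * u σ)))) * (α σ * β τ + α τ * β σ) := by
  rw [fderiv_fderiv_endpointFunctional hT ℓ hu hw huw]
  have hg : ContinuousOn (fun s => w s * (B * u s)) (Icc 0 T) :=
    hw.mul (continuousOn_const.mul hu.continuousOn)
  generalize u T = x
  generalize hgd : (fun s => w s * (B * u s)) = g at hg
  have hgs : ∀ s, w s * (B * u s) = g s := fun s => congrFun hgd s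
  simp only [hgs]
  have hk : ∀ τ, ContinuousOn (fun σ => ℓ (x * (g τ * g σ))) (Icc 0 T) := fun τ =>
    ℓ.continuous.comp_continuousOn (continuousOn_const.mul (continuousOn_const.mul hg))
  have hin : ∀ (γ : ControlSpace T), ∀ τ ∈ Icc 0 T,
      IntervalIntegrable (fun σ => γ σ * ℓ (x * (g τ * g σ))) volume 0 τ := fun γ τ hτ =>
    intervalIntegrable_smul γ hτ ((hk τ).mono (Icc_subset_Icc_right hτ.2))
  have hc : ∀ γ : ControlSpace T,
      -- The kernel factors through `g τ * g σ`, so this integral is `ℓ` of `x g(τ)` times a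
      -- continuous primitive.
      ContinuousOn (fun τ => ∫ σ in (0 : ℝ)..τ, γ σ * ℓ (x * (g τ * g σ))) (Icc 0 T) := fun γ => by
    have i1 := intervalIntegrable_smul γ (right_mem_Icc.2 hT) hg
    refine (ℓ.continuous.comp_continuousOn (continuousOn_const.mul
      (hg.mul (i1.continuousOn_primitive hT)))).congr (f := fun τ => ℓ (x * (g τ * _)))
        fun τ hτ => ?_
    have h2 := ContinuousLinearMap.intervalIntegral_comp_comm
      (ℓ.comp ((ContinuousLinearMap.mul ℝ 𝔸 x).comp (ContinuousLinearMap.mul ℝ 𝔸 (g τ))))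
      (i1.mono_set (uIcc_zero_subset hτ))
    simp only [ContinuousLinearMap.comp_apply, ContinuousLinearMap.mul_apply'] at h2
    change _ = ℓ (x * (g τ * ∫ s in (0 : ℝ)..τ, γ s • g s))
    rw [← h2]
    simp only [mul_smul_comm, map_smul, smul_eq_mul]
  have hα := intervalIntegrable_smul α (right_mem_Icc.2 hT) (hc β)
  have hβ := intervalIntegrable_smul β (right_mem_Icc.2 hT) (hc α)
  simp only [smul_eq_mul] at hα hβ
  rw [← intervalIntegral.integral_add hα hβ]
  refine intervalIntegral.integral_congr fun τ hτ => ?_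
  rw [uIcc_of_le hT] at hτ
  rw [← intervalIntegral.integral_const_mul, ← intervalIntegral.integral_const_mul,
    ← intervalIntegral.integral_add ((hin β τ hτ).const_mul _) ((hin α τ hτ).const_mul _)]
  refine intervalIntegral.integral_congr fun σ _ => ?_
  ring

end Endpoint

/-! ### Translation between the matrix Schrödinger equation and the abstract flow. -/

section Propagator

attribute [local instance] Matrix.linftyOpNormedRing Matrix.linftyOpNormedAlgebra

variable {n : ℕ} {T : ℝ} {H₀ H₁ : Matrix (Fin n) (Fin n) ℂ} {f : ControlSpace T}
  {U : ℝ → Matrix (Fin n) (Fin n) ℂ}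

lemma neg_I_smul_hamiltonian (s : ℝ) :
    -Complex.I • H₀ + f s • (-Complex.I • H₁) = -Complex.I • hamiltonian H₀ H₁ f s := by
  rw [hamiltonian, smul_add, ← Complex.coe_smul (f s), smul_comm]

lemma integral_generator_apply (hT : 0 ≤ T) (hU : ContinuousOn U (Icc 0 T)) {t : ℝ}
    (ht : t ∈ Icc 0 T) (i j : Fin n) :
    (∫ s in (0 : ℝ)..t, (-Complex.I • H₀ + f s • (-Complex.I • H₁)) * U s) i j
      = -(Complex.I * ∫ s in (0 : ℝ)..t, (hamiltonian H₀ H₁ f s * U s) i j) := by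
  have h1 := (intervalIntegrable_mul_continuousOn hT
    (intervalIntegrable_generator hT (-Complex.I • H₀) (-Complex.I • H₁) f) hU).mono_set
    (uIcc_zero_subset ht)
  refine (ContinuousLinearMap.intervalIntegral_comp_comm
    (LinearMap.toContinuousLinearMap (Matrix.entryLinearMap ℝ ℂ i j)) h1).symm.trans ?_
  rw [← neg_mul, ← intervalIntegral.integral_const_mul]
  refine intervalIntegral.integral_congr fun s _ => ?_
  change ((-Complex.I • H₀ + f s • (-Complex.I • H₁)) * U s) i j = _
  rw [neg_I_smul_hamiltonian, smul_mul_assoc, Matrix.smul_apply, smul_eq_mul]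

/-- Entry evaluation is a continuous linear map, so the entrywise integrals agree with the Bochner
integral of matrices. -/
lemma isPropagator_iff (hT : 0 ≤ T) :
    IsPropagator H₀ H₁ f U ↔
      IsFundamental (fun s => -Complex.I • H₀ + f s • (-Complex.I • H₁)) T U := by
  refine ⟨fun h => ⟨h.continuousOn, fun t ht => ?_⟩, fun h => ⟨h.continuousOn, fun t ht i j => ?_⟩⟩
  · ext i j
    rw [h.integral_eq t ht, Matrix.add_apply, integral_generator_apply hT h.continuousOn ht,
      sub_eq_add_neg]
  · have := congrFun (congrFun (h.eq_integral t ht) i) j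
    rw [this, Matrix.add_apply, integral_generator_apply hT h.continuousOn ht, sub_eq_add_neg]

lemma isPropagator_propagator (hT : 0 ≤ T) (H₀ H₁ : Matrix (Fin n) (Fin n) ℂ)
    (f : ControlSpace T) : IsPropagator H₀ H₁ f (propagator H₀ H₁ f) := by
  have h : ∃ U, IsPropagator H₀ H₁ f U :=
    ⟨_, (isPropagator_iff hT).2 (isFundamental_flowTraj hT _ _ f)⟩
  rw [propagator, dif_pos h]
  exact h.choose_spec

lemma IsPropagator.eqOn {U' : ℝ → Matrix (Fin n) (Fin n) ℂ} (hT : 0 ≤ T)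
    (hU : IsPropagator H₀ H₁ f U) (hU' : IsPropagator H₀ H₁ f U') : EqOn U U' (Icc 0 T) :=
  (((isPropagator_iff hT).1 hU).eqOn_flowTraj hT).trans
    (((isPropagator_iff hT).1 hU').eqOn_flowTraj hT).symm

/-- The functional `X ↦ (1/n) Re Tr (V† X)`. -/
def fidelityFunctional (V : Matrix (Fin n) (Fin n) ℂ) : Matrix (Fin n) (Fin n) ℂ →L[ℝ] ℝ :=
  LinearMap.toContinuousLinearMap
    ((1 / (n : ℝ)) • (Complex.reLm ∘ₗ (Matrix.traceLinearMap (Fin n) ℝ ℂ) ∘ₗ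
      LinearMap.mulLeft ℝ Vᴴ))

lemma fidelityFunctional_apply (V X : Matrix (Fin n) (Fin n) ℂ) :
    fidelityFunctional V X = 1 / (n : ℝ) * (Vᴴ * X).trace.re := rfl

lemma gateFidelity_eq (hT : 0 ≤ T) (V : Matrix (Fin n) (Fin n) ℂ) :
    gateFidelity (T := T) H₀ H₁ V
      = endpointFunctional hT (-Complex.I • H₀) (-Complex.I • H₁) (fidelityFunctional V) := by
  ext f
  refine Eq.trans ?_ (endpointFunctional_eq hT _ _ (fidelityFunctional V) f).symm
  refine Eq.trans ?_ (fidelityFunctional_apply V _).symm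
  rw [gateFidelity, ((isPropagator_iff hT).1 (isPropagator_propagator hT H₀ H₁ f)).eqOn_flowTraj hT
      (right_mem_Icc.2 hT)]

end Propagator

end

end QuantumControl

namespace QuantumControl

noncomputable section

open Set

set_option linter.unusedSectionVars false

/-! ### The three-level system along its free evolution. -/

section ThreeLevel

attribute [local instance] Matrix.linftyOpNormedRing Matrix.linftyOpNormedAlgebra

/-- The energies of the drift. -/
def energy (ε : ℝ) : Fin 3 → ℝ := ![1 + ε, 1, 2]

lemma drift_eq_diagonal (ε : ℝ) : drift ε = diagonal fun j => (energy ε j : ℂ) := by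
  ext i j
  fin_cases i <;> fin_cases j <;> simp [drift, energy]

lemma exp_smul_drift (z : ℂ) (ε : ℝ) :
    NormedSpace.exp (z • drift ε) = diagonal fun j => Complex.exp (z * energy ε j) := by
  have h : z • drift ε = diagonal fun j => z * energy ε j := by
    rw [drift_eq_diagonal, ← diagonal_smul]; rfl
  rw [h, Matrix.exp_diagonal]
  congr 1
  ext j
  rw [Pi.coe_exp, Complex.exp_eq_exp_ℂ]

/-- The free evolution. -/
def freeEvolution (ε t : ℝ) : Matrix (Fin 3) (Fin 3) ℂ :=
  diagonal fun j => Complex.exp (-(energy ε j * t : ℝ) * Complex.I)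

/-- The inverse of the free evolution. -/
def freeInverse (ε t : ℝ) : Matrix (Fin 3) (Fin 3) ℂ :=
  diagonal fun j => Complex.exp ((energy ε j * t : ℝ) * Complex.I)

lemma freeEvolution_mul_freeInverse (ε t : ℝ) : freeEvolution ε t * freeInverse ε t = 1 := by
  rw [freeEvolution, freeInverse, diagonal_mul_diagonal, ← diagonal_one]
  congr 1
  ext j
  rw [← Complex.exp_add, neg_mul, neg_add_cancel, Complex.exp_zero]

lemma continuous_freeInverse (ε : ℝ) : Continuous (freeInverse ε) :=
  Continuous.matrix_diagonal (by fun_prop)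

lemma isFundamental_freeEvolution (a b c ε T : ℝ) :
    IsFundamental (fun s => -Complex.I • drift ε
      + (0 : ControlSpace T) s • (-Complex.I • control a b c)) T (freeEvolution ε) := by
  have h : (fun t : ℝ => NormedSpace.exp (t • (-Complex.I • drift ε))) = freeEvolution ε := by
    ext1 t
    rw [← Complex.coe_smul t, smul_smul, exp_smul_drift, freeEvolution]
    congr 1
    ext j
    congr 1
    push_cast
    ring
  rw [← h]
  refine (isFundamental_exp _ T).congr_ae ?_
  filter_upwards [Lp.coeFn_zero ℝ 2 (volume.restrict (Ioc (0 : ℝ) T))] with s hs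
  rw [hs, Pi.zero_apply, zero_smul, add_zero]

/-- The phases of the diagonal gate `V† exp (-i T H₀)`. -/
def gatePhase (s φ γ : ℝ) : Fin 3 → ℝ := ![φ, γ + Real.pi / 2, s * γ + Real.pi / 2]

lemma targetAdjoint_eq (s φ γ ε : ℝ) :
    targetAdjoint s φ γ ε = diagonal (fun j => Complex.exp (gatePhase s φ γ j * Complex.I))
      * freeInverse ε (Real.pi / ε) := by
  have e : Complex.exp (Real.pi / 2 * Complex.I) = Complex.I := Complex.exp_pi_div_two_mul_I
  rw [targetAdjoint, exp_smul_drift, freeInverse]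
  congr 1
  · ext i j
    fin_cases i <;> fin_cases j <;>
      simp [gatePhase, add_mul, Complex.exp_add, e, mul_comm Complex.I]
  · congr 1
    ext j
    congr 1
    push_cast
    ring

lemma freeInverse_mul_freeEvolution (ε t : ℝ) : freeInverse ε t * freeEvolution ε t = 1 :=
  mul_eq_one_comm.1 (freeEvolution_mul_freeInverse ε t)

/-- The factor `exp (i T H₀)` of the target undoes the free evolution, so only three diagonal phases
remain. -/
lemma fidelityFunctional_freeEvolution_mul (s φ γ ε : ℝ) (Z : Matrix (Fin 3) (Fin 3) ℂ) :
    fidelityFunctional (targetAdjoint s φ γ ε)ᴴ (freeEvolution ε (Real.pi / ε) * Z)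
      = 1 / 3 * ∑ j, (Complex.exp (gatePhase s φ γ j * Complex.I) * Z j j).re := by
  rw [fidelityFunctional_apply, conjTranspose_conjTranspose, targetAdjoint_eq, Matrix.mul_assoc,
    ← Matrix.mul_assoc (freeInverse _ _), freeInverse_mul_freeEvolution, Matrix.one_mul, trace,
    Complex.re_sum]
  simp [diagonal_mul]

/-- The control Hamiltonian in the interaction picture, times `-i`. -/
lemma freeInverse_mul_control_apply (a b c ε t : ℝ) (i j : Fin 3) :
    (freeInverse ε t * (-Complex.I • control a b c * freeEvolution ε t)) i j
      = -Complex.I * control a b c i j *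
        Complex.exp (((energy ε i - energy ε j) * t : ℝ) * Complex.I) := by
  rw [freeInverse, freeEvolution, diagonal_mul, mul_diagonal, Matrix.smul_apply, smul_eq_mul]
  have : Complex.exp (((energy ε i - energy ε j) * t : ℝ) * Complex.I)
      = Complex.exp ((energy ε i * t : ℝ) * Complex.I)
        * Complex.exp (-(energy ε j * t : ℝ) * Complex.I) := by
    rw [← Complex.exp_add]
    congr 1
    push_cast
    ring
  rw [this]
  ring

lemma fidelityFunctional_first_order {s : ℝ} (hs : s = 1 ∨ s = -1) (a b c φ γ ε t : ℝ) :
    fidelityFunctional (targetAdjoint s φ γ ε)ᴴ (freeEvolution ε (Real.pi / ε) *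
        (freeInverse ε t * (-Complex.I • control a b c * freeEvolution ε t)))
      = 1 / 3 * a * Real.sin φ + 1 / 3 * (b + c) * Real.cos γ := by
  rw [fidelityFunctional_freeEvolution_mul]
  simp only [freeInverse_mul_control_apply, Fin.sum_univ_three, sub_self, zero_mul]
  -- The diagonal of the interaction picture does not depend on time; this is why the gradient is
  -- constant.
  have h : ∀ (θ : ℝ) (r : ℝ), (Complex.exp (θ * Complex.I) * (-Complex.I * r)).re
      = r * Real.sin θ := fun θ r => by
    simp [Complex.exp_re, Complex.exp_im, mul_comm]
  simp only [Complex.ofReal_zero, zero_mul, Complex.exp_zero, mul_one]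
  have e0 : control a b c 0 0 = (a : ℂ) := rfl
  have e1 : control a b c 1 1 = (b : ℂ) := rfl
  have e2 : control a b c 2 2 = (c : ℂ) := rfl
  rw [e0, e1, e2, h, h, h]
  simp only [gatePhase, cons_val_zero, cons_val_one, cons_val, Real.sin_add_pi_div_two]
  rcases hs with rfl | rfl <;> simp <;> ring

lemma fidelityFunctional_second_order {s : ℝ} (hs : s = 1 ∨ s = -1) (a b c φ γ ε τ σ : ℝ) :
    fidelityFunctional (targetAdjoint s φ γ ε)ᴴ (freeEvolution ε (Real.pi / ε) *
        ((freeInverse ε τ * (-Complex.I • control a b c * freeEvolution ε τ)) *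
          (freeInverse ε σ * (-Complex.I • control a b c * freeEvolution ε σ))))
      = 1 / 3 * (coeffX φ γ * Real.sin (ε * (σ - τ)) - coeffA s a b c φ γ
              + coeffY s γ * Real.cos (σ - τ) - coeffZ φ γ * Real.cos (ε * (σ - τ))) := by
  rw [fidelityFunctional_freeEvolution_mul]
  -- The path from level `i` to `j` and back contributes one cosine in `σ - τ`, shifted by the gate
  -- phase of `i`; the minus sign is `(-i)²`.
  have h : ∀ (i j : Fin 3) (r : ℝ), control a b c i j * control a b c j i = (r : ℂ) →
      (Complex.exp (gatePhase s φ γ i * Complex.I) *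
        ((-Complex.I * control a b c i j *
            Complex.exp (((energy ε i - energy ε j) * τ : ℝ) * Complex.I)) *
          (-Complex.I * control a b c j i *
            Complex.exp (((energy ε j - energy ε i) * σ : ℝ) * Complex.I)))).re
      = -r * Real.cos (gatePhase s φ γ i - (energy ε i - energy ε j) * (σ - τ)) := by
    intro i j r hr
    have e : Complex.exp (gatePhase s φ γ i * Complex.I) *
        ((-Complex.I * control a b c i j *
            Complex.exp (((energy ε i - energy ε j) * τ : ℝ) * Complex.I)) *
          (-Complex.I * control a b c j i *
            Complex.exp (((energy ε j - energy ε i) * σ : ℝ) * Complex.I)))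
        = ((-r : ℝ) : ℂ) * Complex.exp
          ((gatePhase s φ γ i - (energy ε i - energy ε j) * (σ - τ) : ℝ) * Complex.I) := by
      have : Complex.exp
          ((gatePhase s φ γ i - (energy ε i - energy ε j) * (σ - τ) : ℝ) * Complex.I)
          = Complex.exp (gatePhase s φ γ i * Complex.I)
            * Complex.exp (((energy ε i - energy ε j) * τ : ℝ) * Complex.I)
            * Complex.exp (((energy ε j - energy ε i) * σ : ℝ) * Complex.I) := by
        rw [← Complex.exp_add, ← Complex.exp_add]
        congr 1
        push_cast
        ring
      rw [this, Complex.ofReal_neg, ← hr]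
      linear_combination (Complex.exp (gatePhase s φ γ i * Complex.I)
            * Complex.exp (((energy ε i - energy ε j) * τ : ℝ) * Complex.I)
            * Complex.exp (((energy ε j - energy ε i) * σ : ℝ) * Complex.I))
            * control a b c i j * control a b c j i * Complex.I_sq
    rw [e, Complex.re_ofReal_mul, Complex.exp_ofReal_mul_I_re]
  simp only [Matrix.mul_apply (M := freeInverse ε τ * (-Complex.I • control a b c *
    freeEvolution ε τ)), freeInverse_mul_control_apply, Finset.mul_sum, Complex.re_sum]
  simp only [Fin.sum_univ_three]
  rw [h 0 0 (a ^ 2) (by simp [control, pow_two]), h 0 1 1 (by simp [control]),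
    h 0 2 0 (by simp [control]), h 1 0 1 (by simp [control]),
    h 1 1 (b ^ 2) (by simp [control, pow_two]), h 1 2 1 (by simp [control]),
    h 2 0 0 (by simp [control]), h 2 1 1 (by simp [control]),
    h 2 2 (c ^ 2) (by simp [control, pow_two])]
  simp only [gatePhase, energy, cons_val_zero, cons_val_one, cons_val, coeffX, coeffY, coeffZ,
    coeffA]
  have e1 : ∀ θ x : ℝ, Real.cos (θ + Real.pi / 2 - x)
      = -Real.sin θ * Real.cos x + Real.cos θ * Real.sin x := fun θ x => by
    rw [Real.cos_sub, Real.cos_add_pi_div_two, Real.sin_add_pi_div_two]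
  have a1 : (1 + ε - 1) * (σ - τ) = ε * (σ - τ) := by ring
  have a2 : (1 - (1 + ε)) * (σ - τ) = -(ε * (σ - τ)) := by ring
  have a3 : ((1 : ℝ) - 2) * (σ - τ) = -(σ - τ) := by ring
  have a4 : ((2 : ℝ) - 1) * (σ - τ) = σ - τ := by ring
  simp only [a1, a2, a3, a4, e1, sub_self, zero_mul, Real.cos_sub φ, Real.cos_neg, Real.sin_neg,
    Real.cos_zero, Real.sin_zero]
  rcases hs with rfl | rfl <;> simp <;> ring


end ThreeLevel

/-! ### Gradient and Hessian of the three-level fidelity at the zero control. -/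

section Derivatives

attribute [local instance] Matrix.linftyOpNormedRing Matrix.linftyOpNormedAlgebra

lemma trapFidelity_eq (s a b c φ γ : ℝ) {ε : ℝ} (hT : 0 ≤ Real.pi / ε) :
    trapFidelity s a b c φ γ ε = endpointFunctional hT (-Complex.I • drift ε)
      (-Complex.I • control a b c) (fidelityFunctional (targetAdjoint s φ γ ε)ᴴ) :=
  gateFidelity_eq hT _

lemma contDiff_trapFidelity (s a b c φ γ : ℝ) {ε : ℝ} (hε : 0 < ε) {n : WithTop ℕ∞} :
    ContDiff ℝ n (trapFidelity s a b c φ γ ε) := by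
  rw [trapFidelity_eq s a b c φ γ (div_pos Real.pi_pos hε).le]
  exact contDiff_endpointFunctional _ _ _ _

lemma fderiv_trapFidelity_zero {s : ℝ} (hs : s = 1 ∨ s = -1) (a b c φ γ : ℝ) {ε : ℝ} (hε : 0 < ε)
    (α : ControlSpace (Real.pi / ε)) :
    fderiv ℝ (trapFidelity s a b c φ γ ε) 0 α = ∫ t in (0 : ℝ)..(Real.pi / ε),
      (1 / 3 * a * Real.sin φ + 1 / 3 * (b + c) * Real.cos γ) * α t := by
  have hT := (div_pos Real.pi_pos hε).le
  rw [trapFidelity_eq s a b c φ γ hT]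
  refine (fderiv_endpointFunctional hT _ (isFundamental_freeEvolution a b c ε _)
    (continuous_freeInverse ε).continuousOn (fun t _ => freeEvolution_mul_freeInverse ε t) α).trans
    ?_
  refine intervalIntegral.integral_congr fun t _ => ?_
  change α t * fidelityFunctional _ _ = _
  rw [fidelityFunctional_first_order hs, mul_comm]

lemma hessian_trapFidelity_zero {s : ℝ} (hs : s = 1 ∨ s = -1) (a b c φ γ : ℝ) {ε : ℝ} (hε : 0 < ε)
    (α β : ControlSpace (Real.pi / ε)) :
    hessian (trapFidelity s a b c φ γ ε) 0 α β =
      1 / 3 * ∫ τ in (0 : ℝ)..(Real.pi / ε), ∫ σ in (0 : ℝ)..τ,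
        (coeffX φ γ * Real.sin (ε * (σ - τ)) - coeffA s a b c φ γ
          + coeffY s γ * Real.cos (σ - τ) - coeffZ φ γ * Real.cos (ε * (σ - τ)))
        * (α σ * β τ + α τ * β σ) := by
  have hT := (div_pos Real.pi_pos hε).le
  rw [hessian, trapFidelity_eq s a b c φ γ hT]
  refine (fderiv_fderiv_endpointFunctional_eq_integral hT _
    (isFundamental_freeEvolution a b c ε _) (continuous_freeInverse ε).continuousOn
    (fun t _ => freeEvolution_mul_freeInverse ε t) α β).trans ?_
  rw [← intervalIntegral.integral_const_mul]
  refine intervalIntegral.integral_congr fun τ _ => ?_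
  rw [← intervalIntegral.integral_const_mul]
  refine intervalIntegral.integral_congr fun σ _ => ?_
  change fidelityFunctional _ _ * _ = _
  rw [fidelityFunctional_second_order hs, mul_assoc]

end Derivatives

end

end QuantumControl

namespace QuantumControl

noncomputable section

open Set

set_option linter.unusedSectionVars false

/-! ### The Fourier series of the sine with period `π`. -/

section FourierSin

lemma integral_exp_odd (m : ℤ) :
    ∫ x in (0 : ℝ)..Real.pi, Complex.exp ((2 * m + 1 : ℂ) * Complex.I * x)
      = 2 * Complex.I / (2 * m + 1) := by
  have h0 : (2 * m + 1 : ℂ) ≠ 0 := by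
    have : (2 * m + 1 : ℤ) ≠ 0 := by omega
    exact_mod_cast this
  rw [integral_exp_mul_complex (mul_ne_zero h0 Complex.I_ne_zero)]
  have h1 : Complex.exp ((2 * m + 1 : ℂ) * Complex.I * (Real.pi : ℝ)) = -1 := by
    have : (2 * m + 1 : ℂ) * Complex.I * (Real.pi : ℝ)
        = m * (2 * Real.pi * Complex.I) + Real.pi * Complex.I := by ring
    rw [this, Complex.exp_add, Complex.exp_int_mul_two_pi_mul_I, Complex.exp_pi_mul_I, one_mul]
  rw [h1]
  simp only [Complex.ofReal_zero, mul_zero, Complex.exp_zero]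
  field_simp
  rw [Complex.I_sq]
  norm_num

lemma fourierCoeffOn_sin (n : ℤ) :
    fourierCoeffOn Real.pi_pos (fun x : ℝ => (Real.sin x : ℂ)) n
      = ((2 / Real.pi / (1 - 4 * (n : ℝ) ^ 2) : ℝ) : ℂ) := by
  rw [fourierCoeffOn_eq_integral]
  have hp : (Real.pi : ℂ) ≠ 0 := by exact_mod_cast Real.pi_ne_zero
  -- The two exponentials of the sine move the even frequency `-2n` to the odd ones `-2n + 1` and
  -- `-2n - 1`, whose integrals over `[0, π]` do not vanish.
  have e : ∀ x : ℝ, (fourier (-n)) (x : AddCircle (Real.pi - 0)) • (Real.sin x : ℂ)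
      = (1 / (2 * Complex.I)) * (Complex.exp ((2 * (-n : ℤ) + 1 : ℂ) * Complex.I * x)
        - Complex.exp ((2 * (-n - 1 : ℤ) + 1 : ℂ) * Complex.I * x)) := fun x => by
    rw [fourier_coe_apply, sub_zero, smul_eq_mul, Complex.ofReal_sin, Complex.sin]
    have e1 : 2 * (Real.pi : ℂ) * Complex.I * (-n : ℤ) * x / Real.pi
        = 2 * Complex.I * (-n : ℤ) * x := by
      field_simp
    have e2 : (2 * (-n : ℤ) + 1 : ℂ) * Complex.I * x
        = 2 * Complex.I * (-n : ℤ) * x + x * Complex.I := by ring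
    have e3 : (2 * (-n - 1 : ℤ) + 1 : ℂ) * Complex.I * x
        = 2 * Complex.I * (-n : ℤ) * x + -x * Complex.I := by push_cast; ring
    rw [e1, e2, e3, Complex.exp_add, Complex.exp_add]
    field_simp
    rw [Complex.I_sq]
    ring
  simp only [e]
  rw [intervalIntegral.integral_const_mul, intervalIntegral.integral_sub
    (Continuous.intervalIntegrable (by fun_prop) _ _)
    (Continuous.intervalIntegrable (by fun_prop) _ _), integral_exp_odd, integral_exp_odd]
  have h1 : (1 - 2 * n : ℂ) ≠ 0 := by
    have : (1 - 2 * n : ℤ) ≠ 0 := by omega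
    exact_mod_cast this
  have h2 : (1 + 2 * n : ℂ) ≠ 0 := by
    have : (1 + 2 * n : ℤ) ≠ 0 := by omega
    exact_mod_cast this
  have h3 : (1 - 4 * (n : ℂ) ^ 2) ≠ 0 := by
    have : (1 - 4 * (n : ℂ) ^ 2) = (1 - 2 * n) * (1 + 2 * n) := by ring
    rw [this]; exact mul_ne_zero h1 h2
  have h4 : (2 * ((-n : ℤ) : ℂ) + 1) = 1 - 2 * n := by push_cast; ring
  have h5 : (2 * ((-n - 1 : ℤ) : ℂ) + 1) = -(1 + 2 * n) := by push_cast; ring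
  rw [h4, h5]
  rw [sub_zero, Complex.real_smul]
  push_cast
  rw [div_sub_div _ _ h1 (neg_ne_zero.2 h2)]
  rw [show (1 - 2 * n : ℂ) * -(1 + 2 * n) = -(1 - 4 * (n : ℂ) ^ 2) by ring]
  field_simp
  ring

lemma summable_sin_coeff :
    Summable fun k : ℕ => 4 / (Real.pi * (4 * ((k : ℝ) + 1) ^ 2 - 1)) := by
  have h := ((summable_nat_add_iff 1).2 (Real.summable_one_div_nat_pow.2 one_lt_two)).mul_left
    (4 / Real.pi)
  refine Summable.of_nonneg_of_le (fun k => ?_) (fun k => ?_) h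
  · have : (0 : ℝ) ≤ 4 * ((k : ℝ) + 1) ^ 2 - 1 := by nlinarith [(Nat.cast_nonneg k : (0 : ℝ) ≤ k)]
    positivity
  · have hk : (0 : ℝ) ≤ k := Nat.cast_nonneg k
    have : ((k : ℝ) + 1) ^ 2 ≤ 4 * ((k : ℝ) + 1) ^ 2 - 1 := by nlinarith
    rw [← div_div]
    push_cast
    rw [div_eq_mul_one_div (4 / Real.pi)]
    gcongr

lemma sin_coeff_pos (k : ℕ) : 0 < 4 / (Real.pi * (4 * ((k : ℝ) + 1) ^ 2 - 1)) := by
  have : (0 : ℝ) < 4 * ((k : ℝ) + 1) ^ 2 - 1 := by nlinarith [(Nat.cast_nonneg k : (0 : ℝ) ≤ k)]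
  have := Real.pi_pos
  positivity

/-- The Fourier series of the sine on `[0,π]` with respect to the period `π`. -/
lemma hasSum_sin_series {θ : ℝ} (hθ : θ ∈ Icc 0 Real.pi) :
    HasSum (fun k : ℕ => 4 / (Real.pi * (4 * ((k : ℝ) + 1) ^ 2 - 1)) *
      Real.cos (2 * ((k : ℝ) + 1) * θ)) (2 / Real.pi - Real.sin θ) := by
  have : Fact (0 < Real.pi) := ⟨Real.pi_pos⟩
  -- The sine takes the same value at `0` and `π`, so it descends to a continuous function on the
  -- circle of length `π`.
  let F : C(AddCircle Real.pi, ℂ) :=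
    ⟨AddCircle.liftIco Real.pi 0 (fun x : ℝ => (Real.sin x : ℂ)),
      AddCircle.liftIco_zero_continuous (by simp) (by fun_prop)⟩
  have hFc : ∀ n, fourierCoeff F n = ((2 / Real.pi / (1 - 4 * (n : ℝ) ^ 2) : ℝ) : ℂ) := fun n => by
    rw [← fourierCoeffOn_sin n]
    have h := fourierCoeff_liftIco_eq (T := Real.pi) (a := 0) (fun x : ℝ => (Real.sin x : ℂ)) n
    simp only [zero_add] at h
    exact h
  have hsN : Summable fun k : ℕ => (2 / Real.pi / (1 - 4 * (k : ℝ) ^ 2) : ℝ) := by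
    refine (summable_nat_add_iff 1).1 ?_
    refine (summable_sin_coeff.mul_left (-1 / 2)).congr fun k => ?_
    have : (4 * ((k : ℝ) + 1) ^ 2 - 1) ≠ 0 := by
      nlinarith [(Nat.cast_nonneg k : (0 : ℝ) ≤ k)]
    have h2 : (1 - 4 * ((k : ℝ) + 1) ^ 2) ≠ 0 := by
      nlinarith [(Nat.cast_nonneg k : (0 : ℝ) ≤ k)]
    have := Real.pi_ne_zero
    push_cast
    field_simp
    ring
  have hs : Summable (fourierCoeff F) := by
    have : fourierCoeff F = fun n : ℤ => ((2 / Real.pi / (1 - 4 * (n : ℝ) ^ 2) : ℝ) : ℂ) :=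
      funext hFc
    rw [this]
    have hsZ : Summable fun n : ℤ => (2 / Real.pi / (1 - 4 * (n : ℝ) ^ 2) : ℝ) :=
      Summable.of_nat_of_neg hsN (hsN.congr fun k => by simp)
    exact Complex.ofRealCLM.summable hsZ
  have hFθ : F (θ : AddCircle Real.pi) = (Real.sin θ : ℂ) := by
    -- The lift is defined through `[0, π)`, so the end point `π` has to be read as `0`.
    rcases eq_or_lt_of_le hθ.2 with rfl | hlt
    · have : ((Real.pi : ℝ) : AddCircle Real.pi) = ((0 : ℝ) : AddCircle Real.pi) := by
        rw [AddCircle.coe_period, AddCircle.coe_zero]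
      rw [this]
      change AddCircle.liftIco Real.pi 0 (fun x : ℝ => (Real.sin x : ℂ)) _ = _
      rw [AddCircle.liftIco_zero_coe_apply ⟨le_rfl, Real.pi_pos⟩]
      simp
    · change AddCircle.liftIco Real.pi 0 (fun x : ℝ => (Real.sin x : ℂ)) _ = _
      rw [AddCircle.liftIco_zero_coe_apply ⟨hθ.1, hlt⟩]
  have h := (has_pointwise_sum_fourier_series_of_summable hs (θ : AddCircle Real.pi)).nat_add_neg
  rw [hFθ] at h
  -- Pairing `n` with `-n` counts the zeroth coefficient `2/π` twice; dropping index `0` removes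
  -- both copies and leaves the sum `sin θ - 2/π`, with `k` now standing for frequency `k + 1`.
  have h1 := (hasSum_nat_add_iff' 1).2 h
  have h2 := Complex.reCLM.hasSum h1
  have h3 := h2.neg
  have hp : (Real.pi : ℂ) ≠ 0 := by exact_mod_cast Real.pi_ne_zero
  have hf : ∀ n : ℤ, fourier n (θ : AddCircle Real.pi)
      = Complex.exp ((2 * n * θ : ℝ) * Complex.I) := fun n => by
    rw [fourier_coe_apply]
    congr 1
    push_cast
    field_simp
  convert h3 using 1
  · rfl
  · funext k
    simp only [Complex.reCLM_apply, hFc, hf, smul_eq_mul, Complex.add_re,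
      Complex.re_ofReal_mul, Complex.exp_ofReal_mul_I_re]
    have h2 : (1 - 4 * ((k : ℝ) + 1) ^ 2) ≠ 0 := by
      nlinarith [(Nat.cast_nonneg k : (0 : ℝ) ≤ k)]
    have h3 : (4 * ((k : ℝ) + 1) ^ 2 - 1) ≠ 0 := by
      nlinarith [(Nat.cast_nonneg k : (0 : ℝ) ≤ k)]
    have := Real.pi_ne_zero
    push_cast
    rw [show 2 * -((k : ℝ) + 1) * θ = -(2 * ((k : ℝ) + 1) * θ) by ring, Real.cos_neg, neg_sq]
    field_simp
    ring
  · simp [hFc, -Complex.ofReal_sin]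

end FourierSin

end

end QuantumControl

namespace QuantumControl

noncomputable section

open Set

set_option linter.unusedSectionVars false

/-! ### Difference kernels on the square and their expansion into projections. -/

section Kernel

variable {T : ℝ}

/-- The integral `∬ K(s - r) α(s) β(r) ds dr` over the square `[0,T]²`. -/
def kernelForm (K : ℝ → ℝ) (α β : ControlSpace T) : ℝ :=
  ∫ z : ℝ × ℝ, K (z.1 - z.2) * (α z.1 * β z.2)
    ∂((volume.restrict (Ioc 0 T)).prod (volume.restrict (Ioc 0 T)))

lemma ControlSpace.integrable (α : ControlSpace T) : Integrable α (volume.restrict (Ioc 0 T)) :=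
  α.memLp.integrable one_le_two

lemma integrable_kernel (α β : ControlSpace T) {K : ℝ → ℝ} (hK : Continuous K) {C : ℝ}
    (hC : ∀ x, |K x| ≤ C) :
    Integrable (fun z : ℝ × ℝ => K (z.1 - z.2) * (α z.1 * β z.2))
      ((volume.restrict (Ioc 0 T)).prod (volume.restrict (Ioc 0 T))) :=
  (α.integrable.mul_prod β.integrable).bdd_mul (c := C)
    (hK.comp (continuous_fst.sub continuous_snd)).aestronglyMeasurable
    (Filter.Eventually.of_forall fun _ => hC _)

lemma kernelForm_one (hT : 0 ≤ T) (α β : ControlSpace T) :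
    kernelForm (fun _ => 1) α β = proj (fun _ => 1) α β := by
  simp only [kernelForm, proj, one_mul, intervalIntegral.integral_of_le hT]
  exact integral_prod_mul α β

lemma integrable_mul_control (α : ControlSpace T) {g : ℝ → ℝ} (hg : Continuous g) {C : ℝ}
    (hC : ∀ x, |g x| ≤ C) : Integrable (fun t => g t * α t) (volume.restrict (Ioc 0 T)) :=
  α.integrable.bdd_mul (c := C) hg.aestronglyMeasurable (Filter.Eventually.of_forall hC)

/-- The addition formula writes `cos (ω (s - r))` as a sum of two products of functions of one
variable. -/
lemma kernelForm_cos (hT : 0 ≤ T) (ω : ℝ) (α β : ControlSpace T) :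
    kernelForm (fun x => Real.cos (ω * x)) α β
      = proj (fun t => Real.sin (ω * t)) α β + proj (fun t => Real.cos (ω * t)) α β := by
  simp only [kernelForm, proj, intervalIntegral.integral_of_le hT]
  have hs : ∀ γ : ControlSpace T, Integrable (fun t => Real.sin (ω * t) * γ t)
      (volume.restrict (Ioc 0 T)) := fun γ =>
    integrable_mul_control γ (by fun_prop) fun x => Real.abs_sin_le_one _
  have hc : ∀ γ : ControlSpace T, Integrable (fun t => Real.cos (ω * t) * γ t)
      (volume.restrict (Ioc 0 T)) := fun γ =>
    integrable_mul_control γ (by fun_prop) fun x => Real.abs_cos_le_one _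
  rw [← integral_prod_mul, ← integral_prod_mul,
    ← integral_add ((hs α).mul_prod (hs β)) ((hc α).mul_prod (hc β))]
  congr 1
  ext z
  rw [mul_sub, Real.cos_sub]
  ring

/-- The choice `T = π/ε` keeps `ε |s - r|` within `[0, π]`, where the sine series holds; absolute
summability of its coefficients permits termwise integration against `α(s) β(r)`. -/
lemma hasSum_kernelForm {ε : ℝ} (hε : 0 < ε) (α β : ControlSpace (Real.pi / ε)) :
    HasSum (fun k : ℕ => 4 / (Real.pi * (4 * ((k : ℝ) + 1) ^ 2 - 1)) *
        (proj (fun t => Real.sin (2 * ((k : ℝ) + 1) * ε * t)) α β +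
          proj (fun t => Real.cos (2 * ((k : ℝ) + 1) * ε * t)) α β))
      (2 / Real.pi * proj (fun _ => 1) α β - kernelForm (fun x => Real.sin (ε * |x|)) α β) := by
  have hT : 0 ≤ Real.pi / ε := (div_pos Real.pi_pos hε).le
  set μ := (volume.restrict (Ioc 0 (Real.pi / ε))).prod (volume.restrict (Ioc 0 (Real.pi / ε)))
    with hμ
  have hab : Integrable (fun z : ℝ × ℝ => α z.1 * β z.2) μ := α.integrable.mul_prod β.integrable
  let F : ℕ → ℝ × ℝ → ℝ := fun k z => 4 / (Real.pi * (4 * ((k : ℝ) + 1) ^ 2 - 1)) *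
    (Real.cos (2 * ((k : ℝ) + 1) * ε * (z.1 - z.2)) * (α z.1 * β z.2))
  have hF : ∀ k, Integrable (F k) μ := fun k =>
    (integrable_kernel α β (K := fun x => Real.cos (2 * ((k : ℝ) + 1) * ε * x)) (by fun_prop)
      fun x => Real.abs_cos_le_one _).const_mul _
  have hFs : Summable fun k => ∫ z, ‖F k z‖ ∂μ := by
    refine Summable.of_nonneg_of_le (fun k => integral_nonneg fun _ => norm_nonneg _) (fun k => ?_)
      (summable_sin_coeff.mul_right (∫ z, ‖α z.1 * β z.2‖ ∂μ))
    rw [← integral_const_mul]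
    refine integral_mono (hF k).norm (hab.norm.const_mul _) fun z => ?_
    simp only [F]
    rw [norm_mul, Real.norm_of_nonneg (sin_coeff_pos k).le, norm_mul (Real.cos _)]
    refine mul_le_mul_of_nonneg_left ?_ (sin_coeff_pos k).le
    exact mul_le_of_le_one_left (norm_nonneg _) (Real.abs_cos_le_one _)
  have h := hasSum_integral_of_summable_integral_norm hF hFs
  have e1 : ∀ k, ∫ z, F k z ∂μ = 4 / (Real.pi * (4 * ((k : ℝ) + 1) ^ 2 - 1)) *
        (proj (fun t => Real.sin (2 * ((k : ℝ) + 1) * ε * t)) α β +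
          proj (fun t => Real.cos (2 * ((k : ℝ) + 1) * ε * t)) α β) := fun k => by
    rw [← kernelForm_cos hT, kernelForm, ← integral_const_mul]
  have e2 : ∫ z, ∑' k, F k z ∂μ
      = 2 / Real.pi * proj (fun _ => 1) α β - kernelForm (fun x => Real.sin (ε * |x|)) α β := by
    have j1 : Integrable (fun z : ℝ × ℝ => 2 / Real.pi * (1 * (α z.1 * β z.2))) μ := by
      simp only [one_mul]
      exact hab.const_mul _
    have j2 : Integrable (fun z : ℝ × ℝ => Real.sin (ε * |z.1 - z.2|) * (α z.1 * β z.2)) μ :=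
      integrable_kernel α β (K := fun x => Real.sin (ε * |x|)) (by fun_prop)
        fun x => Real.abs_sin_le_one _
    rw [← kernelForm_one hT, kernelForm, kernelForm, ← integral_const_mul, ← integral_sub j1 j2]
    · refine integral_congr_ae ?_
      have hmem : ∀ᵐ z ∂μ, z ∈ Ioc 0 (Real.pi / ε) ×ˢ Ioc 0 (Real.pi / ε) := by
        rw [hμ, Measure.prod_restrict]
        exact ae_restrict_mem (measurableSet_Ioc.prod measurableSet_Ioc)
      filter_upwards [hmem] with z hz
      have hθ : ε * |z.1 - z.2| ∈ Icc 0 Real.pi := by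
        refine ⟨by positivity, ?_⟩
        have : |z.1 - z.2| ≤ Real.pi / ε := by
          rw [abs_le]
          constructor <;> linarith [hz.1.1, hz.1.2, hz.2.1, hz.2.2]
        calc ε * |z.1 - z.2| ≤ ε * (Real.pi / ε) := by gcongr
          _ = Real.pi := by field_simp
      have hs := (hasSum_sin_series hθ).mul_right (α z.1 * β z.2)
      -- Evenness of the cosine removes the absolute value, so each term of the series splits into
      -- projections although `sin (ε |x|)` does not.
      have e : ∀ k : ℕ, Real.cos (2 * ((k : ℝ) + 1) * (ε * |z.1 - z.2|))
          = Real.cos (2 * ((k : ℝ) + 1) * ε * (z.1 - z.2)) := fun k => by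
        rw [← Real.cos_abs (2 * ((k : ℝ) + 1) * ε * (z.1 - z.2)), abs_mul, abs_of_pos
          (by positivity : 0 < 2 * ((k : ℝ) + 1) * ε), mul_assoc (2 * ((k : ℝ) + 1))]
      have hFz : (fun k => F k z) = fun k : ℕ => 4 / (Real.pi * (4 * ((k : ℝ) + 1) ^ 2 - 1)) *
          Real.cos (2 * ((k : ℝ) + 1) * (ε * |z.1 - z.2|)) * (α z.1 * β z.2) := funext fun k => by
        rw [e, mul_assoc]
      rw [hFz, hs.tsum_eq]
      ring
  rw [← e2]
  simpa only [e1] using h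

/-- A symmetric kernel form as a sum of two integrals over the triangle. -/
lemma kernelForm_eq_triangle (α β : ControlSpace T) (hT : 0 ≤ T) {K : ℝ → ℝ} (hK : Continuous K)
    {C : ℝ} (hC : ∀ x, |K x| ≤ C) (hsymm : ∀ x, K (-x) = K x) :
    kernelForm K α β = (∫ τ in (0 : ℝ)..T, α τ * ∫ σ in (0 : ℝ)..τ, β σ * K (σ - τ))
      + ∫ τ in (0 : ℝ)..T, β τ * ∫ σ in (0 : ℝ)..τ, α σ * K (σ - τ) := by
  rw [kernelForm, setIntegral_triangle (integrable_kernel α β hK hC)]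
  simp only [intervalIntegral.integral_of_le hT]
  congr 1
  · refine setIntegral_congr_fun measurableSet_Ioc fun τ hτ => ?_
    simp only [intervalIntegral.integral_of_le hτ.1.le]
    rw [← integral_const_mul]
    refine integral_congr_ae (Filter.Eventually.of_forall fun σ => ?_)
    simp only
    rw [← hsymm, neg_sub]
    ring
  · refine setIntegral_congr_fun measurableSet_Ioc fun τ hτ => ?_
    simp only [intervalIntegral.integral_of_le hτ.1.le]
    rw [← integral_const_mul]
    refine integral_congr_ae (Filter.Eventually.of_forall fun σ => ?_)
    simp only
    ring

end Kernel

/-! ### The Hessian as a series of projections. -/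

section Series

attribute [local instance] Matrix.linftyOpNormedRing Matrix.linftyOpNormedAlgebra

/-- The even extension of the kernel of the Hessian. -/
def hessianKernel (s a b c φ γ ε x : ℝ) : ℝ :=
  -(coeffX φ γ * Real.sin (ε * |x|)) - coeffA s a b c φ γ
    + coeffY s γ * Real.cos x - coeffZ φ γ * Real.cos (ε * x)

/-- On the triangle `σ ≤ τ` one has `sin (ε (σ - τ)) = -sin (ε |σ - τ|)`, so the kernel is the
restriction of an even one and the two triangle integrals combine into one over the square. -/
lemma hessian_eq_kernelForm {s : ℝ} (hs : s = 1 ∨ s = -1) (a b c φ γ : ℝ) {ε : ℝ} (hε : 0 < ε)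
    (α β : ControlSpace (Real.pi / ε)) :
    hessian (trapFidelity s a b c φ γ ε) 0 α β
      = 1 / 3 * kernelForm (hessianKernel s a b c φ γ ε) α β := by
  have hT := (div_pos Real.pi_pos hε).le
  rw [hessian, trapFidelity_eq s a b c φ γ hT]
  refine (fderiv_fderiv_endpointFunctional hT _
    (isFundamental_freeEvolution a b c ε _) (continuous_freeInverse ε).continuousOn
    (fun t _ => freeEvolution_mul_freeInverse ε t) α β).trans ?_
  have hK : Continuous (hessianKernel s a b c φ γ ε) := by
    unfold hessianKernel
    fun_prop
  have hC : ∀ x, |hessianKernel s a b c φ γ ε x|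
      ≤ |coeffX φ γ| + |coeffA s a b c φ γ| + |coeffY s γ| + |coeffZ φ γ| := fun x => by
    have h1 : |coeffX φ γ * Real.sin (ε * |x|)| ≤ |coeffX φ γ| := by
      rw [abs_mul]; exact mul_le_of_le_one_right (abs_nonneg _) (Real.abs_sin_le_one _)
    have h2 : |coeffY s γ * Real.cos x| ≤ |coeffY s γ| := by
      rw [abs_mul]; exact mul_le_of_le_one_right (abs_nonneg _) (Real.abs_cos_le_one _)
    have h3 : |coeffZ φ γ * Real.cos (ε * x)| ≤ |coeffZ φ γ| := by
      rw [abs_mul]; exact mul_le_of_le_one_right (abs_nonneg _) (Real.abs_cos_le_one _)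
    have h4 := neg_abs_le (coeffA s a b c φ γ)
    have h5 := le_abs_self (coeffA s a b c φ γ)
    rw [abs_le] at h1 h2 h3
    rw [hessianKernel, abs_le]
    constructor <;> linarith
  rw [kernelForm_eq_triangle α β hT hK hC fun x => by simp [hessianKernel], mul_add,
    ← intervalIntegral.integral_const_mul, ← intervalIntegral.integral_const_mul]
  have key : ∀ τ ∈ Icc 0 (Real.pi / ε), ∀ γ' : ControlSpace (Real.pi / ε),
      ∫ σ in (0 : ℝ)..τ, γ' σ * fidelityFunctional (targetAdjoint s φ γ ε)ᴴ
        (freeEvolution ε (Real.pi / ε) *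
          ((freeInverse ε τ * (-Complex.I • control a b c * freeEvolution ε τ)) *
            (freeInverse ε σ * (-Complex.I • control a b c * freeEvolution ε σ))))
      = 1 / 3 * ∫ σ in (0 : ℝ)..τ, γ' σ * hessianKernel s a b c φ γ ε (σ - τ) := by
    intro τ hτ γ'
    rw [← intervalIntegral.integral_const_mul]
    refine intervalIntegral.integral_congr fun σ hσ => ?_
    rw [uIcc_of_le hτ.1] at hσ
    rw [fidelityFunctional_second_order hs, hessianKernel, abs_of_nonpos (sub_nonpos.2 hσ.2),
      mul_neg, Real.sin_neg]
    ring
  congr 1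
  · refine intervalIntegral.integral_congr fun τ hτ => ?_
    rw [uIcc_of_le hT] at hτ
    refine (congrArg (fun x => α τ * x) (key τ hτ β)).trans ?_
    ring
  · refine intervalIntegral.integral_congr fun τ hτ => ?_
    rw [uIcc_of_le hT] at hτ
    refine (congrArg (fun x => β τ * x) (key τ hτ α)).trans ?_
    ring

lemma kernelForm_hessianKernel (s a b c φ γ : ℝ) {ε : ℝ} (hε : 0 < ε)
    (α β : ControlSpace (Real.pi / ε)) :
    kernelForm (hessianKernel s a b c φ γ ε) α β
      = -coeffX φ γ * kernelForm (fun x => Real.sin (ε * |x|)) α β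
        - coeffA s a b c φ γ * proj (fun _ => 1) α β
        + coeffY s γ * (proj Real.sin α β + proj Real.cos α β)
        - coeffZ φ γ * (proj (fun t => Real.sin (ε * t)) α β
          + proj (fun t => Real.cos (ε * t)) α β) := by
  have hT := (div_pos Real.pi_pos hε).le
  have h1 := kernelForm_cos hT 1 α β
  simp only [one_mul] at h1
  rw [← kernelForm_cos hT ε, ← h1, ← kernelForm_one hT]
  have i1 := (integrable_kernel α β (K := fun x => Real.sin (ε * |x|)) (by fun_prop)
    fun x => Real.abs_sin_le_one _).const_mul (-coeffX φ γ)
  have i2 := (integrable_kernel α β (K := fun _ => 1) (C := 1) (by fun_prop)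
    fun x => by simp).const_mul (coeffA s a b c φ γ)
  have i3 := (integrable_kernel α β (K := fun x => Real.cos x) (by fun_prop)
    fun x => Real.abs_cos_le_one _).const_mul (coeffY s γ)
  have i4 := (integrable_kernel α β (K := fun x => Real.cos (ε * x)) (by fun_prop)
    fun x => Real.abs_cos_le_one _).const_mul (coeffZ φ γ)
  simp only [kernelForm]
  have e1 := integral_sub i1 i2
  have e2 := integral_add (i1.sub i2) i3
  have e3 := integral_sub ((i1.sub i2).add i3) i4
  simp only [Pi.sub_apply, Pi.add_apply] at e1 e2 e3
  rw [← integral_const_mul, ← integral_const_mul, ← integral_const_mul, ← integral_const_mul,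
    ← e1, ← e2, ← e3]
  congr 1
  ext z
  simp only [hessianKernel]
  ring

/-- The constant term `2/π` of the sine series joins `coeffA` to give `coeffW 2`; this explains why
`κ = 2` is the natural threshold. -/
lemma hessian_eq_series {s : ℝ} (hs : s = 1 ∨ s = -1) (a b c φ γ : ℝ) {ε : ℝ} (hε : 0 < ε)
    (α β : ControlSpace (Real.pi / ε)) :
    hessian (trapFidelity s a b c φ γ ε) 0 α β =
      - (1 / 3) * coeffW 2 s a b c φ γ * proj (fun _ => 1) α β
      + 1 / 3 * coeffX φ γ * ∑' k : ℕ, 4 / (Real.pi * (4 * ((k : ℝ) + 1) ^ 2 - 1)) *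
          (proj (fun t => Real.sin (2 * ((k : ℝ) + 1) * ε * t)) α β +
            proj (fun t => Real.cos (2 * ((k : ℝ) + 1) * ε * t)) α β)
      + 1 / 3 * coeffY s γ * (proj Real.cos α β + proj Real.sin α β)
      - 1 / 3 * coeffZ φ γ *
          (proj (fun t => Real.cos (ε * t)) α β + proj (fun t => Real.sin (ε * t)) α β) := by
  rw [hessian_eq_kernelForm hs a b c φ γ hε, kernelForm_hessianKernel s a b c φ γ hε,
    (hasSum_kernelForm hε α β).tsum_eq, coeffW]
  ring

end Series

/-! ### Negative definiteness and the second derivative test. -/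

section Definiteness

lemma proj_self {T : ℝ} (g : ℝ → ℝ) (α : ControlSpace T) :
    proj g α α = (∫ t in (0 : ℝ)..T, g t * α t) ^ 2 := by
  rw [proj, pow_two]

/-- Completeness of the trigonometric system of period `T = π / ε` in `L²(0,T)`. -/
lemma eq_zero_of_trig_orthogonal {ε : ℝ} (hε : 0 < ε) (α : ControlSpace (Real.pi / ε))
    (h0 : ∫ t in (0 : ℝ)..(Real.pi / ε), α t = 0)
    (hsin : ∀ k : ℕ, ∫ t in (0 : ℝ)..(Real.pi / ε), Real.sin (2 * ((k : ℝ) + 1) * ε * t) * α t = 0)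
    (hcos : ∀ k : ℕ, ∫ t in (0 : ℝ)..(Real.pi / ε), Real.cos (2 * ((k : ℝ) + 1) * ε * t) * α t = 0) :
    α = 0 := by
  have hT := div_pos Real.pi_pos hε
  have hmem : MemLp (fun t => (α t : ℂ)) 2 (volume.restrict (Ioc 0 (Real.pi / ε))) :=
    α.memLp.ofReal
  have hsin' : ∀ n : ℤ, ∫ t in (0 : ℝ)..(Real.pi / ε), Real.sin (2 * n * ε * t) * α t = 0 := by
    intro n
    rcases lt_trichotomy n 0 with hn | rfl | hn
    · obtain ⟨k, hk⟩ : ∃ k : ℕ, n = -(k + 1) := ⟨(-n - 1).toNat, by omega⟩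
      have e : ∀ t, Real.sin (2 * n * ε * t) * α t
          = -(Real.sin (2 * ((k : ℝ) + 1) * ε * t) * α t) := fun t => by
        rw [← neg_mul, ← Real.sin_neg, hk]
        push_cast
        congr 2
        ring
      simp only [e, intervalIntegral.integral_neg, hsin k, neg_zero]
    · simp
    · obtain ⟨k, hk⟩ : ∃ k : ℕ, n = k + 1 := ⟨(n - 1).toNat, by omega⟩
      rw [hk]
      exact_mod_cast hsin k
  have hcos' : ∀ n : ℤ, ∫ t in (0 : ℝ)..(Real.pi / ε), Real.cos (2 * n * ε * t) * α t = 0 := by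
    intro n
    rcases lt_trichotomy n 0 with hn | rfl | hn
    · obtain ⟨k, hk⟩ : ∃ k : ℕ, n = -(k + 1) := ⟨(-n - 1).toNat, by omega⟩
      have e : ∀ t, Real.cos (2 * n * ε * t) * α t
          = Real.cos (2 * ((k : ℝ) + 1) * ε * t) * α t := fun t => by
        rw [← Real.cos_neg, hk]
        push_cast
        congr 2
        ring
      simp only [e, hcos k]
    · simpa using h0
    · obtain ⟨k, hk⟩ : ∃ k : ℕ, n = k + 1 := ⟨(n - 1).toNat, by omega⟩
      rw [hk]
      exact_mod_cast hcos k
  have hcoef : ∀ n : ℤ, fourierCoeffOn hT (fun t => (α t : ℂ)) n = 0 := fun n => by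
    rw [fourierCoeffOn_eq_integral]
    have e : ∀ t : ℝ, (fourier (-n)) (t : AddCircle (Real.pi / ε - 0)) • (α t : ℂ)
        = ((Real.cos (2 * n * ε * t) * α t : ℝ) : ℂ)
          - Complex.I * ((Real.sin (2 * n * ε * t) * α t : ℝ) : ℂ) := fun t => by
      rw [fourier_coe_apply, sub_zero, smul_eq_mul]
      have hp : (Real.pi : ℂ) ≠ 0 := by exact_mod_cast Real.pi_ne_zero
      have hε' : (ε : ℂ) ≠ 0 := by exact_mod_cast hε.ne'
      have e1 : 2 * (Real.pi : ℂ) * Complex.I * (-n : ℤ) * t / ((Real.pi / ε : ℝ) : ℂ)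
          = ((-(2 * n * ε * t) : ℝ) : ℂ) * Complex.I := by
        push_cast
        field_simp
      rw [e1, Complex.exp_mul_I, ← Complex.ofReal_cos, ← Complex.ofReal_sin, Real.cos_neg,
        Real.sin_neg]
      push_cast
      ring
    have i1 : IntervalIntegrable (fun t => ((Real.cos (2 * n * ε * t) * α t : ℝ) : ℂ)) volume 0
        (Real.pi / ε) := (intervalIntegrable_iff_integrableOn_Ioc_of_le hT.le).2
      (integrable_mul_control α (by fun_prop) fun x => Real.abs_cos_le_one _).ofReal
    have i2 : IntervalIntegrable (fun t => ((Real.sin (2 * n * ε * t) * α t : ℝ) : ℂ)) volume 0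
        (Real.pi / ε) := (intervalIntegrable_iff_integrableOn_Ioc_of_le hT.le).2
      (integrable_mul_control α (by fun_prop) fun x => Real.abs_sin_le_one _).ofReal
    simp only [e]
    rw [intervalIntegral.integral_sub i1 (i2.const_mul _),
      intervalIntegral.integral_const_mul, intervalIntegral.integral_ofReal,
      intervalIntegral.integral_ofReal, hcos', hsin']
    simp
  -- All Fourier coefficients with respect to the period `π/ε` vanish, so Parseval's identity gives
  -- `∫ α² = 0`.
  have h := hasSum_sq_fourierCoeffOn hT hmem
  simp only [hcoef, norm_zero, ne_eq, OfNat.ofNat_ne_zero, not_false_eq_true, zero_pow,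
    sub_zero] at h
  have h2 := h.unique hasSum_zero
  rw [smul_eq_mul, mul_eq_zero, or_iff_right (inv_ne_zero hT.ne')] at h2
  have h3 := α.norm_sq hT.le
  simp only [Complex.norm_real, Real.norm_eq_abs, sq_abs] at h2
  rw [h2] at h3
  simpa using h3

/-- Every term of the series is nonpositive at `α`. If the total were not negative, each term with a
strictly negative coefficient would vanish, and these terms contain all moments of a complete
trigonometric system. -/
lemma hessian_neg {κ s : ℝ} (hs : s = 1 ∨ s = -1) (hκ : 2 ≤ κ) {a b c φ γ : ℝ}
    (h : TrapConstraints κ s a b c φ γ) {ε : ℝ} (hε : 0 < ε) (α : ControlSpace (Real.pi / ε))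
    (hα : α ≠ 0) : hessian (trapFidelity s a b c φ γ ε) 0 α α < 0 := by
  by_contra hneg
  rw [not_lt, hessian_eq_series hs a b c φ γ hε] at hneg
  -- Since `x < 0`, `coeffW κ` decreases in `κ`, so positivity at some `κ ≥ 2` implies it at `2`.
  have hw : 0 < coeffW 2 s a b c φ γ := by
    refine h.w_pos.trans_le ?_
    rw [coeffW, coeffW]
    have : 2 / Real.pi ≤ κ / Real.pi := by gcongr
    nlinarith [h.x_neg]
  have hsum := hasSum_kernelForm hε α α
  set S := ∑' k : ℕ, 4 / (Real.pi * (4 * ((k : ℝ) + 1) ^ 2 - 1)) *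
          (proj (fun t => Real.sin (2 * ((k : ℝ) + 1) * ε * t)) α α +
            proj (fun t => Real.cos (2 * ((k : ℝ) + 1) * ε * t)) α α) with hS
  have hp : ∀ g : ℝ → ℝ, 0 ≤ proj g α α := fun g => by rw [proj_self]; positivity
  have hterm : ∀ k : ℕ, 0 ≤ 4 / (Real.pi * (4 * ((k : ℝ) + 1) ^ 2 - 1)) *
          (proj (fun t => Real.sin (2 * ((k : ℝ) + 1) * ε * t)) α α +
            proj (fun t => Real.cos (2 * ((k : ℝ) + 1) * ε * t)) α α) := fun k =>
    mul_nonneg (sin_coeff_pos k).le (add_nonneg (hp _) (hp _))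
  have hS0 : 0 ≤ S := tsum_nonneg hterm
  have n1 := mul_nonneg hw.le (hp fun _ => 1)
  have n2 := mul_nonneg (neg_pos.2 h.x_neg).le hS0
  have n3 := mul_nonneg (neg_nonneg.2 h.y_nonpos) (add_nonneg (hp Real.cos) (hp Real.sin))
  have n4 := mul_nonneg h.z_nonneg
    (add_nonneg (hp fun t => Real.cos (ε * t)) (hp fun t => Real.sin (ε * t)))
  have z1 : coeffW 2 s a b c φ γ * proj (fun _ => 1) α α = 0 := by linarith
  have z2 : -coeffX φ γ * S = 0 := by linarith
  have hS00 : S = 0 := (mul_eq_zero.1 z2).resolve_left (neg_pos.2 h.x_neg).ne'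
  have hS1 := hsum.summable.hasSum
  rw [← hS, hS00, hasSum_zero_iff_of_nonneg hterm] at hS1
  have hk : ∀ k : ℕ, proj (fun t => Real.sin (2 * ((k : ℝ) + 1) * ε * t)) α α +
            proj (fun t => Real.cos (2 * ((k : ℝ) + 1) * ε * t)) α α = 0 := fun k =>
    (mul_eq_zero.1 (congrFun hS1 k)).resolve_left (sin_coeff_pos k).ne'
  have hsq : ∀ g : ℝ → ℝ, proj g α α = 0 → ∫ t in (0 : ℝ)..(Real.pi / ε), g t * α t = 0 :=
    fun g hg => by rwa [proj_self, sq_eq_zero_iff] at hg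
  refine hα (eq_zero_of_trig_orthogonal hε α ?_ (fun k => hsq _ ?_) fun k => hsq _ ?_)
  · have := hsq _ ((mul_eq_zero.1 z1).resolve_left hw.ne')
    simpa only [one_mul] using this
  · linarith [hk k, hp (fun t => Real.sin (2 * ((k : ℝ) + 1) * ε * t)),
      hp (fun t => Real.cos (2 * ((k : ℝ) + 1) * ε * t))]
  · linarith [hk k, hp (fun t => Real.sin (2 * ((k : ℝ) + 1) * ε * t)),
      hp (fun t => Real.cos (2 * ((k : ℝ) + 1) * ε * t))]

/-- The second derivative test on finite-dimensional subspaces. -/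
lemma isLocalMaxOn_of_fderiv_fderiv_neg {E : Type*} [NormedAddCommGroup E] [NormedSpace ℝ E]
    {F : E → ℝ} (hF : ContDiff ℝ 2 F) (h0 : fderiv ℝ F 0 = 0)
    (hneg : ∀ v : E, v ≠ 0 → fderiv ℝ (fderiv ℝ F) 0 v v < 0) (S : Submodule ℝ E)
    [FiniteDimensional ℝ S] : IsLocalMaxOn F (S : Set E) 0 := by
  set D := fderiv ℝ (fderiv ℝ F) 0 with hD
  have hd2 : HasFDerivAt (fderiv ℝ F) D 0 :=
    (((hF.fderiv_right (m := 1) (by norm_num)).differentiable one_ne_zero) 0).hasFDerivAt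
  have hd1 : Differentiable ℝ F := hF.differentiable two_ne_zero
  -- The constant is minus the maximum of the quadratic form on the compact unit sphere of `S`; the
  -- trivial subspace has an empty sphere and is treated apart.
  obtain ⟨c, hc, hcS⟩ : ∃ c > 0, ∀ v ∈ S, D v v ≤ -c * ‖v‖ ^ 2 := by
    by_cases hne : (Metric.sphere (0 : S) 1).Nonempty
    · have hcont : Continuous fun v : S => D v v := by fun_prop
      obtain ⟨m, hm, hmax⟩ := (isCompact_sphere (0 : S) 1).exists_isMaxOn hne hcont.continuousOn
      have hm0 : (m : E) ≠ 0 := by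
        intro h
        have : m = 0 := Subtype.ext h
        simp [this] at hm
      refine ⟨-(D m m), neg_pos.2 (hneg _ hm0), fun v hv => ?_⟩
      rcases eq_or_ne v 0 with rfl | hv0
      · simp
      · have hn : ‖v‖ ≠ 0 := norm_ne_zero_iff.2 hv0
        have hmem : (‖v‖⁻¹ • (⟨v, hv⟩ : S)) ∈ Metric.sphere (0 : S) 1 := by
          rw [mem_sphere_zero_iff_norm, norm_smul, norm_inv, norm_norm]
          exact inv_mul_cancel₀ hn
        have h1 := hmax hmem
        simp only [mem_ofPred_eq, Submodule.coe_smul, map_smul, _root_.smul_apply, smul_eq_mul] at h1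
        rw [neg_neg]
        calc D v v = ‖v‖ ^ 2 * (‖v‖⁻¹ * (‖v‖⁻¹ * D v v)) := by field_simp
          _ ≤ ‖v‖ ^ 2 * D m m := by gcongr
          _ = _ := mul_comm _ _
    · refine ⟨1, one_pos, fun v hv => ?_⟩
      have : v = 0 := by
        by_contra hv0
        refine hne ⟨‖v‖⁻¹ • (⟨v, hv⟩ : S), ?_⟩
        rw [mem_sphere_zero_iff_norm, norm_smul, norm_inv, norm_norm]
        exact inv_mul_cancel₀ (norm_ne_zero_iff.2 hv0)
      simp [this]
  have hlit := hd2.isLittleO.def hc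
  obtain ⟨δ, hδ, hball⟩ := Metric.eventually_nhds_iff_ball.1 hlit
  refine Filter.eventually_of_mem (inter_mem_nhdsWithin _ (Metric.ball_mem_nhds 0 hδ)) ?_
  rintro v ⟨hvS, hvδ⟩
  have hder : ∀ t : ℝ, HasDerivAt (fun t : ℝ => F (t • v)) (fderiv ℝ F (t • v) v) t := fun t => by
    have h1 : HasDerivAt (fun t : ℝ => t • v) v t := by
      simpa using (hasDerivAt_id t).smul_const v
    exact (hd1 (t • v)).hasFDerivAt.comp_hasDerivAt t h1
  -- Along the ray the slope is at most `-c t ‖v‖²` from the Hessian plus an error of at most `c t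
  -- ‖v‖²` from linearizing the gradient, hence nonpositive.
  have hanti : AntitoneOn (fun t : ℝ => F (t • v)) (Icc 0 1) := by
    refine antitoneOn_of_deriv_nonpos (convex_Icc 0 1)
      (fun t _ => (hder t).continuousAt.continuousWithinAt)
      (fun t _ => (hder t).differentiableAt.differentiableWithinAt) fun t ht => ?_
    rw [interior_Icc] at ht
    rw [(hder t).deriv]
    have hmem : t • v ∈ Metric.ball (0 : E) δ := by
      rw [mem_ball_zero_iff] at hvδ ⊢
      rw [norm_smul, Real.norm_of_nonneg ht.1.le]
      exact (mul_le_of_le_one_left (norm_nonneg _) ht.2.le).trans_lt hvδ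
    have h1 := hball _ hmem
    rw [h0, sub_zero, sub_zero, norm_smul, Real.norm_of_nonneg ht.1.le] at h1
    have h2 := (fderiv ℝ F (t • v) - D (t • v)).le_of_opNorm_le h1 v
    have h3 := (le_abs_self _).trans h2
    simp only [_root_.sub_apply, map_smul, _root_.smul_apply, smul_eq_mul] at h3
    have h4 := mul_le_mul_of_nonneg_left (hcS v hvS) ht.1.le
    nlinarith
  have := hanti (left_mem_Icc.2 zero_le_one) (right_mem_Icc.2 zero_le_one) zero_le_one
  simpa using this

lemma isAttractiveAtZero {κ s : ℝ} (hs : s = 1 ∨ s = -1) (hκ : 2 ≤ κ) {a b c φ γ : ℝ}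
    (h : TrapConstraints κ s a b c φ γ) {ε : ℝ} (hε : 0 < ε) :
    IsAttractiveAtZero (trapFidelity s a b c φ γ ε) := by
  have h0 : fderiv ℝ (trapFidelity s a b c φ γ ε) 0 = 0 := by
    ext α
    rw [fderiv_trapFidelity_zero hs a b c φ γ hε]
    have : 1 / 3 * a * Real.sin φ + 1 / 3 * (b + c) * Real.cos γ = 0 := by linarith [h.crit]
    simp only [this, zero_mul, intervalIntegral.integral_zero, _root_.zero_apply]
  have hC := contDiff_trapFidelity s a b c φ γ hε (n := 2)
  refine ⟨?_, hessian_neg hs hκ h hε, fun S hS => ?_⟩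
  · rw [IsCriticalPoint, ← h0]
    exact (hC.differentiable two_ne_zero 0).hasFDerivAt
  · exact isLocalMaxOn_of_fderiv_fderiv_neg hC h0 (hessian_neg hs hκ h hε) S

end Definiteness

end

end QuantumControl

namespace QuantumControl

noncomputable section

open Set

set_option linter.unusedSectionVars false

/-! ### Concatenation of trajectories and reachable elements. -/

section Trajectory

variable {𝔸 : Type*} [NormedRing 𝔸] [NormedAlgebra ℝ 𝔸] [CompleteSpace 𝔸]

/-- `u` is the trajectory of the control `f` on `[0,T]` for the system `u' = (A + f B) u`. -/
structure IsTrajectory (A B : 𝔸) (T : ℝ) (f : ℝ → ℝ) (u : ℝ → 𝔸) : Prop where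
  nonneg : 0 ≤ T
  memLp : MemLp f 2 (volume.restrict (Ioc 0 T))
  isFundamental : IsFundamental (fun s => A + f s • B) T u

variable {A B : 𝔸} {T S : ℝ} {f g : ℝ → ℝ} {u v : ℝ → 𝔸}

lemma IsTrajectory.intervalIntegrable (h : IsTrajectory A B T f u) :
    IntervalIntegrable (fun s => A + f s • B) volume 0 T :=
  intervalIntegrable_const.add
    ((intervalIntegrable_of_memLp h.nonneg h.memLp).smul_continuousOn continuousOn_const)

lemma IsTrajectory.map_zero (h : IsTrajectory A B T f u) : u 0 = 1 :=
  h.isFundamental.map_zero h.nonneg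

lemma isTrajectory_const (A B : 𝔸) (c : ℝ) (hT : 0 ≤ T) :
    IsTrajectory A B T (fun _ => c) (fun t => NormedSpace.exp (t • (A + c • B))) :=
  ⟨hT, memLp_const c, isFundamental_exp _ _⟩

lemma isTrajectory_flowTraj (hT : 0 ≤ T) (A B : 𝔸) (f : ControlSpace T) :
    IsTrajectory A B T f ((flowTraj hT A B f).ext hT) :=
  ⟨hT, f.memLp, isFundamental_flowTraj hT A B f⟩

/-- Every trajectory is the trajectory of an element of the control space. -/
lemma IsTrajectory.eqOn_flowTraj (h : IsTrajectory A B T f u) :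
    EqOn u ((flowTraj h.nonneg A B (h.memLp.toLp f)).ext h.nonneg) (Icc 0 T) := by
  refine IsFundamental.eqOn_flowTraj h.nonneg (h.isFundamental.congr_ae ?_)
  filter_upwards [h.memLp.coeFn_toLp] with s hs
  rw [hs]

lemma memLp_concat (hf : MemLp f 2 (volume.restrict (Ioc 0 T)))
    (hg : MemLp g 2 (volume.restrict (Ioc 0 S))) :
    MemLp ((Iic T).piecewise f fun s => g (s - T)) 2 (volume.restrict (Ioc 0 (T + S))) := by
  have hg' : MemLp (fun s => g (s - T)) 2 (volume.restrict (Ioc T (T + S))) := by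
    have hmp := (measurePreserving_sub_right volume T).restrict_preimage
      (measurableSet_Ioc (a := (0 : ℝ)) (b := S))
    rw [preimage_sub_const_Ioc, zero_add, add_comm S] at hmp
    exact hg.comp_measurePreserving hmp
  refine MemLp.piecewise measurableSet_Iic ?_ ?_
  · rw [Measure.restrict_restrict measurableSet_Iic]
    refine hf.mono_measure (Measure.restrict_mono_set _ ?_)
    exact fun x hx => ⟨hx.2.1, hx.1⟩
  · rw [Measure.restrict_restrict measurableSet_Iic.compl]
    refine hg'.mono_measure (Measure.restrict_mono_set _ ?_)
    exact fun x hx => ⟨not_le.1 hx.1, hx.2.2⟩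

/-- Concatenation of trajectories. -/
lemma IsTrajectory.concat (hu : IsTrajectory A B T f u) (hv : IsTrajectory A B S g v) :
    ∃ h w, IsTrajectory A B (T + S) h w ∧ (∀ t ∈ Icc 0 T, w t = u t) ∧
      ∀ r ∈ Icc 0 S, w (T + r) = v r * u T := by
  have hT := hu.nonneg
  have hS := hv.nonneg
  set h := (Iic T).piecewise f fun s => g (s - T) with hh
  -- The equation is invariant under right multiplication, so the second piece restarts from `u T`;
  -- continuity at `T` holds because `v 0 = 1`.
  set w := (Iic T).piecewise u fun t => v (t - T) * u T with hw
  have hw1 : ∀ t ∈ Icc 0 T, w t = u t := fun t ht => piecewise_eq_of_mem _ _ _ ht.2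
  have hw2 : ∀ t ∈ Icc T (T + S), w t = v (t - T) * u T := fun t ht => by
    rcases eq_or_lt_of_le ht.1 with rfl | hlt
    · rw [hw1 _ ⟨hT, le_rfl⟩, sub_self, hv.map_zero, one_mul]
    · exact piecewise_eq_of_notMem _ _ _ (not_le.2 hlt)
  have hmap : MapsTo (fun t => t - T) (Icc T (T + S)) (Icc 0 S) := fun t ht =>
    ⟨sub_nonneg.2 ht.1, by linarith [ht.2]⟩
  have hc2 : ContinuousOn w (Icc T (T + S)) :=
    ((hv.isFundamental.continuousOn.comp (by fun_prop) hmap).mul continuousOn_const).congr hw2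
  have hc1 : ContinuousOn w (Icc 0 T) := hu.isFundamental.continuousOn.congr hw1
  have hc : ContinuousOn w (Icc 0 (T + S)) := by
    rw [← Icc_union_Icc_eq_Icc hT (le_add_of_nonneg_right hS)]
    exact hc1.union_of_isClosed hc2 isClosed_Icc isClosed_Icc
  have hmem : MemLp h 2 (volume.restrict (Ioc 0 (T + S))) := memLp_concat hu.memLp hv.memLp
  have hTS : 0 ≤ T + S := add_nonneg hT hS
  have hint : IntervalIntegrable (fun s => (A + h s • B) * w s) volume 0 (T + S) :=
    intervalIntegrable_mul_continuousOn hTS (intervalIntegrable_const.add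
      ((intervalIntegrable_of_memLp hTS hmem).smul_continuousOn continuousOn_const)) hc
  have heq1 : ∀ t ∈ Icc 0 T, ∫ s in (0 : ℝ)..t, (A + h s • B) * w s = u t - 1 := fun t ht => by
    rw [hu.isFundamental.eq_integral t ht, add_sub_cancel_left]
    refine intervalIntegral.integral_congr fun s hs => ?_
    rw [uIcc_of_le ht.1] at hs
    simp only [hw1 s ⟨hs.1, hs.2.trans ht.2⟩, hh,
      piecewise_eq_of_mem _ _ _ (show s ∈ Iic T from hs.2.trans ht.2)]
  refine ⟨h, w, ⟨hTS, hmem, hc, fun t ht => ?_⟩, hw1, fun r hr => ?_⟩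
  · rcases le_total t T with htT | htT
    · rw [heq1 t ⟨ht.1, htT⟩, hw1 t ⟨ht.1, htT⟩]
      abel
    · have hr : t - T ∈ Icc 0 S := ⟨sub_nonneg.2 htT, by linarith [ht.2]⟩
      have e2 : ∫ s in T..t, (A + h s • B) * w s = (v (t - T) - 1) * u T := by
        have e3 : ∫ s in T..t, (A + h s • B) * w s
            = ∫ s in T..t, (fun s => (A + g s • B) * v s * u T) (s - T) := by
          refine intervalIntegral.integral_congr_ae (Filter.Eventually.of_forall fun s hs => ?_)
          rw [uIoc_of_le htT] at hs
          simp only [hw2 s ⟨hs.1.le, hs.2.trans ht.2⟩, hh,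
            piecewise_eq_of_notMem _ _ _ (show s ∉ Iic T from not_le.2 hs.1), mul_assoc]
        have hi := ((intervalIntegrable_mul_continuousOn hS hv.intervalIntegrable
          hv.isFundamental.continuousOn).mono_set (uIcc_zero_subset hr))
        refine (e3.trans (intervalIntegral.integral_comp_sub_right
          (fun s => (A + g s • B) * v s * u T) T)).trans ?_
        rw [sub_self, hv.isFundamental.eq_integral _ hr, add_sub_cancel_left]
        simp only [intervalIntegral.integral_of_le hr.1]
        exact integral_mul_const_of_integrable
          ((intervalIntegrable_iff_integrableOn_Ioc_of_le hr.1).1 hi)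
      rw [← intervalIntegral.integral_add_adjacent_intervals (b := T)
        (hint.mono_set (uIcc_zero_subset ⟨hT, le_add_of_nonneg_right hS⟩))
        (hint.mono_set (by
          rw [uIcc_of_le htT, uIcc_of_le hTS]
          exact Icc_subset_Icc hT ht.2)),
        heq1 T ⟨hT, le_rfl⟩, e2, hw2 t ⟨htT, ht.2⟩, sub_mul]
      simp
  · rw [hw2 _ ⟨le_add_of_nonneg_right hr.1, by linarith [hr.2]⟩, add_sub_cancel_left]

/-- `g` can be reached from `1` in time exactly `T`. -/
def Reach (A B : 𝔸) (T : ℝ) (x : 𝔸) : Prop :=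
  ∃ f u, IsTrajectory A B T f u ∧ u T = x

lemma Reach.mul {x y : 𝔸} (hx : Reach A B T x) (hy : Reach A B S y) :
    Reach A B (T + S) (y * x) := by
  obtain ⟨f, u, hu, rfl⟩ := hx
  obtain ⟨g, v, hv, rfl⟩ := hy
  obtain ⟨h, w, hw, -, hw2⟩ := hu.concat hv
  exact ⟨h, w, hw, hw2 S ⟨hv.nonneg, le_rfl⟩⟩

lemma reach_exp (A B : 𝔸) (hT : 0 ≤ T) : Reach A B T (NormedSpace.exp (T • A)) :=
  ⟨fun _ => 0, _, isTrajectory_const A B 0 hT, by simp⟩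

lemma Reach.pow {x : 𝔸} (hx : Reach A B T x) (k : ℕ) : Reach A B (k * T) (x ^ k) := by
  induction k with
  | zero => simpa using reach_exp A B (le_refl (0 : ℝ))
  | succ k ih =>
    rw [pow_succ']
    convert! ih.mul hx using 1
    push_cast
    ring

end Trajectory

/-! ### Unitarity of trajectories for skew-adjoint generators. -/

section Unitarity

variable {𝔸 : Type*} [NormedRing 𝔸] [NormedAlgebra ℝ 𝔸] [CompleteSpace 𝔸] [StarRing 𝔸]
  [StarModule ℝ 𝔸] [ContinuousStar 𝔸] [IsDedekindFiniteMonoid 𝔸]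
  {A B : 𝔸} {T S : ℝ} {f g : ℝ → ℝ} {u v : ℝ → 𝔸}

/-- For skew-adjoint `A` and `B` the adjoint of the equation for `u` is the equation of its left
inverse. -/
lemma IsTrajectory.star_mul_self (hA : star A = -A) (hB : star B = -B)
    (h : IsTrajectory A B T f u) {t : ℝ} (ht : t ∈ Icc 0 T) : star (u t) * u t = 1 := by
  refine h.isFundamental.adjoint_mul h.nonneg h.intervalIntegrable
    h.isFundamental.continuousOn.star (fun t ht => ?_) t ht
  have h1 := (intervalIntegrable_mul_continuousOn h.nonneg h.intervalIntegrable
    h.isFundamental.continuousOn).mono_set (uIcc_zero_subset ht)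
  have h2 := ContinuousLinearMap.intervalIntegral_comp_comm
    ((starL' ℝ : 𝔸 ≃L[ℝ] 𝔸) : 𝔸 →L[ℝ] 𝔸) h1
  simp only [ContinuousLinearEquiv.coe_coe, starL'_apply] at h2
  rw [h.isFundamental.eq_integral t ht, star_add, star_one, ← h2]
  congr 1
  refine intervalIntegral.integral_congr fun s _ => ?_
  simp only [star_mul, star_add, star_smul, hA, hB, star_trivial, mul_add, mul_neg,
    smul_neg, neg_add]

lemma IsTrajectory.mem_unitary (hA : star A = -A) (hB : star B = -B)
    (h : IsTrajectory A B T f u) {t : ℝ} (ht : t ∈ Icc 0 T) : u t ∈ unitary 𝔸 :=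
  Unitary.mem_iff.2 ⟨h.star_mul_self hA hB ht, mul_eq_one_comm.1 (h.star_mul_self hA hB ht)⟩

lemma Reach.mem_unitary (hA : star A = -A) (hB : star B = -B) {x : 𝔸} (h : Reach A B T x) :
    x ∈ unitary 𝔸 := by
  obtain ⟨f, u, hu, rfl⟩ := h
  exact hu.mem_unitary hA hB ⟨hu.nonneg, le_rfl⟩

end Unitarity

end

end QuantumControl

namespace QuantumControl

noncomputable section

open Set

set_option linter.unusedSectionVars false

/-- The joint linear dependence on a real parameter and a further linear parameter. -/
def jointLinear {P Y : Type*} [NormedAddCommGroup P] [NormedSpace ℝ P] [NormedAddCommGroup Y]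
    [NormedSpace ℝ Y] (K : Y) (κ : P →L[ℝ] Y) : (ℝ × P) →L[ℝ] Y :=
  (ContinuousLinearMap.toSpanSingleton ℝ K).coprod κ

lemma jointLinear_apply {P Y : Type*} [NormedAddCommGroup P] [NormedSpace ℝ P]
    [NormedAddCommGroup Y] [NormedSpace ℝ Y] (K : Y) (κ : P →L[ℝ] Y) (p : ℝ × P) :
    jointLinear K κ p = p.1 • K + κ p.2 := rfl

lemma jointLinear_zero_left {P Y : Type*} [NormedAddCommGroup P] [NormedSpace ℝ P]
    [NormedAddCommGroup Y] [NormedSpace ℝ Y] (K : Y) (κ : P →L[ℝ] Y) (p : P) :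
    jointLinear K κ (0, p) = κ p := by
  rw [jointLinear_apply, zero_smul, zero_add]

/-! ### A neighbourhood reachable uniformly in the perturbation. -/

section Openness

variable {𝔸 : Type*} [NormedRing 𝔸] [NormedAlgebra ℝ 𝔸] [CompleteSpace 𝔸] [StarRing 𝔸]
  [StarModule ℝ 𝔸] [ContinuousStar 𝔸] [IsDedekindFiniteMonoid 𝔸] [FiniteDimensional ℝ 𝔸]
  {A A' B : 𝔸} {T S : ℝ} {f g : ℝ → ℝ} {u v : ℝ → 𝔸}

/-- The span of the control operators in the interaction picture along a trajectory. -/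
def controlSpan (B : 𝔸) (T : ℝ) (u : ℝ → 𝔸) : Submodule ℝ 𝔸 :=
  Submodule.span ℝ ((fun t => star (u t) * (B * u t)) '' Icc 0 T)

/-- Integration of a continuous function against controls reaches the span of its values. -/
lemma exists_volterra_eq (hT : 0 < T) (C : Traj T 𝔸) {X : 𝔸}
    (hX : X ∈ Submodule.span ℝ (range C)) :
    ∃ α : ControlSpace T, volterra hT.le α C ⟨T, right_mem_Icc.2 hT.le⟩ = X := by
  let L : ControlSpace T →ₗ[ℝ] 𝔸 :=
    ((ContinuousMap.evalCLM ℝ (⟨T, right_mem_Icc.2 hT.le⟩ : Icc (0 : ℝ) T)).comp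
      ((volterra hT.le).flip C)).toLinearMap
  have hL : ∀ α, L α = volterra hT.le α C ⟨T, right_mem_Icc.2 hT.le⟩ := fun _ => rfl
  suffices h : Submodule.span ℝ (range C) ≤ LinearMap.range L by
    obtain ⟨α, hα⟩ := h hX
    exact ⟨α, hα⟩
  rw [Submodule.span_le]
  rintro _ ⟨t, rfl⟩
  -- A functional `ℓ` that kills the range but not `C t` is tested on the control `s ↦ ℓ (C s)`: the
  -- integral of `ℓ (C s)²` would be both zero and positive.
  by_contra hnot
  obtain ⟨ℓ, hℓ, hker⟩ := Submodule.exists_le_ker_of_notMem hnot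
  let ℓc : 𝔸 →L[ℝ] ℝ := LinearMap.toContinuousLinearMap ℓ
  have hc : Continuous fun s => ℓc (C.ext hT.le s) :=
    ℓc.continuous.comp (C.continuous_ext hT.le)
  have hm : MemLp (fun s => ℓc (C.ext hT.le s)) 2 (volume.restrict (Ioc 0 T)) :=
    MemLp.of_bound hc.aestronglyMeasurable (‖ℓc‖ * ‖C‖) (Filter.Eventually.of_forall fun s =>
      (ℓc.le_opNorm _).trans (mul_le_mul_of_nonneg_left (C.norm_ext_le hT.le s) (norm_nonneg _)))
  have h0 : ℓc (L (hm.toLp _)) = 0 := hker ⟨_, rfl⟩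
  rw [hL, volterra_apply, ← ContinuousLinearMap.intervalIntegral_comp_comm _
    (intervalIntegrable_smul _ (right_mem_Icc.2 hT.le) (C.continuous_ext hT.le).continuousOn)] at h0
  have h1 : ∫ s in (0 : ℝ)..T, ℓc (C.ext hT.le s) ^ 2 = 0 := by
    refine Eq.trans (intervalIntegral.integral_congr_ae_restrict ?_) h0
    rw [uIoc_of_le hT.le]
    filter_upwards [hm.coeFn_toLp] with s hs
    rw [hs, map_smul, smul_eq_mul, pow_two]
  have h2 : 0 < ∫ s in (0 : ℝ)..T, ℓc (C.ext hT.le s) ^ 2 := by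
    refine intervalIntegral.integral_pos hT (hc.pow 2).continuousOn (fun s _ => sq_nonneg _)
      ⟨t, t.2, ?_⟩
    rw [Traj.ext_coe]
    exact sq_pos_of_ne_zero hℓ
  exact h2.ne' h1

lemma driftOp_add_smul (hT : 0 ≤ T) (A A' : 𝔸) (ε : ℝ) :
    driftOp hT (A + ε • A') = driftOp hT A + ε • driftOp hT A' := by
  ext Y t
  have h1 : Continuous fun s => A * Y.ext hT s := continuous_const.mul (Y.continuous_ext hT)
  have h2 : Continuous fun s => ε • (A' * Y.ext hT s) :=
    (continuous_const.mul (Y.continuous_ext hT)).const_smul ε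
  have e : (driftOp hT A + ε • driftOp hT A') Y t = driftOp hT A Y t + ε • driftOp hT A' Y t := rfl
  rw [e, driftOp_apply, driftOp_apply, driftOp_apply, ← intervalIntegral.integral_smul,
    ← intervalIntegral.integral_add (h1.intervalIntegrable _ _) (h2.intervalIntegrable _ _)]
  simp only [add_mul, smul_mul_assoc]

/-- The control operator depending jointly on the perturbation parameter and the control. -/
def jointDrive (hT : 0 ≤ T) (A' B : 𝔸) :
    (ℝ × ControlSpace T) →L[ℝ] Traj T 𝔸 →L[ℝ] Traj T 𝔸 :=
  jointLinear (driftOp hT A') (drive hT B)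

lemma drift_add_jointDrive (hT : 0 ≤ T) (A A' B : 𝔸) (p : ℝ × ControlSpace T) :
    driftOp hT A + jointDrive hT A' B p = driftOp hT (A + p.1 • A') + drive hT B p.2 := by
  rw [driftOp_add_smul, add_assoc, jointDrive, jointLinear_apply]

lemma isUnit_joint (hT : 0 ≤ T) (A A' B : 𝔸) (p : ℝ × ControlSpace T) :
    IsUnit (1 - (driftOp hT A + jointDrive hT A' B p)) := by
  rw [drift_add_jointDrive]
  exact isUnit_drift_add_drive hT _ B p.2

lemma resolventOf_joint (hT : 0 ≤ T) (A A' B : 𝔸) (p : ℝ × ControlSpace T) :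
    resolventOf (driftOp hT A) (jointDrive hT A' B) p
      = resolventOf (driftOp hT (A + p.1 • A')) (drive hT B) p.2 := by
  rw [resolventOf, drift_add_jointDrive, resolventOf]

/-- Unitarity reads `2 Q = -Q²`, which for `‖Q‖ < 1` forces `Q = 0`. -/
lemma eq_zero_of_one_add_isSelfAdjoint_unitary {Q : 𝔸} (hQ : ‖Q‖ < 1) (hs : star Q = Q)
    (hu : star (1 + Q) * (1 + Q) = 1) : Q = 0 := by
  rw [star_add, star_one, hs] at hu
  have h1 : (2 : ℝ) • Q = -(Q * Q) := by
    have : 1 + Q + (Q + Q * Q) = 1 := by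
      rw [add_mul, one_mul, mul_add, mul_one] at hu
      exact hu
    rw [two_smul, eq_neg_iff_add_eq_zero]
    have h2 : 1 + (Q + Q + Q * Q) = 1 + 0 :=
      calc 1 + (Q + Q + Q * Q) = 1 + Q + (Q + Q * Q) := by abel
        _ = 1 + 0 := by rw [this, add_zero]
    exact add_left_cancel h2
  by_contra hne
  have h2 : 2 * ‖Q‖ ≤ ‖Q‖ * ‖Q‖ := by
    calc 2 * ‖Q‖ = ‖(2 : ℝ) • Q‖ := by rw [norm_smul, Real.norm_ofNat]
      _ ≤ _ := by rw [h1, norm_neg]; exact norm_mul_le _ _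
  have h3 : 0 < ‖Q‖ := norm_pos_iff.2 hne
  nlinarith

/-- If the linearization along one trajectory of the unperturbed system is onto, then a fixed
neighbourhood of its end point can be reached in the same time by all nearby systems. -/
lemma exists_nhds_reach (hA : star A = -A) (hA' : star A' = -A') (hB : star B = -B)
    (hT : 0 < T) (hu : IsTrajectory A B T f u)
    (hspan : ∀ X : 𝔸, star X = -X → X ∈ controlSpan B T u) :
    ∃ δ > (0 : ℝ), ∃ W ∈ nhds (u T), ∀ ε : ℝ, |ε| < δ → ∀ x ∈ unitary 𝔸, x ∈ W →
      Reach (A + ε • A') B T x := by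
  let f₀ : ControlSpace T := hu.memLp.toLp f
  let tT : Icc (0 : ℝ) T := ⟨T, right_mem_Icc.2 hT.le⟩
  let u₀ : ℝ → 𝔸 := (flowTraj hT.le A B f₀).ext hT.le
  have hu₀ : EqOn u u₀ (Icc 0 T) := hu.eqOn_flowTraj
  have htr : IsTrajectory A B T f₀ u₀ := isTrajectory_flowTraj hT.le A B f₀
  have huu : ∀ t ∈ Icc (0 : ℝ) T, u₀ t * star (u₀ t) = 1 := fun t ht =>
    mul_eq_one_comm.1 (htr.star_mul_self hA hB ht)
  let one : Traj T 𝔸 := ContinuousMap.const _ 1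
  let E : ℝ × ControlSpace T → 𝔸 := fun p =>
    resolventOf (driftOp hT.le A) (jointDrive hT.le A' B) p one tT
  have hE : ∀ p, E p = (flowTraj hT.le (A + p.1 • A') B p.2).ext hT.le T := fun p => by
    rw [Traj.ext_of_mem hT.le _ (right_mem_Icc.2 hT.le), flowTraj, ← resolventOf_joint]
  have hE0 : E (0, f₀) = u₀ T := by rw [hE]; simp [u₀]
  let E' : (ℝ × ControlSpace T) →L[ℝ] 𝔸 := (ContinuousMap.evalCLM ℝ tT).comp
    ((resolventOf (driftOp hT.le A) (jointDrive hT.le A' B) (0, f₀)).comp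
      ((jointDrive hT.le A' B).flip
        (resolventOf (driftOp hT.le A) (jointDrive hT.le A' B) (0, f₀) one)))
  have hdE : HasStrictFDerivAt E E' (0, f₀) :=
    (ContinuousMap.evalCLM ℝ tT).hasStrictFDerivAt.comp _
      (hasStrictFDerivAt_resolventOf_apply (isUnit_joint hT.le A A' B _) one)
  have hres : resolventOf (driftOp hT.le A) (jointDrive hT.le A' B) (0, f₀)
      = resolventOf (driftOp hT.le A) (drive hT.le B) f₀ := by
    rw [resolventOf_joint]; simp
  -- the derivative in the direction of the control
  let C : Traj T 𝔸 := ⟨fun t => star (u₀ t) * (B * u₀ t), by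
    have h : Continuous u₀ := Traj.continuous_ext hT.le _
    fun_prop⟩
  have hE'α : ∀ α : ControlSpace T, E' (0, α) = u₀ T * volterra hT.le α C tT := fun α => by
    have e1 : E' (0, α) = resolventOf (driftOp hT.le A) (drive hT.le B) f₀
        (drive hT.le B α (flowTraj hT.le A B f₀)) tT := by
      have : jointDrive hT.le A' B (0, α) = drive hT.le B α := by
        exact jointLinear_zero_left _ _ α
      simp only [E', ContinuousLinearMap.comp_apply, ContinuousLinearMap.flip_apply,
        ContinuousMap.evalCLM_apply, hres, this]
      rfl
    rw [e1, resolventOf_drive_apply hT.le htr.isFundamental htr.isFundamental.continuousOn.star huu,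
      volterra_apply]
    refine congrArg (fun z => u₀ T * z) ?_
    refine intervalIntegral.integral_congr fun s hs => ?_
    rw [uIcc_of_le hT.le] at hs
    simp only [Traj.ext_of_mem hT.le C hs]
    rfl
  have hrange : ∀ K : 𝔸, star K = -K → ∃ α : ControlSpace T, E' (0, α) = u₀ T * K := by
    intro K hK
    obtain ⟨α, hα⟩ := exists_volterra_eq hT C (X := K) (by
      have h := hspan K hK
      refine Submodule.span_mono ?_ h
      rintro _ ⟨t, ht, rfl⟩
      refine ⟨⟨t, ht⟩, ?_⟩
      change star (u₀ t) * (B * u₀ t) = star (u t) * (B * u t)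
      rw [hu₀ ht])
    exact ⟨α, by rw [hE'α, hα]⟩
  -- the joint map
  let st : 𝔸 →L[ℝ] 𝔸 := ((starL' ℝ : 𝔸 ≃L[ℝ] 𝔸) : 𝔸 →L[ℝ] 𝔸)
  let Hm : 𝔸 →L[ℝ] 𝔸 := ContinuousLinearMap.id ℝ 𝔸 + st
  have hHm : ∀ P, Hm P = P + star P := fun _ => rfl
  -- Controls produce only the tangent directions `u₀ T * K` with `K` skew-adjoint. The factor `1 +
  -- (P + star P)` supplies the self-adjoint ones, so the inverse function theorem applies in the
  -- full algebra; the first component keeps `ε` prescribed.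
  let Φ : (ℝ × ControlSpace T) × 𝔸 → ℝ × 𝔸 := fun q => (q.1.1, E q.1 * (1 + Hm q.2))
  have h1 : HasStrictFDerivAt (fun q : (ℝ × ControlSpace T) × 𝔸 => E q.1)
      (E'.comp (ContinuousLinearMap.fst ℝ _ _)) ((0, f₀), (0 : 𝔸)) :=
    HasStrictFDerivAt.comp (g := E) ((0, f₀), (0 : 𝔸)) hdE hasStrictFDerivAt_fst
  have h2 : HasStrictFDerivAt (fun q : (ℝ × ControlSpace T) × 𝔸 => 1 + Hm q.2)
      (Hm.comp (ContinuousLinearMap.snd ℝ _ _)) ((0, f₀), (0 : 𝔸)) :=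
    (Hm.hasStrictFDerivAt.comp _ hasStrictFDerivAt_snd).const_add 1
  have h3 := h1.mul' h2
  have h4 : HasStrictFDerivAt (fun q : (ℝ × ControlSpace T) × 𝔸 => q.1.1)
      ((ContinuousLinearMap.fst ℝ ℝ (ControlSpace T)).comp (ContinuousLinearMap.fst ℝ _ 𝔸))
      ((0, f₀), (0 : 𝔸)) :=
    ((ContinuousLinearMap.fst ℝ ℝ (ControlSpace T)).comp
      (ContinuousLinearMap.fst ℝ _ 𝔸)).hasStrictFDerivAt
  have hΦ := h4.prodMk h3
  have hmap := hΦ.map_nhds_eq_of_surj (by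
    refine LinearMap.range_eq_top.2 ?_
    rintro ⟨e, M⟩
    -- `N` is split into its skew-adjoint half, produced by a control, and its self-adjoint half,
    -- produced by `Hm`. The coefficient is `1/4` because `Hm` doubles self-adjoint elements.
    set N := star (u₀ T) * (M - E' (e, 0)) with hN
    obtain ⟨α, hα⟩ := hrange ((1 / 2 : ℝ) • (N - star N)) (by
      rw [star_smul, star_sub, star_star, star_trivial (1 / 2 : ℝ), ← smul_neg, neg_sub])
    refine ⟨((e, α), (1 / 4 : ℝ) • (N + star N)), ?_⟩
    have hP : Hm ((1 / 4 : ℝ) • (N + star N)) = (1 / 2 : ℝ) • (N + star N) := by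
      rw [hHm, star_smul, star_add, star_star, star_trivial (1 / 4 : ℝ), add_comm (star N), ← add_smul]
      norm_num
    have hsplit : E' (e, α) = E' (e, 0) + E' (0, α) := by
      rw [← map_add]; simp
    have hNN : u₀ T * N = M - E' (e, 0) := by
      rw [hN, ← mul_assoc, huu T (right_mem_Icc.2 hT.le), one_mul]
    have hfin : u₀ T * ((1 / 2 : ℝ) • (N + star N)) + E' (e, α) = M := by
      rw [hsplit, hα]
      have : u₀ T * ((1 / 2 : ℝ) • (N + star N)) + (E' (e, 0) + u₀ T * ((1 / 2 : ℝ) • (N - star N)))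
          = E' (e, 0) + u₀ T * ((1 / 2 : ℝ) • (N + star N) + (1 / 2 : ℝ) • (N - star N)) := by
        rw [mul_add]; abel
      rw [this, ← smul_add, add_add_sub_cancel, ← two_smul ℝ N, smul_smul]
      norm_num
      rw [hNN]
      abel
    refine Prod.ext rfl ?_
    change E (0, f₀) • Hm ((1 / 4 : ℝ) • (N + star N)) + MulOpposite.op (1 + Hm 0) • E' (e, α) = M
    rw [map_zero, add_zero, MulOpposite.op_one, one_smul, hP, hE0, smul_eq_mul]
    exact hfin)
  have hV : {q : (ℝ × ControlSpace T) × 𝔸 | ‖Hm q.2‖ < 1} ∈ nhds ((0, f₀), (0 : 𝔸)) := by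
    refine IsOpen.mem_nhds (isOpen_lt (by fun_prop) continuous_const) ?_
    simp
  have himg := Filter.image_mem_map (m := Φ) hV
  have hval : Φ ((0, f₀), (0 : 𝔸)) = (0, u T) := by
    simp [Φ, hE0, hu₀ (right_mem_Icc.2 hT.le)]
  change Filter.map Φ _ = nhds (Φ _) at hmap
  rw [hmap, hval, nhds_prod_eq, Filter.mem_prod_iff] at himg
  obtain ⟨D, hD, W, hW, hDW⟩ := himg
  obtain ⟨δ, hδ, hball⟩ := Metric.mem_nhds_iff.1 hD
  refine ⟨δ, hδ, W, hW, fun ε hε x hx hxW => ?_⟩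
  have hεD : ε ∈ D := hball (by simpa using hε)
  obtain ⟨⟨⟨e, α⟩, P⟩, hP, hPe⟩ := hDW (mk_mem_prod hεD hxW)
  have hee : e = ε := congrArg Prod.fst hPe
  have hx2 : E (e, α) * (1 + Hm P) = x := congrArg Prod.snd hPe
  subst hee
  have hAe : star (A + e • A') = -(A + e • A') := by
    rw [star_add, star_smul, hA, hA', star_trivial, smul_neg, neg_add]
  have htre := isTrajectory_flowTraj hT.le (A + e • A') B α
  have hun := htre.star_mul_self hAe hB (right_mem_Icc.2 hT.le)
  have hEe : E (e, α) = (flowTraj hT.le (A + e • A') B α).ext hT.le T := hE (e, α)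
  rw [← hEe] at hun
  -- Both the target and the end point are unitary, so the auxiliary self-adjoint factor is unitary
  -- and must be trivial.
  have hQ : Hm P = 0 := by
    refine eq_zero_of_one_add_isSelfAdjoint_unitary hP ?_ ?_
    · rw [hHm, star_add, star_star, add_comm]
    · have h5 := (Unitary.mem_iff.1 hx).1
      rw [← hx2, star_mul, mul_assoc, ← mul_assoc (star (E (e, α))), hun, one_mul] at h5
      exact h5
  rw [hQ, add_zero, mul_one] at hx2
  exact ⟨_, _, htre, by rw [← hEe, hx2]⟩

end Openness

end

end QuantumControl

namespace QuantumControl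

noncomputable section

open Set

set_option linter.unusedSectionVars false

/-! ### Spans of interaction-picture control operators. -/

section FullSpan

variable {𝔸 : Type*} [NormedRing 𝔸] [NormedAlgebra ℝ 𝔸] [CompleteSpace 𝔸] [StarRing 𝔸]
  [StarModule ℝ 𝔸] [ContinuousStar 𝔸] [IsDedekindFiniteMonoid 𝔸] [FiniteDimensional ℝ 𝔸]
  {A B : 𝔸} {T S : ℝ} {f g : ℝ → ℝ} {u v : ℝ → 𝔸}

/-- The span of the control operators in the interaction picture along all trajectories. -/
def fullSpan (A B : 𝔸) : Submodule ℝ 𝔸 :=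
  Submodule.span ℝ {X | ∃ T f u t, IsTrajectory A B T f u ∧ t ∈ Icc 0 T ∧
    star (u t) * (B * u t) = X}

/-- Conjugation `X ↦ x⋆ X x` as a linear map. -/
def conjMap (x : 𝔸) : 𝔸 →ₗ[ℝ] 𝔸 :=
  (LinearMap.mulRight ℝ x).comp (LinearMap.mulLeft ℝ (star x))

lemma conjMap_apply (x X : 𝔸) : conjMap x X = star x * X * x := rfl

lemma conjMap_conj (x y : 𝔸) : conjMap x (star y * (B * y)) = star (y * x) * (B * (y * x)) := by
  rw [conjMap_apply, star_mul]
  simp only [mul_assoc]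

lemma mem_fullSpan (A B : 𝔸) : B ∈ fullSpan A B := by
  refine Submodule.subset_span ⟨0, _, _, 0, isTrajectory_const A B 0 le_rfl, by simp, ?_⟩
  simp

lemma IsTrajectory.conjMap_mem_fullSpan (hu : IsTrajectory A B T f u) {X : 𝔸}
    (hX : X ∈ fullSpan A B) : conjMap (u T) X ∈ fullSpan A B := by
  suffices h : fullSpan A B ≤ (fullSpan A B).comap (conjMap (u T)) from h hX
  refine Submodule.span_le.2 ?_
  rintro _ ⟨S, g, v, t, hv, ht, rfl⟩
  obtain ⟨h, w, hw, -, hw2⟩ := hu.concat hv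
  refine Submodule.subset_span ⟨_, h, w, T + t, hw, ⟨by linarith [hu.nonneg, ht.1],
    by linarith [ht.2]⟩, ?_⟩
  rw [conjMap_conj, hw2 t ht]

/-- The span is stable under commutators with the drift and the control. -/
lemma commutator_mem_fullSpan (hA : star A = -A) (hB : star B = -B) (c : ℝ) {X : 𝔸}
    (hX : X ∈ fullSpan A B) : X * (A + c • B) - (A + c • B) * X ∈ fullSpan A B := by
  set M := A + c • B with hM
  have hsM : star M = -M := by
    rw [hM, star_add, star_smul, hA, hB, star_trivial, smul_neg, neg_add]
  let φ : ℝ → 𝔸 := fun t => NormedSpace.exp (t • -M) * X * NormedSpace.exp (t • M)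
  have hφL : ∀ t : ℝ, 0 ≤ t → φ t ∈ fullSpan A B := fun t ht => by
    have h := (isTrajectory_const A B c ht).conjMap_mem_fullSpan hX
    rw [conjMap_apply, NormedSpace.star_exp, star_smul, ← hM, hsM, star_trivial] at h
    exact h
  have hd : HasDerivAt φ (X * M - M * X) 0 := by
    have h1 := hasDerivAt_exp_smul_const (𝕂 := ℝ) (-M) 0
    have h2 := hasDerivAt_exp_smul_const (𝕂 := ℝ) M 0
    have h3 : HasDerivAt φ _ 0 := (h1.mul_const X).mul h2
    refine h3.congr_deriv ?_
    simp only [zero_smul, NormedSpace.exp_zero]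
    noncomm_ring
  have hcl : IsClosed (fullSpan A B : Set 𝔸) := Submodule.closed_of_finiteDimensional _
  -- Only forward times are available, so the commutator is obtained as a one-sided derivative in a
  -- closed subspace.
  refine hcl.mem_of_tendsto hd.tendsto_slope_zero_right ?_
  filter_upwards [self_mem_nhdsWithin] with t ht
  refine Submodule.smul_mem _ _ (Submodule.sub_mem _ (hφL _ ?_) (hφL 0 le_rfl))
  rw [zero_add]; exact le_of_lt ht

/-- There is one trajectory whose interaction picture already spans everything. -/
lemma exists_controlSpan_eq_fullSpan (hA : star A = -A) (hB : star B = -B) :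
    ∃ T f u, 0 < T ∧ IsTrajectory A B T f u ∧ controlSpan B T u = fullSpan A B := by
  let s : Set (Submodule ℝ 𝔸) :=
    {P | ∃ T f u, 0 < T ∧ IsTrajectory A B T f u ∧ controlSpan B T u = P}
  have hs : s.Nonempty := ⟨_, 1, _, _, one_pos, isTrajectory_const A B 0 zero_le_one, rfl⟩
  obtain ⟨P, ⟨T, f, u, hT, hu, rfl⟩, hmax⟩ :=
    (wellFounded_gt (α := Submodule ℝ 𝔸)).has_min s hs
  refine ⟨T, f, u, hT, hu, ?_⟩
  have hle : controlSpan B T u ≤ fullSpan A B := by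
    refine Submodule.span_mono ?_
    rintro _ ⟨t, ht, rfl⟩
    exact ⟨T, f, u, t, hu, ht, rfl⟩
  -- Any trajectory can be appended to the maximal one. By maximality the span does not grow, so it
  -- contains every conjugated generator; injectivity of the conjugation then matches dimensions.
  have hconj : (fullSpan A B).map (conjMap (u T)) ≤ controlSpan B T u := by
    rw [Submodule.map_le_iff_le_comap]
    refine Submodule.span_le.2 ?_
    rintro _ ⟨S, g, v, t, hv, ht, rfl⟩
    obtain ⟨h, w, hw, hw1, hw2⟩ := hu.concat hv
    have hsub : controlSpan B T u ≤ controlSpan B (T + S) w := by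
      refine Submodule.span_mono ?_
      rintro _ ⟨r, hr, rfl⟩
      exact ⟨r, ⟨hr.1, hr.2.trans (by linarith [hv.nonneg])⟩, by simp only [hw1 r hr]⟩
    have heq : controlSpan B T u = controlSpan B (T + S) w := by
      by_contra hne
      exact hmax _ ⟨T + S, h, w, by linarith [hv.nonneg], hw, rfl⟩ (lt_of_le_of_ne hsub hne)
    rw [heq]
    refine Submodule.subset_span ⟨T + t, ⟨by linarith [hT, ht.1], by linarith [ht.2]⟩, ?_⟩
    simp only [conjMap_conj, hw2 t ht]
  have hinj : Function.Injective (conjMap (u T)) := by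
    have h1 := Unitary.mem_iff.1 (hu.mem_unitary hA hB (right_mem_Icc.2 hT.le))
    refine Function.LeftInverse.injective (g := fun Y => u T * Y * star (u T)) fun X => ?_
    change u T * (star (u T) * X * u T) * star (u T) = X
    rw [mul_assoc, mul_assoc, mul_assoc, h1.2, mul_one, ← mul_assoc, h1.2, one_mul]
  refine Submodule.eq_of_le_of_finrank_le hle ?_
  rw [(Submodule.equivMapOfInjective _ hinj (fullSpan A B)).finrank_eq]
  exact Submodule.finrank_mono hconj

end FullSpan

/-! ### From the exact-time rank condition to a full span. -/

section Rank

attribute [local instance] Matrix.linftyOpNormedRing Matrix.linftyOpNormedAlgebra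

variable {n : ℕ} {H₀ H₁ : Matrix (Fin n) (Fin n) ℂ}

lemma continuousStar_matrix (n : ℕ) : @ContinuousStar (Matrix (Fin n) (Fin n) ℂ)
    (Matrix.linftyOpNormedRing : NormedRing (Matrix (Fin n) (Fin n)
      ℂ)).toMetricSpace.toPseudoMetricSpace.toUniformSpace.toTopologicalSpace _ :=
  ⟨continuous_id.matrix_conjTranspose⟩

attribute [local instance] continuousStar_matrix

/-- A space stable under commutators with `A` and `B` which contains `B` contains all
commutators of bracket words. -/
lemma IsBracketWord.commutator_mem {A B : Matrix (Fin n) (Fin n) ℂ}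
    {L : Submodule ℝ (Matrix (Fin n) (Fin n) ℂ)} (hA : ∀ X ∈ L, X * A - A * X ∈ L)
    (hB : ∀ X ∈ L, X * B - B * X ∈ L) (hBL : B ∈ L) {X Y : Matrix (Fin n) (Fin n) ℂ}
    (hX : IsBracketWord A B X) (hY : IsBracketWord A B Y) : X * Y - Y * X ∈ L := by
  -- The drift `A` need not lie in `L`; it is the only word allowed outside, which is where the
  -- exact-time condition differs from the ordinary one.
  have key : ∀ Z, IsBracketWord A B Z → (∀ X ∈ L, X * Z - Z * X ∈ L) ∧ (Z = A ∨ Z ∈ L) := by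
    have comm : ∀ X Y, ((∀ W ∈ L, W * X - X * W ∈ L) ∧ (X = A ∨ X ∈ L)) →
        ((∀ W ∈ L, W * Y - Y * W ∈ L) ∧ (Y = A ∨ Y ∈ L)) → X * Y - Y * X ∈ L := by
      rintro V W ⟨hV, hV'⟩ ⟨hW, hW'⟩
      rcases hV' with rfl | hV'
      · rcases hW' with rfl | hW'
        · simp
        · rw [← neg_sub]
          exact L.neg_mem (hV _ hW')
      · exact hW _ hV'
    intro Z hZ
    induction hZ with
    | fst => exact ⟨hA, Or.inl rfl⟩
    | snd => exact ⟨hB, Or.inr hBL⟩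
    | @bracket X Y _ _ ihX ihY =>
      refine ⟨fun W hW => ?_, Or.inr (comm X Y ihX ihY)⟩
      -- The Jacobi identity `[W,[X,Y]] = [[W,X],Y] - [[W,Y],X]`.
      have h := L.sub_mem (ihY.1 _ (ihX.1 W hW)) (ihX.1 _ (ihY.1 W hW))
      convert h using 1
      noncomm_ring
  rcases (key X hX).2 with rfl | hX'
  · rcases (key Y hY).2 with rfl | hY'
    · simp
    · rw [← neg_sub]
      exact L.neg_mem (hA _ hY')
  · exact (key Y hY).1 _ hX'

/-- Under the exact-time rank condition, some trajectory has full interaction picture span. -/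
lemma ExactTimeRankCondition.exists_controlSpan (h : ExactTimeRankCondition H₀ H₁)
    (h₀ : H₀ᴴ = H₀) (h₁ : H₁ᴴ = H₁) :
    ∃ T f u, 0 < T ∧ IsTrajectory (-Complex.I • H₀) (-Complex.I • H₁) T f u ∧
      ∀ X, star X = -X → X ∈ controlSpan (-Complex.I • H₁) T u := by
  have hA : star (-Complex.I • H₀) = -(-Complex.I • H₀) := by
    simp [Matrix.star_eq_conjTranspose, h₀]
  have hB : star (-Complex.I • H₁) = -(-Complex.I • H₁) := by
    simp [Matrix.star_eq_conjTranspose, h₁]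
  obtain ⟨T, f, u, hT, hu, hspan⟩ := exists_controlSpan_eq_fullSpan hA hB
  refine ⟨T, f, u, hT, hu, fun X hX => ?_⟩
  rw [hspan]
  set L := fullSpan (-Complex.I • H₀) (-Complex.I • H₁)
  have hBL : -Complex.I • H₁ ∈ L := mem_fullSpan _ _
  have hAs : ∀ X ∈ L, X * (-Complex.I • H₀) - (-Complex.I • H₀) * X ∈ L := fun X hX => by
    have := commutator_mem_fullSpan hA hB 0 hX
    rwa [zero_smul, add_zero] at this
  have hBs : ∀ X ∈ L, X * (-Complex.I • H₁) - (-Complex.I • H₁) * X ∈ L := fun X hX => by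
    have := L.sub_mem (commutator_mem_fullSpan hA hB 1 hX) (hAs X hX)
    convert this using 1
    rw [one_smul]
    noncomm_ring
  have hBL' : Complex.I • H₁ ∈ L := by simpa using L.neg_mem hBL
  have hX' : X ∈ {X : Matrix (Fin n) (Fin n) ℂ | Xᴴ = -X} := hX
  rw [← h] at hX'
  refine Submodule.span_le.2 ?_ hX'
  rintro Z (⟨V, W, hV, hW, rfl⟩ | rfl)
  · refine IsBracketWord.commutator_mem (fun X hX => ?_) (fun X hX => ?_) hBL' hV hW
    · simpa [sub_eq_add_neg, add_comm] using L.neg_mem (hAs X hX)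
    · simpa [sub_eq_add_neg, add_comm] using L.neg_mem (hBs X hX)
  · exact hBL'

end Rank

end

end QuantumControl

namespace QuantumControl

noncomputable section

open Set

set_option linter.unusedSectionVars false

/-! ### Recurrence and roots in the unitary group. -/

section UnitaryGroup

variable {𝔸 : Type*} [CStarAlgebra 𝔸]

/-- Powers of a unitary element of a finite-dimensional algebra return near the identity. -/
lemma exists_pow_mem_nhds_one [FiniteDimensional ℂ 𝔸] {g : 𝔸} (hg : g ∈ unitary 𝔸) {N : Set 𝔸}
    (hN : N ∈ nhds (1 : 𝔸)) : ∃ k : ℕ, g ^ (k + 1) ∈ N := by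
  have : ProperSpace 𝔸 := FiniteDimensional.proper ℂ 𝔸
  have hb : Bornology.IsBounded (unitary 𝔸 : Set 𝔸) := by
    rcases subsingleton_or_nontrivial 𝔸 with h | h
    · exact (Set.toFinite _).isBounded
    refine (Metric.isBounded_closedBall (x := (0 : 𝔸)) (r := 1)).subset fun u hu => ?_
    rw [mem_closedBall_zero_iff, CStarRing.norm_of_mem_unitary hu]
  have : CompactSpace (unitary 𝔸) :=
    isCompact_iff_compactSpace.1 (Metric.isCompact_of_isClosed_isBounded isClosed_unitary hb)
  have h1 := mapClusterPt_one_atTop_pow (⟨g, hg⟩ : unitary 𝔸)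
  have h2 : Subtype.val ⁻¹' N ∈ nhds (1 : unitary 𝔸) :=
    continuous_subtype_val.continuousAt.preimage_mem_nhds hN
  obtain ⟨k, hk1, hk2⟩ := ((h1.frequently h2).and_eventually
    (Filter.eventually_ge_atTop 1)).exists
  refine ⟨k - 1, ?_⟩
  rw [Nat.sub_add_cancel hk2]
  exact hk1

/-- Every unitary element with finite spectrum is the exponential of a skew-adjoint element of
universally bounded norm. -/
lemma exists_exp_eq_of_finite_spectrum {g : 𝔸} (hg : g ∈ unitary 𝔸)
    (hfin : (spectrum ℂ g).Finite) :
    ∃ x : 𝔸, star x = -x ∧ ‖x‖ ≤ Real.pi + Real.pi * ‖(1 : 𝔸)‖ ∧ NormedSpace.exp x = g := by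
  -- A finite spectrum leaves an angle `θ` with `-exp (iθ)` outside it; after rotating by `-θ` the
  -- value `-1` is avoided and the principal logarithm exists.
  obtain ⟨θ, hθ, hθs⟩ := (Ioc_infinite (neg_lt_self Real.pi_pos)).exists_notMem_finset
    (hfin.image fun z => Complex.arg (-z)).toFinset
  set z : ℂ := Complex.exp (θ * Complex.I) with hz
  have hzz : Complex.exp (-(θ * Complex.I)) * z = 1 := by
    rw [hz, ← Complex.exp_add, neg_add_cancel, Complex.exp_zero]
  have hzn : -z ∉ spectrum ℂ g := fun h => by
    refine hθs ((Finite.mem_toFinset _).2 ⟨-z, h, ?_⟩)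
    change Complex.arg (- -z) = θ
    rw [neg_neg, hz, Complex.exp_mul_I, Complex.arg_cos_add_sin_mul_I hθ]
  have hstar : star (Complex.exp (-(θ * Complex.I))) = z := by
    rw [hz, Complex.star_def, ← Complex.exp_conj]
    simp
  set u : 𝔸 := Complex.exp (-(θ * Complex.I)) • g with hu
  have hum : u ∈ unitary 𝔸 := by
    have h := Unitary.mem_iff.1 hg
    refine Unitary.mem_iff.2 ⟨?_, ?_⟩
    · rw [hu, star_smul, smul_mul_smul_comm, h.1, hstar, mul_comm, hzz, one_smul]
    · rw [hu, star_smul, smul_mul_smul_comm, h.2, hstar, hzz, one_smul]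
  have hlt : ‖((⟨u, hum⟩ : unitary 𝔸) : 𝔸) - 1‖ < 2 := by
    refine (Unitary.norm_sub_one_lt_two_iff hum).2 fun h => hzn ?_
    have h2 := (spectrum.smul_mem_smul_iff (s := (-z : ℂ)) (a := g)
      (r := Units.mk0 _ (Complex.exp_ne_zero (-(θ * Complex.I))))).1
    refine h2 ?_
    rw [Units.smul_def, Units.smul_def, Units.val_mk0, smul_eq_mul, mul_neg, hzz]
    exact h
  set x := Unitary.argSelfAdjoint ⟨u, hum⟩ with hx
  have hexp : NormedSpace.exp (Complex.I • (x : 𝔸)) = u := by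
    have := congrArg Subtype.val (expUnitary_argSelfAdjoint hlt)
    rwa [selfAdjoint.expUnitary_coe] at this
  have hxs : star (x : 𝔸) = x := x.2
  let : NormedAlgebra ℚ 𝔸 := NormedAlgebra.restrictScalars ℚ ℂ 𝔸
  refine ⟨Complex.I • (x : 𝔸) + algebraMap ℂ 𝔸 (θ * Complex.I), ?_, ?_, ?_⟩
  · rw [star_add, star_smul, hxs, ← algebraMap_star_comm]
    simp [add_comm]
  · refine (norm_add_le _ _).trans (add_le_add ?_ ?_)
    · rw [norm_smul, Complex.norm_I, one_mul]
      exact Unitary.norm_argSelfAdjoint_le_pi _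
    · rw [norm_algebraMap, norm_mul, Complex.norm_I, mul_one, Complex.norm_real]
      exact mul_le_mul_of_nonneg_right (abs_le.2 ⟨hθ.1.le, hθ.2⟩) (norm_nonneg _)
  · rw [NormedSpace.exp_add_of_commute (Algebra.commutes _ _).symm, hexp,
      ← NormedSpace.algebraMap_exp_comm, ← Complex.exp_eq_exp_ℂ, ← Algebra.commutes,
      ← Algebra.smul_def, hu, smul_smul, mul_comm, hzz, one_smul]

/-- All unitary elements have roots of one common order in a given neighbourhood of `1`. -/
lemma exists_root_mem_nhds_one (hfin : ∀ g : 𝔸, (spectrum ℂ g).Finite) {N : Set 𝔸}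
    (hN : N ∈ nhds (1 : 𝔸)) :
    ∃ m : ℕ, ∀ g ∈ unitary 𝔸, ∃ h ∈ unitary 𝔸, h ∈ N ∧ h ^ m = g := by
  let : NormedAlgebra ℚ 𝔸 := NormedAlgebra.restrictScalars ℚ ℂ 𝔸
  have h0 : (NormedSpace.exp : 𝔸 → 𝔸) ⁻¹' N ∈ nhds (0 : 𝔸) := by
    refine NormedSpace.exp_continuous.continuousAt.preimage_mem_nhds ?_
    rwa [NormedSpace.exp_zero]
  obtain ⟨r, hr, hball⟩ := Metric.mem_nhds_iff.1 h0
  -- The logarithms are bounded uniformly over the unitary elements, so one root order `m` serves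
  -- all of them.
  obtain ⟨m, hm⟩ := exists_nat_gt ((Real.pi + Real.pi * ‖(1 : 𝔸)‖) / r)
  have hm0 : (0 : ℝ) < m := lt_of_le_of_lt (by positivity) hm
  refine ⟨m, fun g hg => ?_⟩
  obtain ⟨x, hxs, hxn, rfl⟩ := exists_exp_eq_of_finite_spectrum hg (hfin g)
  refine ⟨NormedSpace.exp ((m : ℝ)⁻¹ • x), ?_, hball ?_, ?_⟩
  · have hs : star (NormedSpace.exp ((m : ℝ)⁻¹ • x)) = NormedSpace.exp (-((m : ℝ)⁻¹ • x)) := by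
      rw [NormedSpace.star_exp, star_smul, star_trivial, hxs, smul_neg]
    rw [Unitary.mem_iff, hs, ← NormedSpace.exp_add_of_commute (Commute.refl _).neg_left,
      ← NormedSpace.exp_add_of_commute (Commute.refl _).neg_right, neg_add_cancel,
      add_neg_cancel, NormedSpace.exp_zero]
    exact ⟨rfl, rfl⟩
  · rw [mem_ball_zero_iff, norm_smul, norm_inv, Real.norm_natCast, inv_mul_lt_iff₀ hm0]
    rw [div_lt_iff₀ hr] at hm
    exact hxn.trans_lt hm
  · rw [← NormedSpace.exp_nsmul, ← Nat.cast_smul_eq_nsmul ℝ, smul_smul, mul_inv_cancel₀ hm0.ne',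
      one_smul]

end UnitaryGroup

/-! ### Controllability at one time, then at all later times. -/

section Controllability

section Abstract

variable {𝔸 : Type*} [NormedRing 𝔸] [NormedAlgebra ℝ 𝔸] [CompleteSpace 𝔸] [StarRing 𝔸]
  [StarModule ℝ 𝔸] [ContinuousStar 𝔸] [IsDedekindFiniteMonoid 𝔸] [FiniteDimensional ℝ 𝔸]
  {A A' B : 𝔸} {T : ℝ} {f : ℝ → ℝ} {u : ℝ → 𝔸}

/-- A trajectory with full interaction picture span makes all nearby systems controllable at one
common time. -/
lemma exists_reach_unitary
    (hrec : ∀ g ∈ unitary 𝔸, ∀ N ∈ nhds (1 : 𝔸), ∃ k : ℕ, g ^ (k + 1) ∈ N)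
    (hroot : ∀ N ∈ nhds (1 : 𝔸), ∃ m : ℕ, ∀ g ∈ unitary 𝔸, ∃ h ∈ unitary 𝔸, h ∈ N ∧ h ^ m = g)
    (hA : star A = -A) (hA' : star A' = -A') (hB : star B = -B)
    (hT : 0 < T) (hu : IsTrajectory A B T f u)
    (hspan : ∀ X : 𝔸, star X = -X → X ∈ controlSpan B T u) :
    ∃ S : ℝ, 0 ≤ S ∧ ∃ δ > (0 : ℝ), ∀ ε : ℝ, |ε| < δ → ∀ x ∈ unitary 𝔸,
      Reach (A + ε • A') B S x := by
  obtain ⟨δ, hδ, W, hW, hreach⟩ := exists_nhds_reach hA hA' hB hT hu hspan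
  set g := u T with hg
  have hgu : g ∈ unitary 𝔸 := hu.mem_unitary hA hB (right_mem_Icc.2 hT.le)
  obtain ⟨hg1, hg2⟩ := Unitary.mem_iff.1 hgu
  have hN0 : (fun z : 𝔸 => star z * g) ⁻¹' interior W ∈ nhds (1 : 𝔸) := by
    refine ContinuousAt.preimage_mem_nhds (by fun_prop) ?_
    rw [star_one, one_mul]
    exact interior_mem_nhds.2 hW
  -- If `g ^ (k + 1)` is close to `1`, then `g ^ (-k)` is close to `g`, hence inside the reachable
  -- neighbourhood.
  obtain ⟨k, hk⟩ := hrec g hgu _ hN0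
  have hk' : star (g ^ k) ∈ interior W := by
    have : star (g ^ (k + 1)) * g = star (g ^ k) := by
      rw [pow_succ', star_mul, mul_assoc, hg1, mul_one]
    rwa [mem_preimage, this] at hk
  have hN1 : (fun h : 𝔸 => star (g ^ k) * h) ⁻¹' W ∈ nhds (1 : 𝔸) := by
    refine ContinuousAt.preimage_mem_nhds (by fun_prop) ?_
    rw [mul_one]
    exact mem_interior_iff_mem_nhds.1 hk'
  obtain ⟨m, hm⟩ := hroot _ hN1
  have hgk : g ^ k ∈ unitary 𝔸 := pow_mem hgu k
  refine ⟨m * (T + k * T), by positivity, δ, hδ, fun ε hε x hx => ?_⟩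
  obtain ⟨h, hh, hhW, rfl⟩ := hm x hx
  refine Reach.pow ?_ m
  have h1 : Reach (A + ε • A') B T (star (g ^ k) * h) :=
    hreach ε hε _ (mul_mem (Unitary.star_mem hgk) hh) hhW
  have h2 : Reach (A + ε • A') B (k * T) (g ^ k) :=
    (hreach ε hε g hgu (mem_of_mem_nhds hW)).pow k
  -- First `g ^ (-k) h`, then `g ^ k`: every `h` near `1` is reached in time `T + k T`, and `m`
  -- repetitions reach its `m`-th power.
  have h3 := h1.mul h2
  rwa [← mul_assoc, (Unitary.mem_iff.1 hgk).2, one_mul] at h3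

/-- Controllability at one time persists at later times. -/
lemma Reach.unitary_of_le (hA : star A = -A) (hB : star B = -B) {S : ℝ}
    (h : ∀ x ∈ unitary 𝔸, Reach A B S x) (hST : S ≤ T) {x : 𝔸} (hx : x ∈ unitary 𝔸) :
    Reach A B T x := by
  have h1 := reach_exp A B (sub_nonneg.2 hST)
  have hy := h1.mem_unitary hA hB
  -- The excess time is spent on free drift to `y`; the target of the remaining steering is then `x
  -- * star y`.
  have h2 := h1.mul (h _ (mul_mem hx (Unitary.star_mem hy)))
  rwa [sub_add_cancel, mul_assoc, (Unitary.mem_iff.1 hy).1, mul_one] at h2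

end Abstract

section MatrixTopology

open scoped Matrix.Norms.L2Operator

/-- The C⋆-norm is needed only in the proof. Only neighbourhoods of `1` are mentioned, so the result
can be used with another norm of the same topology. -/
lemma exists_pow_mem_nhds_one_matrix {n : ℕ} {g : Matrix (Fin n) (Fin n) ℂ}
    (hg : g ∈ unitary (Matrix (Fin n) (Fin n) ℂ)) {N : Set (Matrix (Fin n) (Fin n) ℂ)}
    (hN : N ∈ nhds 1) : ∃ k : ℕ, g ^ (k + 1) ∈ N :=
  exists_pow_mem_nhds_one hg hN

lemma exists_root_mem_nhds_one_matrix {n : ℕ} {N : Set (Matrix (Fin n) (Fin n) ℂ)}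
    (hN : N ∈ nhds 1) : ∃ m : ℕ, ∀ g ∈ unitary (Matrix (Fin n) (Fin n) ℂ),
      ∃ h ∈ unitary (Matrix (Fin n) (Fin n) ℂ), h ∈ N ∧ h ^ m = g := by
  have hfin : ∀ g : Matrix (Fin n) (Fin n) ℂ, (spectrum ℂ g).Finite := fun g =>
    Matrix.finite_spectrum g
  exact exists_root_mem_nhds_one hfin hN

end MatrixTopology

attribute [local instance] Matrix.linftyOpNormedRing Matrix.linftyOpNormedAlgebra
  continuousStar_matrix

variable {n : ℕ} {H₀ H₁ : Matrix (Fin n) (Fin n) ℂ}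

lemma controllableAt_of_reach {T : ℝ} (h : ∀ x ∈ unitary (Matrix (Fin n) (Fin n) ℂ),
    Reach (-Complex.I • H₀) (-Complex.I • H₁) T x) : ControllableAt H₀ H₁ T := by
  intro g hg
  obtain ⟨f, u, hu, rfl⟩ := h g hg
  have hT := hu.nonneg
  refine ⟨hu.memLp.toLp f, ?_⟩
  have hmem := right_mem_Icc.2 hT
  rw [hu.eqOn_flowTraj hmem]
  exact ((isPropagator_iff hT).1 (isPropagator_propagator hT H₀ H₁ _)).eqOn_flowTraj hT hmem

/-- The exact-time rank condition gives controllability of all nearby systems at all late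
times. -/
theorem ExactTimeRankCondition.exists_controllableAt (h : ExactTimeRankCondition H₀ H₁)
    (h₀ : H₀ᴴ = H₀) (h₁ : H₁ᴴ = H₁) {H' : Matrix (Fin n) (Fin n) ℂ} (h' : H'ᴴ = H') :
    ∃ S : ℝ, 0 ≤ S ∧ ∃ δ > (0 : ℝ), ∀ ε : ℝ, |ε| < δ → ∀ T : ℝ, S ≤ T →
      ControllableAt (H₀ + ε • H') H₁ T := by
  have key : ∀ H : Matrix (Fin n) (Fin n) ℂ, Hᴴ = H →
      star (-Complex.I • H) = -(-Complex.I • H) := fun H hH => by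
    simp [Matrix.star_eq_conjTranspose, hH]
  obtain ⟨T, f, u, hT, hu, hspan⟩ := h.exists_controlSpan h₀ h₁
  obtain ⟨S, hS, δ, hδ, hreach⟩ := exists_reach_unitary
    (fun g hg N hN => exists_pow_mem_nhds_one_matrix hg hN)
    (fun N hN => exists_root_mem_nhds_one_matrix hN) (key _ h₀) (key _ h') (key _ h₁) hT hu hspan
  refine ⟨S, hS, δ, hδ, fun ε hε T hT => controllableAt_of_reach fun x hx => ?_⟩
  have hH : (H₀ + ε • H')ᴴ = H₀ + ε • H' := by
    rw [conjTranspose_add, conjTranspose_smul, h₀, h', star_trivial]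
  refine Reach.unitary_of_le (key _ hH) (key _ h₁) (fun y hy => ?_) hT hx
  rw [smul_add, smul_comm]
  exact hreach ε hε y hy

lemma drift_conjTranspose (ε : ℝ) : (drift ε)ᴴ = drift ε := by
  ext i j
  fin_cases i <;> fin_cases j <;> simp [drift]

lemma control_conjTranspose (a b c : ℝ) : (control a b c)ᴴ = control a b c := by
  ext i j
  fin_cases i <;> fin_cases j <;> simp [control]

/-- The rank condition at `ε = 0` gives controllability at time `π / ε` for all small `ε`. -/
theorem exists_forall_controllableAt {a b c : ℝ}
    (h : ExactTimeRankCondition (drift 0) (control a b c)) :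
    ∃ ε₀ > (0 : ℝ), ∀ ε : ℝ, 0 < ε → ε < ε₀ →
      ControllableAt (drift ε) (control a b c) (Real.pi / ε) := by
  obtain ⟨S, hS, δ, hδ, hc⟩ := h.exists_controllableAt (drift_conjTranspose 0)
    (control_conjTranspose a b c) (H' := !![1, 0, 0; 0, 0, 0; 0, 0, 0]) (by
      ext i j
      fin_cases i <;> fin_cases j <;> simp)
  -- The bound `π / (S + 1)` guarantees `π / ε ≥ S`, and stays meaningful when `S = 0`.
  refine ⟨min δ (Real.pi / (S + 1)), lt_min hδ (by positivity), fun ε hε hlt => ?_⟩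
  have hd : drift ε = drift 0 + ε • !![1, 0, 0; 0, 0, 0; 0, 0, 0] := by
    ext i j
    fin_cases i <;> fin_cases j <;> simp [drift]
  rw [hd]
  refine hc ε (by rw [abs_of_pos hε]; exact hlt.trans_le (min_le_left _ _)) _ ?_
  have h1 := hlt.trans_le (min_le_right _ _)
  rw [lt_div_iff₀ (by positivity)] at h1
  rw [le_div_iff₀ hε]
  nlinarith

end Controllability

end

end QuantumControl

namespace QuantumControl

noncomputable section

open Set

set_option linter.unusedSectionVars false

/-! ### Verification of the rank condition in coordinates of `u(3)`. -/

section RankCondition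

lemma IsBracketWord.conjTranspose_eq {n : ℕ} {A B Z : Matrix (Fin n) (Fin n) ℂ} (hA : Aᴴ = -A)
    (hB : Bᴴ = -B) (h : IsBracketWord A B Z) : Zᴴ = -Z := by
  induction h with
  | fst => exact hA
  | snd => exact hB
  | bracket _ _ hX hY =>
    rw [conjTranspose_sub, conjTranspose_mul, conjTranspose_mul, hX, hY]
    noncomm_ring

/-- The span of the commutators of bracket words, joined with `i H₁`. -/
def rankSpan {n : ℕ} (H₀ H₁ : Matrix (Fin n) (Fin n) ℂ) :
    Submodule ℝ (Matrix (Fin n) (Fin n) ℂ) :=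
  Submodule.span ℝ
      ({Z | ∃ X Y, IsBracketWord (Complex.I • H₀) (Complex.I • H₁) X ∧
          IsBracketWord (Complex.I • H₀) (Complex.I • H₁) Y ∧ Z = X * Y - Y * X} ∪
        {Complex.I • H₁})

lemma rankSpan_subset {n : ℕ} {H₀ H₁ : Matrix (Fin n) (Fin n) ℂ} (h₀ : H₀ᴴ = H₀)
    (h₁ : H₁ᴴ = H₁) {X : Matrix (Fin n) (Fin n) ℂ} (hX : X ∈ rankSpan H₀ H₁) : Xᴴ = -X := by
  have hA : (Complex.I • H₀)ᴴ = -(Complex.I • H₀) := by simp [h₀]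
  have hB : (Complex.I • H₁)ᴴ = -(Complex.I • H₁) := by simp [h₁]
  refine Submodule.span_induction (p := fun Z _ => Zᴴ = -Z) ?_ (by simp)
    (fun V W _ _ hV hW => by rw [conjTranspose_add, hV, hW, neg_add])
    (fun r V _ hV => by rw [conjTranspose_smul, hV, star_trivial, smul_neg]) hX
  rintro Z (⟨V, W, hV, hW, rfl⟩ | rfl)
  · exact (hV.bracket hW).conjTranspose_eq hA hB
  · exact hB

/-- Both conclusions are needed: the first allows further bracketing, the second gives membership in
the span. -/
lemma IsBracketWord.commutator_mem_rankSpan {n : ℕ} {H₀ H₁ X Y Z : Matrix (Fin n) (Fin n) ℂ}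
    (hX : IsBracketWord (Complex.I • H₀) (Complex.I • H₁) X)
    (hY : IsBracketWord (Complex.I • H₀) (Complex.I • H₁) Y) (h : X * Y - Y * X = Z) :
    IsBracketWord (Complex.I • H₀) (Complex.I • H₁) Z ∧ Z ∈ rankSpan H₀ H₁ :=
  ⟨h ▸ hX.bracket hY, Submodule.subset_span (Or.inl ⟨X, Y, hX, hY, h.symm⟩)⟩

/-- A skew-Hermitian `3 × 3` matrix given by its real coordinates. -/
def skew (d₁ d₂ d₃ p q r p' q' r' : ℝ) : Matrix (Fin 3) (Fin 3) ℂ :=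
  !![⟨0, d₁⟩, ⟨p, p'⟩, ⟨q, q'⟩;
     ⟨-p, p'⟩, ⟨0, d₂⟩, ⟨r, r'⟩;
     ⟨-q, q'⟩, ⟨-r, r'⟩, ⟨0, d₃⟩]

lemma exists_skew_eq {X : Matrix (Fin 3) (Fin 3) ℂ} (hX : Xᴴ = -X) :
    ∃ d₁ d₂ d₃ p q r p' q' r' : ℝ, X = skew d₁ d₂ d₃ p q r p' q' r' := by
  have h : ∀ i j, (X j i).re = -(X i j).re ∧ (X j i).im = (X i j).im := fun i j => by
    have h := congrFun (congrFun hX i) j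
    rw [conjTranspose_apply, Matrix.neg_apply] at h
    have h1 := congrArg Complex.re h
    have h2 := congrArg Complex.im h
    simp only [Complex.star_def, Complex.conj_re, Complex.conj_im, Complex.neg_re,
      Complex.neg_im] at h1 h2
    exact ⟨h1, by linarith⟩
  refine ⟨(X 0 0).im, (X 1 1).im, (X 2 2).im, (X 0 1).re, (X 0 2).re, (X 1 2).re, (X 0 1).im,
    (X 0 2).im, (X 1 2).im, ?_⟩
  have hd : ∀ i, (X i i).re = 0 := fun i => by linarith [(h i i).1]
  ext i j
  fin_cases i <;> fin_cases j <;> apply Complex.ext <;>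
    simp [skew, hd, (h 0 1).1, (h 0 1).2, (h 0 2).1, (h 0 2).2, (h 1 2).1, (h 1 2).2]

lemma skew_commutator (d₁ d₂ d₃ p q r p' q' r' D₁ D₂ D₃ P Q R P' Q' R' : ℝ) :
    skew d₁ d₂ d₃ p q r p' q' r' * skew D₁ D₂ D₃ P Q R P' Q' R'
      - skew D₁ D₂ D₃ P Q R P' Q' R' * skew d₁ d₂ d₃ p q r p' q' r'
    = skew (2 * (p * P' - p' * P) + 2 * (q * Q' - q' * Q))
        (2 * (p' * P - p * P') + 2 * (r * R' - r' * R))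
        (2 * (q' * Q - q * Q') + 2 * (r' * R - r * R'))
        (P' * (d₂ - d₁) + p' * (D₁ - D₂) - q * R - q' * R' + r * Q + r' * Q')
        (Q' * (d₃ - d₁) + q' * (D₁ - D₃) + p * R - p' * R' - r * P + r' * P')
        (R' * (d₃ - d₂) + r' * (D₂ - D₃) - p * Q - p' * Q' + q * P + q' * P')
        (P * (d₁ - d₂) + p * (D₂ - D₁) + q * R' - q' * R + r * Q' - r' * Q)
        (Q * (d₁ - d₃) + q * (D₃ - D₁) + p * R' + p' * R - r * P' - r' * P)
        (R * (d₂ - d₃) + r * (D₃ - D₂) - p * Q' + p' * Q + q' * P - q * P') := by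
  ext i j
  fin_cases i <;> fin_cases j <;> apply Complex.ext <;>
    simp [skew] <;> ring

lemma skew_add (d₁ d₂ d₃ p q r p' q' r' D₁ D₂ D₃ P Q R P' Q' R' : ℝ) :
    skew d₁ d₂ d₃ p q r p' q' r' + skew D₁ D₂ D₃ P Q R P' Q' R'
      = skew (d₁ + D₁) (d₂ + D₂) (d₃ + D₃) (p + P) (q + Q) (r + R) (p' + P') (q' + Q')
        (r' + R') := by
  ext i j
  fin_cases i <;> fin_cases j <;> apply Complex.ext <;> simp [skew] <;> ring

lemma smul_skew (t d₁ d₂ d₃ p q r p' q' r' : ℝ) :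
    t • skew d₁ d₂ d₃ p q r p' q' r'
      = skew (t * d₁) (t * d₂) (t * d₃) (t * p) (t * q) (t * r) (t * p') (t * q') (t * r') := by
  ext i j
  fin_cases i <;> fin_cases j <;> apply Complex.ext <;> simp [skew]

/-- The exact-time rank condition holds as soon as the control Hamiltonian has nonzero trace. -/
theorem exactTimeRankCondition {a b c : ℝ} (h : a + b + c ≠ 0) :
    ExactTimeRankCondition (drift 0) (control a b c) := by
  refine Subset.antisymm (fun X hX => rankSpan_subset (drift_conjTranspose 0)
    (control_conjTranspose a b c) hX) fun X hX => ?_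
  change X ∈ rankSpan (drift 0) (control a b c)
  obtain ⟨d₁, d₂, d₃, p, q, r, p', q', r', rfl⟩ := exists_skew_eq hX
  have eA : Complex.I • drift 0 = skew 1 1 2 0 0 0 0 0 0 := by
    ext i j
    fin_cases i <;> fin_cases j <;> apply Complex.ext <;> simp [skew, drift]
  have eB : Complex.I • control a b c = skew a b c 0 0 0 1 0 1 := by
    ext i j
    fin_cases i <;> fin_cases j <;> apply Complex.ext <;> simp [skew, control]
  have wA : IsBracketWord (Complex.I • drift 0) (Complex.I • control a b c)
      (skew 1 1 2 0 0 0 0 0 0) := eA ▸ .fst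
  have wB : IsBracketWord (Complex.I • drift 0) (Complex.I • control a b c)
      (skew a b c 0 0 0 1 0 1) := eB ▸ .snd
  have mB : skew a b c 0 0 0 1 0 1 ∈ rankSpan (drift 0) (control a b c) :=
    eB ▸ Submodule.subset_span (Or.inr rfl)
  -- At `ε = 0` the drift is degenerate on the first two levels, so its bracket with the control
  -- isolates the coupling of levels two and three; the remaining couplings come from bracketing
  -- with it.
  obtain ⟨w1, m1⟩ := wA.commutator_mem_rankSpan wB (Z := skew 0 0 0 0 0 1 0 0 0)
    (by rw [skew_commutator]; congr 1 <;> ring)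
  obtain ⟨w2, m2⟩ := wA.commutator_mem_rankSpan w1 (Z := skew 0 0 0 0 0 0 0 0 (-1))
    (by rw [skew_commutator]; congr 1 <;> ring)
  obtain ⟨w3, m3⟩ := w1.commutator_mem_rankSpan w2 (Z := skew 0 (-2) 2 0 0 0 0 0 0)
    (by rw [skew_commutator]; congr 1 <;> ring)
  obtain ⟨w4, m4⟩ := w1.commutator_mem_rankSpan wB (Z := skew 0 2 (-2) 0 0 0 0 (-1) (c - b))
    (by rw [skew_commutator]; congr 1 <;> ring)
  obtain ⟨w5, m5⟩ := wA.commutator_mem_rankSpan w4 (Z := skew 0 0 0 0 (-1) (c - b) 0 0 0)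
    (by rw [skew_commutator]; congr 1 <;> ring)
  obtain ⟨w6, m6⟩ := w1.commutator_mem_rankSpan w4
    (Z := skew 0 (2 * (c - b)) (-2 * (c - b)) 0 0 0 (-1) 0 (-4))
    (by rw [skew_commutator]; congr 1 <;> ring)
  obtain ⟨w7, m7⟩ := w1.commutator_mem_rankSpan w5 (Z := skew 0 0 0 (-1) 0 0 0 0 0)
    (by rw [skew_commutator]; congr 1 <;> ring)
  obtain ⟨w8, m8⟩ := w6.commutator_mem_rankSpan w7
    (Z := skew (-2) 2 0 0 0 0 (2 * (c - b)) (-4) 0)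
    (by rw [skew_commutator]; congr 1 <;> ring)
  -- All commutators are traceless, so the trace fixes the coefficient of `i H₁`; this is the only
  -- use of `a + b + c ≠ 0`. The other coefficients follow by back substitution.
  obtain ⟨t, ht⟩ : ∃ t, t * (a + b + c) = d₁ + d₂ + d₃ := ⟨_, div_mul_cancel₀ _ h⟩
  obtain ⟨x8, h8⟩ : ∃ x, x = (t * a - d₁) / 2 := ⟨_, rfl⟩
  obtain ⟨x6, h6⟩ : ∃ x, x = t + 2 * (c - b) * x8 - p' := ⟨_, rfl⟩
  obtain ⟨x4, h4⟩ : ∃ x, x = -q' - 4 * x8 := ⟨_, rfl⟩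
  obtain ⟨x2, h2⟩ : ∃ x, x = t + (c - b) * x4 - 4 * x6 - r' := ⟨_, rfl⟩
  obtain ⟨x3, h3⟩ : ∃ x, x = (t * b + 2 * x4 + 2 * (c - b) * x6 + 2 * x8 - d₂) / 2 := ⟨_, rfl⟩
  have hsum : skew d₁ d₂ d₃ p q r p' q' r' = t • skew a b c 0 0 0 1 0 1
      + (r + (c - b) * q) • skew 0 0 0 0 0 1 0 0 0 + x2 • skew 0 0 0 0 0 0 0 0 (-1)
      + x3 • skew 0 (-2) 2 0 0 0 0 0 0 + x4 • skew 0 2 (-2) 0 0 0 0 (-1) (c - b)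
      + (-q) • skew 0 0 0 0 (-1) (c - b) 0 0 0
      + x6 • skew 0 (2 * (c - b)) (-2 * (c - b)) 0 0 0 (-1) 0 (-4)
      + (-p) • skew 0 0 0 (-1) 0 0 0 0 0
      + x8 • skew (-2) 2 0 0 0 0 (2 * (c - b)) (-4) 0 := by
    simp only [smul_skew, skew_add]
    congr 1 <;> linarith
  rw [hsum]
  have sm := fun (x : ℝ) {Z} (hZ : Z ∈ rankSpan (drift 0) (control a b c)) =>
    Submodule.smul_mem _ x hZ
  exact add_mem (add_mem (add_mem (add_mem (add_mem (add_mem (add_mem (add_mem (sm _ mB)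
    (sm _ m1)) (sm _ m2)) (sm _ m3)) (sm _ m4)) (sm _ m5)) (sm _ m6)) (sm _ m7)) (sm _ m8)

end RankCondition

/-! ### Values of the fidelity and its maximum. -/

section Values

attribute [local instance] Matrix.linftyOpNormedRing Matrix.linftyOpNormedAlgebra
  continuousStar_matrix

lemma propagator_mem_unitaryGroup {n : ℕ} {T : ℝ} (hT : 0 ≤ T)
    {H₀ H₁ : Matrix (Fin n) (Fin n) ℂ} (h₀ : H₀ᴴ = H₀) (h₁ : H₁ᴴ = H₁) (f : ControlSpace T) :
    propagator H₀ H₁ f T ∈ unitaryGroup (Fin n) ℂ := by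
  have key : ∀ H : Matrix (Fin n) (Fin n) ℂ, Hᴴ = H →
      star (-Complex.I • H) = -(-Complex.I • H) := fun H hH => by
    simp [Matrix.star_eq_conjTranspose, hH]
  have h := ((isPropagator_iff hT).1 (isPropagator_propagator hT H₀ H₁ f))
  exact IsTrajectory.mem_unitary (key _ h₀) (key _ h₁) ⟨hT, f.memLp, h⟩ (right_mem_Icc.2 hT)

/-- `Vᴴ U` is unitary, so each diagonal entry has real part at most one. -/
lemma gateFidelity_le_one {n : ℕ} (hn : 0 < n) {T : ℝ} (hT : 0 ≤ T)
    {H₀ H₁ V : Matrix (Fin n) (Fin n) ℂ} (h₀ : H₀ᴴ = H₀) (h₁ : H₁ᴴ = H₁)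
    (hV : V ∈ unitaryGroup (Fin n) ℂ) (f : ControlSpace T) : gateFidelity H₀ H₁ V f ≤ 1 := by
  have hW : Vᴴ * propagator H₀ H₁ f T ∈ unitaryGroup (Fin n) ℂ :=
    mul_mem (Unitary.star_mem hV) (propagator_mem_unitaryGroup hT h₀ h₁ f)
  rw [gateFidelity, trace, Complex.re_sum]
  have h : ∑ i, ((Vᴴ * propagator H₀ H₁ f T).diag i).re ≤ ∑ _i : Fin n, (1 : ℝ) :=
    Finset.sum_le_sum fun i _ => (Complex.re_le_norm _).trans (entry_norm_bound_of_unitary hW i i)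
  rw [Finset.sum_const, Finset.card_univ, Fintype.card_fin, nsmul_eq_mul, mul_one] at h
  rw [one_div, inv_mul_le_iff₀ (by exact_mod_cast hn), mul_one]
  exact h

/-- If a gate can be reached, then the maximal value of the gate fidelity is `1`. -/
lemma ControllableAt.isGreatest_gateFidelity {n : ℕ} (hn : 0 < n) {T : ℝ} (hT : 0 ≤ T)
    {H₀ H₁ V : Matrix (Fin n) (Fin n) ℂ} (hc : ControllableAt H₀ H₁ T) (h₀ : H₀ᴴ = H₀)
    (h₁ : H₁ᴴ = H₁) (hV : V ∈ unitaryGroup (Fin n) ℂ) :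
    IsGreatest (range (gateFidelity (T := T) H₀ H₁ V)) 1 := by
  refine ⟨?_, ?_⟩
  · obtain ⟨f, hf⟩ := hc V hV
    refine ⟨f, ?_⟩
    have h1 : Vᴴ * V = 1 := (Unitary.mem_iff.1 hV).1
    have hn' : (n : ℝ) ≠ 0 := by exact_mod_cast hn.ne'
    rw [gateFidelity, hf, h1, trace_one, Fintype.card_fin, Complex.natCast_re, one_div,
      inv_mul_cancel₀ hn']
  · rintro _ ⟨f, rfl⟩
    exact gateFidelity_le_one hn hT h₀ h₁ hV f

lemma diagonal_exp_mem_unitaryGroup {n : ℕ} (θ : Fin n → ℝ) :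
    (diagonal fun j => Complex.exp (θ j * Complex.I)) ∈ unitaryGroup (Fin n) ℂ := by
  rw [mem_unitaryGroup_iff, star_eq_conjTranspose, diagonal_conjTranspose, diagonal_mul_diagonal,
    ← diagonal_one]
  congr 1
  ext j
  rw [Pi.star_apply, Complex.star_def, ← Complex.exp_conj, ← Complex.exp_add]
  simp

lemma targetAdjoint_mem_unitaryGroup (s φ γ ε : ℝ) :
    targetAdjoint s φ γ ε ∈ unitaryGroup (Fin 3) ℂ := by
  rw [targetAdjoint_eq, freeInverse]
  exact mul_mem (diagonal_exp_mem_unitaryGroup _) (diagonal_exp_mem_unitaryGroup _)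

lemma isGreatest_trapFidelity {a b c ε : ℝ} (hε : 0 < ε)
    (hc : ControllableAt (drift ε) (control a b c) (Real.pi / ε)) (s φ γ : ℝ) :
    IsGreatest (range (trapFidelity s a b c φ γ ε)) 1 :=
  hc.isGreatest_gateFidelity (by norm_num) (by positivity) (drift_conjTranspose ε)
    (control_conjTranspose a b c) (Unitary.star_mem (targetAdjoint_mem_unitaryGroup s φ γ ε))

lemma trapFidelity_zero (s a b c φ γ : ℝ) {ε : ℝ} (hε : 0 < ε) :
    trapFidelity s a b c φ γ ε 0
      = 1 / 3 * (Real.cos φ - Real.sin γ - Real.sin (s * γ)) := by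
  have hT : 0 ≤ Real.pi / ε := by positivity
  have hp : propagator (drift ε) (control a b c) (0 : ControlSpace (Real.pi / ε)) (Real.pi / ε)
      = freeEvolution ε (Real.pi / ε) * 1 := by
    rw [mul_one]
    exact (isPropagator_propagator hT _ _ 0).eqOn hT
      ((isPropagator_iff hT).2 (isFundamental_freeEvolution a b c ε _)) (right_mem_Icc.2 hT)
  refine (fidelityFunctional_apply _ _).symm.trans ?_
  rw [hp, fidelityFunctional_freeEvolution_mul, Fin.sum_univ_three]
  simp only [one_apply_eq, mul_one, Complex.exp_ofReal_mul_I_re, gatePhase, cons_val_zero,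
    cons_val_one, cons_val, Real.cos_add_pi_div_two]
  ring

lemma exists_forall_isGreatest {a b c : ℝ} (h : a + b + c ≠ 0) (s φ γ : ℝ) :
    ∃ ε₀ > (0 : ℝ), ∀ ε : ℝ, 0 < ε → ε < ε₀ →
      ControllableAt (drift ε) (control a b c) (Real.pi / ε) ∧
      IsGreatest (range (trapFidelity s a b c φ γ ε)) 1 := by
  obtain ⟨ε₀, h0, hc⟩ := exists_forall_controllableAt (exactTimeRankCondition h)
  exact ⟨ε₀, h0, fun ε hε hlt => ⟨hc ε hε hlt, isGreatest_trapFidelity hε (hc ε hε hlt) s φ γ⟩⟩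

end Values

/-! ### The two explicit parameter choices. -/

section Parameters

lemma sin_two_pi_div_three : Real.sin (2 * Real.pi / 3) = √3 / 2 := by
  rw [show 2 * Real.pi / 3 = Real.pi - Real.pi / 3 by ring, Real.sin_pi_sub, Real.sin_pi_div_three]

lemma cos_two_pi_div_three : Real.cos (2 * Real.pi / 3) = -(1 / 2) := by
  rw [show 2 * Real.pi / 3 = Real.pi - Real.pi / 3 by ring, Real.cos_pi_sub, Real.cos_pi_div_three]

lemma sin_three_pi_div_four : Real.sin (3 * Real.pi / 4) = √2 / 2 := by
  rw [show 3 * Real.pi / 4 = Real.pi - Real.pi / 4 by ring, Real.sin_pi_sub, Real.sin_pi_div_four]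

lemma cos_three_pi_div_four : Real.cos (3 * Real.pi / 4) = -(√2 / 2) := by
  rw [show 3 * Real.pi / 4 = Real.pi - Real.pi / 4 by ring, Real.cos_pi_sub, Real.cos_pi_div_four]

lemma sqrt_two_thirds_mul_sqrt_three : √(2 / 3) * √3 = √2 := by
  rw [← Real.sqrt_mul (by norm_num)]
  norm_num

lemma sqrt_two_thirds_sq : √(2 / 3) ^ 2 = 2 / 3 := Real.sq_sqrt (by norm_num)

lemma sqrt_two_bounds : 1.414 < √2 ∧ √2 < 1.4143 :=
  ⟨Real.lt_sqrt_of_sq_lt (by norm_num), (Real.sqrt_lt' (by norm_num)).2 (by norm_num)⟩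

lemma sqrt_three_bounds : 1.732 < √3 ∧ √3 < 1.7321 :=
  ⟨Real.lt_sqrt_of_sq_lt (by norm_num), (Real.sqrt_lt' (by norm_num)).2 (by norm_num)⟩

lemma four_div_pi_bounds : 0 < 4 / Real.pi ∧ 4 / Real.pi < 1.2740 := by
  refine ⟨by positivity, ?_⟩
  rw [div_lt_iff₀ Real.pi_pos]
  linarith [Real.pi_gt_d2]

lemma trapConstraints_neg :
    TrapConstraints 4 (-1) (5 * √(2 / 3)) 4 1 (2 * Real.pi / 3) (-(3 * Real.pi / 4)) := by
  obtain ⟨l2, u2⟩ := sqrt_two_bounds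
  obtain ⟨l3, u3⟩ := sqrt_three_bounds
  obtain ⟨lp, up⟩ := four_div_pi_bounds
  refine ⟨?_, ?_, ?_, ?_, ?_⟩ <;>
    simp only [coeffW, coeffA, coeffX, coeffY, coeffZ, Real.sin_neg, Real.cos_neg,
      sin_two_pi_div_three, cos_two_pi_div_three, sin_three_pi_div_four, cos_three_pi_div_four]
  -- The factor `√(2/3)` in `a` turns `sin φ = √3/2` into a multiple of `√2`, which cancels `(b + c)
  -- cos γ`.
  · linarith [sqrt_two_thirds_mul_sqrt_three]
  -- Numerically `A ≈ 2.27` against `(4/π) x ≈ -2.00`, so the decimal bounds on `√2`, `√3` and `4/π`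
  -- suffice.
  · rw [mul_pow, sqrt_two_thirds_sq]
    nlinarith
  · linarith
  · linarith
  · linarith

lemma trapConstraints_pos :
    TrapConstraints 4 1 (√(2 / 3)) (-1) 0 (Real.pi / 3) (-(Real.pi / 4)) := by
  obtain ⟨l2, u2⟩ := sqrt_two_bounds
  obtain ⟨l3, u3⟩ := sqrt_three_bounds
  obtain ⟨lp, up⟩ := four_div_pi_bounds
  refine ⟨?_, ?_, ?_, ?_, ?_⟩ <;>
    simp only [coeffW, coeffA, coeffX, coeffY, coeffZ, Real.sin_neg, Real.cos_neg,
      Real.sin_pi_div_three, Real.cos_pi_div_three, Real.sin_pi_div_four, Real.cos_pi_div_four]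
  · linarith [sqrt_two_thirds_mul_sqrt_three]
  · rw [sqrt_two_thirds_sq]
    nlinarith
  · linarith
  · linarith
  · linarith

lemma trapFidelity_zero_neg {ε : ℝ} (hε : 0 < ε) :
    trapFidelity (-1) (5 * √(2 / 3)) 4 1 (2 * Real.pi / 3) (-(3 * Real.pi / 4)) ε 0
      = -(1 / 6) := by
  rw [trapFidelity_zero _ _ _ _ _ _ hε, neg_mul, one_mul, neg_neg, Real.sin_neg,
    sin_three_pi_div_four, cos_two_pi_div_three]
  ring

lemma trapFidelity_zero_pos {ε : ℝ} (hε : 0 < ε) :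
    trapFidelity 1 (√(2 / 3)) (-1) 0 (Real.pi / 3) (-(Real.pi / 4)) ε 0 = 1 / 6 + √2 / 3 := by
  rw [trapFidelity_zero _ _ _ _ _ _ hε, one_mul, Real.sin_neg, Real.sin_pi_div_four,
    Real.cos_pi_div_three]
  ring

end Parameters

end

end QuantumControl

open QuantumControl in
theorem mainTheorem3 :
    -- the gradient and the Hessian at `f ≡ 0`, and the sufficient conditions for attractiveness
    (∀ s a b c φ γ ε : ℝ, (s = 1 ∨ s = -1) → 0 < ε →
      -- every control has exactly one propagator on `[0, π/ε]`
      (∀ f : ControlSpace (Real.pi / ε),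
        IsPropagator (drift ε) (control a b c) f (propagator (drift ε) (control a b c) f) ∧
        ∀ U, IsPropagator (drift ε) (control a b c) f U →
          Set.EqOn U (propagator (drift ε) (control a b c) f) (Set.Icc 0 (Real.pi / ε))) ∧
      ContDiff ℝ 2 (trapFidelity s a b c φ γ ε) ∧
      -- the gradient at `f ≡ 0` is a constant function
      (∀ α : ControlSpace (Real.pi / ε),
        fderiv ℝ (trapFidelity s a b c φ γ ε) 0 α =
          ∫ t in (0 : ℝ)..(Real.pi / ε),
            (1 / 3 * a * Real.sin φ + 1 / 3 * (b + c) * Real.cos γ) * α t) ∧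
      -- the Hessian at `f ≡ 0` as an integral
      (∀ α β : ControlSpace (Real.pi / ε),
        hessian (trapFidelity s a b c φ γ ε) 0 α β =
          1 / 3 * ∫ τ in (0 : ℝ)..(Real.pi / ε), ∫ σ in (0 : ℝ)..τ,
            (coeffX φ γ * Real.sin (ε * (σ - τ)) - coeffA s a b c φ γ
              + coeffY s γ * Real.cos (σ - τ) - coeffZ φ γ * Real.cos (ε * (σ - τ)))
            * (α σ * β τ + α τ * β σ)) ∧
      -- the Hessian at `f ≡ 0` as a series of projections
      (∀ α β : ControlSpace (Real.pi / ε),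
        Summable (fun k : ℕ => 4 / (Real.pi * (4 * ((k : ℝ) + 1) ^ 2 - 1)) *
          (proj (fun t => Real.sin (2 * ((k : ℝ) + 1) * ε * t)) α β +
            proj (fun t => Real.cos (2 * ((k : ℝ) + 1) * ε * t)) α β)) ∧
        hessian (trapFidelity s a b c φ γ ε) 0 α β =
          - (1 / 3) * coeffW 2 s a b c φ γ * proj (fun _ => 1) α β
          + 1 / 3 * coeffX φ γ * ∑' k : ℕ, 4 / (Real.pi * (4 * ((k : ℝ) + 1) ^ 2 - 1)) *
              (proj (fun t => Real.sin (2 * ((k : ℝ) + 1) * ε * t)) α β +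
                proj (fun t => Real.cos (2 * ((k : ℝ) + 1) * ε * t)) α β)
          + 1 / 3 * coeffY s γ * (proj Real.cos α β + proj Real.sin α β)
          - 1 / 3 * coeffZ φ γ *
              (proj (fun t => Real.cos (ε * t)) α β + proj (fun t => Real.sin (ε * t)) α β)) ∧
      -- the constraints are sufficient
      (∀ κ : ℝ, 2 ≤ κ → TrapConstraints κ s a b c φ γ →
        IsAttractiveAtZero (trapFidelity s a b c φ γ ε))) ∧
    -- the rank condition at `ε = 0` gives controllability at time `π/ε` for all small `ε`
    (∀ a b c : ℝ, ExactTimeRankCondition (drift 0) (control a b c) →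
      ∃ ε₀ > (0 : ℝ), ∀ ε : ℝ, 0 < ε → ε < ε₀ →
        ControllableAt (drift ε) (control a b c) (Real.pi / ε)) ∧
    -- the choice of parameters with the sign `-`
    (TrapConstraints 4 (-1) (5 * √(2 / 3)) 4 1 (2 * Real.pi / 3) (-(3 * Real.pi / 4)) ∧
      ExactTimeRankCondition (drift 0) (control (5 * √(2 / 3)) 4 1) ∧
      (∀ ε : ℝ, 0 < ε →
        IsAttractiveAtZero
          (trapFidelity (-1) (5 * √(2 / 3)) 4 1 (2 * Real.pi / 3) (-(3 * Real.pi / 4)) ε) ∧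
        trapFidelity (-1) (5 * √(2 / 3)) 4 1 (2 * Real.pi / 3) (-(3 * Real.pi / 4)) ε 0
          = -(1 / 6)) ∧
      |(1 + (-(1 / 6) : ℝ)) / 2 - 42 / 100| < 1 / 200 ∧
      ∃ ε₀ > (0 : ℝ), ∀ ε : ℝ, 0 < ε → ε < ε₀ →
        ControllableAt (drift ε) (control (5 * √(2 / 3)) 4 1) (Real.pi / ε) ∧
        IsGreatest (Set.range
          (trapFidelity (-1) (5 * √(2 / 3)) 4 1 (2 * Real.pi / 3) (-(3 * Real.pi / 4)) ε)) 1) ∧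
    -- the choice of parameters with the sign `+`
    (TrapConstraints 4 1 (√(2 / 3)) (-1) 0 (Real.pi / 3) (-(Real.pi / 4)) ∧
      ExactTimeRankCondition (drift 0) (control (√(2 / 3)) (-1) 0) ∧
      (∀ ε : ℝ, 0 < ε →
        IsAttractiveAtZero (trapFidelity 1 (√(2 / 3)) (-1) 0 (Real.pi / 3) (-(Real.pi / 4)) ε) ∧
        trapFidelity 1 (√(2 / 3)) (-1) 0 (Real.pi / 3) (-(Real.pi / 4)) ε 0
          = 1 / 6 + √2 / 3) ∧
      |(1 + (1 / 6 + √2 / 3)) / 2 - 82 / 100| < 1 / 200 ∧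
      ∃ ε₀ > (0 : ℝ), ∀ ε : ℝ, 0 < ε → ε < ε₀ →
        ControllableAt (drift ε) (control (√(2 / 3)) (-1) 0) (Real.pi / ε) ∧
        IsGreatest (Set.range
          (trapFidelity 1 (√(2 / 3)) (-1) 0 (Real.pi / 3) (-(Real.pi / 4)) ε)) 1) := by
  refine ⟨fun s a b c φ γ ε hs hε => ?_, fun a b c h => exists_forall_controllableAt h, ?_, ?_⟩
  · have hT : 0 ≤ Real.pi / ε := by positivity
    exact ⟨fun f => ⟨isPropagator_propagator hT _ _ f,
        fun U hU => hU.eqOn hT (isPropagator_propagator hT _ _ f)⟩,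
      contDiff_trapFidelity s a b c φ γ hε, fderiv_trapFidelity_zero hs a b c φ γ hε,
      hessian_trapFidelity_zero hs a b c φ γ hε,
      fun α β => ⟨(hasSum_kernelForm hε α β).summable, hessian_eq_series hs a b c φ γ hε α β⟩,
      fun κ hκ h => isAttractiveAtZero hs hκ h hε⟩
  · have hne : 5 * √(2 / 3) + 4 + 1 ≠ 0 := by positivity
    exact ⟨trapConstraints_neg, exactTimeRankCondition hne, fun ε hε =>
      ⟨isAttractiveAtZero (Or.inr rfl) (by norm_num) trapConstraints_neg hε,
        trapFidelity_zero_neg hε⟩, by norm_num [abs_lt], exists_forall_isGreatest hne _ _ _⟩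
  · have hne : √(2 / 3) + -1 + 0 ≠ 0 := fun h => by
      have h1 : √(2 / 3) = 1 := by linarith
      have h2 := sqrt_two_thirds_sq
      rw [h1] at h2
      norm_num at h2
    refine ⟨trapConstraints_pos, exactTimeRankCondition hne, fun ε hε =>
      ⟨isAttractiveAtZero (Or.inl rfl) (by norm_num) trapConstraints_pos hε,
        trapFidelity_zero_pos hε⟩, ?_, exists_forall_isGreatest hne _ _ _⟩
    obtain ⟨l2, u2⟩ := sqrt_two_bounds
    rw [abs_lt]
    constructor <;> linarith
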